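/- **Setting.** Let $d\ge 1$, and let $\mathcal X$ be a probability distribution on $\mathbb R^d$ with $\|x\|=\sqrt d$ almost surely. Write $\tilde x=(x,1)\in\mathbb R^{d+1}$. Let $x_1,\dots,x_n$ ($n\ge1$) be i.i.d. from $\mathcal X$, with noise-free labels $y_i=(x_i^\top\beta)^p$, where $p\in\{0,1,2,\dots\}$ and $\|\beta\|\le 1$. The width-$m$ ReLU network is $f(x,w)=\sum_{j=1}^m \frac{a_j}{\sqrt m}\max(0,w_j^\top\tilde x)$. It is initialized with independent $a_j$ uniform on $\{1,-1\}$ (not trained) and $w_j(0)\sim\mathcal N(0,\kappa^2I_{d+1})$. It is trained by gradient descent $w(k+1)=w(k)-\eta\sum_{i=1}^n\nabla_w f(x_i,w(k))\,(f(x_i,w(k))-y_i)$, with the convention that the ReLU has derivative $1$ at $0$. Let $$K(x,x')=\tilde x^\top\tilde x'\,\frac{\pi-\arccos\left(\tilde x^\top\tilde x'/(d+1)\right)}{2\pi},\qquad H=(K(x_i,x_j))_{i,j=1}^n .$$ For $q\ge1$ put $c_{2q}=\frac{(2q-3)!!\,(d+1)}{2\pi(2q-2)!!\,(2q-1)}$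 with $(-1)!!=0!!=1$, and $$d_k=\tfrac14\mathbf 1_{\{k\le 1\}}+\sum_{q\ge\max(1,\lceil k/2\rceil)}\frac{c_{2q}}{(d+1)^{2q}}\binom{2q}{k},\qquad \phi(x)=[\sqrt{d_0},\sqrt{d_1}\,x,\sqrt{d_2}\,x^{\otimes2},\dots].$$ **Statement.** 1. For every $p\ge0$, $\|\beta\|\le1$ and $x\in\mathbb R^d$: $d_p>0$ and $(x^\top\beta)^p=\phi(x)^\top\bar w$, where $\bar w=[0,\dots,0,\frac1{\sqrt{d_p}}\beta^{\otimes p},0,\dots]$ has its nonzero block in place $p$. 2. If $\|x_i\|=\sqrt d$ for all $i$ and no two of the points $x_1,\dots,x_n$ are parallel, then $H$ is positive definite. 3. There are absolute constants $C,B,C_2,C_3>0$ such that for every $0<b\le B$ there is a real polynomial $P$ in four variables (depending only on $b$) with the following property. Let $d,\mathcal X,p,\beta,n$ be as above and $0<\delta\le\frac12$. With probability more than $1-\delta$ over the sample, for every $c>0$ with $H\succeq cI$, every width $m$, scale $\kappa>0$, step size $\eta>0$ and number of iterations $k$ such that $$b\,\frac{c\delta}{d^2n^{1.5}}\le\kappa^2\le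 B\,\frac{c\delta}{d^2n^{1.5}},\quad \eta\le C_2\frac{c}{(dn)^2},\quad m\ge P\!\left(n,\,d^{\max(p,1)/2},\,\tfrac1c,\,\tfrac1\delta\right),\quad k\ge C_3\,\frac{\log n+p\log(d+1)}{\eta c},$$ one has, with probability more than $1-\delta$ over the initialization $(a,w(0))$, $$\mathbb E_{x\sim\mathcal X}\big((x^\top\beta)^p-f(x,w(k))\big)^2\le C_d\,(d+1)^p(p+1)^{1.5}\sqrt{\frac{\log(1/\delta)}n}\quad\text{if }p\ge2,$$ $$\mathbb E_{x\sim\mathcal X}\big((x^\top\beta)^p-f(x,w(k))\big)^2\le C_d\,\sqrt{\frac{\log(1/\delta)}n}\quad\text{if }p\in\{0,1\}.$$ Here the constant $C_d=C\,(d+1)$ depends only on $d$. For even $p\ge2$ the first bound also holds with the absolute constant $C$ in place of $C_d$. 4. Polynomial functions are dense, in the uniform norm, in the continuous functions on the sphere $\{\|x\|=\sqrt d\}$. -/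

import Mathlib

open MeasureTheory ProbabilityTheory
open scoped Nat

noncomputable section

/-- The augmented input `x̃ = (x, 1)`. -/
def augment {d : ℕ} (x : EuclideanSpace ℝ (Fin d)) : Fin (d + 1) → ℝ :=
  Fin.snoc (α := fun _ => ℝ) (fun i => x i) 1

/-- The one-hidden-layer ReLU network
`f(x, w) = ∑ k, (a k / √m) * max 0 (w k ⬝ x̃)`; the bias is the last coordinate of `w k`. -/
def network {m d : ℕ} (a : Fin m → ℝ) (w : Fin m → Fin (d + 1) → ℝ)
    (x : EuclideanSpace ℝ (Fin d)) : ℝ :=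
  ∑ k, a k / √(m : ℝ) * max 0 (w k ⬝ᵥ augment x)

/-- The gradient of the network in `w`, with the convention `σ'(0) = 1`. -/
def networkGrad {m d : ℕ} (a : Fin m → ℝ) (w : Fin m → Fin (d + 1) → ℝ)
    (x : EuclideanSpace ℝ (Fin d)) : Fin m → Fin (d + 1) → ℝ :=
  fun k j => a k / √(m : ℝ) * (if 0 ≤ w k ⬝ᵥ augment x then 1 else 0) * augment x j

/-- One step of gradient descent, `w ↦ w - η ∇f (f - Y)`; the signs `a` are not trained. -/
def gdStep {m d n : ℕ} (η : ℝ) (a : Fin m → ℝ) (S : Fin n → EuclideanSpace ℝ (Fin d))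
    (y : Fin n → ℝ) (w : Fin m → Fin (d + 1) → ℝ) : Fin m → Fin (d + 1) → ℝ :=
  fun k j => w k j - η * ∑ i, networkGrad a w (S i) k j * (network a w (S i) - y i)

/-- The weights `w(k)` after `k` steps of gradient descent from `w(0) = w₀`. -/
def gdIterate {m d n : ℕ} (η : ℝ) (a : Fin m → ℝ) (S : Fin n → EuclideanSpace ℝ (Fin d))
    (y : Fin n → ℝ) (w₀ : Fin m → Fin (d + 1) → ℝ) (k : ℕ) : Fin m → Fin (d + 1) → ℝ :=
  (gdStep η a S y)^[k] w₀

/-- The uniform distribution on `{1, -1}`. -/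
def signMeasure : Measure ℝ :=
  (2⁻¹ : ENNReal) • (Measure.dirac 1 + Measure.dirac (-1))

/-- The law of the initialization `(a, w(0))`: independent uniform signs `a k`, independent
of the vectors `w k (0)`, which are independent with law `N(0, κ² I)` on `ℝ^(d+1)`. -/
def initMeasure (m d : ℕ) (κ : ℝ) :
    Measure ((Fin m → ℝ) × (Fin m → Fin (d + 1) → ℝ)) :=
  (Measure.pi fun _ : Fin m => signMeasure).prod
    (Measure.pi fun _ : Fin m => Measure.pi fun _ : Fin (d + 1) =>
      gaussianReal 0 (Real.toNNReal (κ ^ 2)))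

/-- The target `y = (xᵀ β) ^ p`. -/
def target {d : ℕ} (β : EuclideanSpace ℝ (Fin d)) (p : ℕ)
    (x : EuclideanSpace ℝ (Fin d)) : ℝ :=
  (inner ℝ x β) ^ p

/-- The generalization error `E_x (y - f(x, w))²` for `x` drawn from `X`. -/
def genError {m d : ℕ} (X : Measure (EuclideanSpace ℝ (Fin d)))
    (y : EuclideanSpace ℝ (Fin d) → ℝ) (a : Fin m → ℝ)
    (w : Fin m → Fin (d + 1) → ℝ) : ℝ :=
  ∫ x, (y x - network a w x) ^ 2 ∂X

/-- The infinite-width neural tangent kernel (on the sphere of radius `√d`). -/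
def ntkKernel {d : ℕ} (x x' : EuclideanSpace ℝ (Fin d)) : ℝ :=
  (augment x ⬝ᵥ augment x') *
    ((Real.pi - Real.arccos ((augment x ⬝ᵥ augment x') / ((d : ℝ) + 1))) / (2 * Real.pi))

/-- The Gram matrix `H` of the kernel on the sample `S`. -/
def ntkGram {d n : ℕ} (S : Fin n → EuclideanSpace ℝ (Fin d)) : Matrix (Fin n) (Fin n) ℝ :=
  Matrix.of fun i j => ntkKernel (S i) (S j)

/-- `c_{2p} = (2p-3)!! (d+1) / (2π (2p-2)!! (2p-1))`, for `p ≥ 1`. At `p = 1` truncated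
subtraction gives `0‼ = 1`, which agrees with the usual `(-1)!! = 1`. -/
def kernelCoeff (d p : ℕ) : ℝ :=
  ((2 * p - 3)‼ : ℝ) * ((d : ℝ) + 1) /
    (2 * Real.pi * ((2 * p - 2)‼ : ℝ) * (2 * (p : ℝ) - 1))

/-- The coefficients `d_k` of the feature vector: the sum of
`c_{2p} / (d+1)^{2p} * (2p choose k)` over `p ≥ max 1 ⌈k/2⌉`, plus `1/4` if `k` is `0` or `1`. -/
def featureCoeff (d k : ℕ) : ℝ :=
  (if k ≤ 1 then 1 / 4 else 0) +
    ∑' p : ℕ, if 1 ≤ p ∧ k ≤ 2 * p then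
      kernelCoeff d p / ((d : ℝ) + 1) ^ (2 * p) * ((2 * p).choose k : ℝ) else 0

/-- The Kronecker power `v^{⊗k}`, with coordinates indexed by `k`-tuples. -/
def tensorPow {d : ℕ} (v : EuclideanSpace ℝ (Fin d)) (k : ℕ) : (Fin k → Fin d) → ℝ :=
  fun i => ∏ j, v (i j)

/-- The feature vector `φ(x) = [√d₀, √d₁ x, √d₂ x^{⊗2}, …]`, block by block. -/
def featureVec {d : ℕ} (x : EuclideanSpace ℝ (Fin d)) (k : ℕ) : (Fin k → Fin d) → ℝ :=
  fun i => √(featureCoeff d k) * tensorPow x k i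

/-- `w̄ = [0, …, 0, β^{⊗p} / √d_p, 0, …]`, block by block, with the nonzero block in place `p`. -/
def targetVec {d : ℕ} (β : EuclideanSpace ℝ (Fin d)) (p k : ℕ) : (Fin k → Fin d) → ℝ :=
  fun i => if k = p then 1 / √(featureCoeff d k) * tensorPow β k i else 0

/-- `√(log(1/δ)/n)` for `p = 0, 1`, and
`(d+1)^p (p+1)^{1.5} √(log(1/δ)/n)` for `p ≥ 2`. -/
def genRate (d p n : ℕ) (δ : ℝ) : ℝ :=
  if p ≤ 1 then √(Real.log (1 / δ) / (n : ℝ))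
  else ((d : ℝ) + 1) ^ p * ((p : ℝ) + 1) ^ (3 / 2 : ℝ) * √(Real.log (1 / δ) / (n : ℝ))

/-- `κ² = Θ(c δ / (d² n^{1.5}))` with constants `b` and `B`, `0 < η ≤ C₂ c / (d n)²`,
`m ≥ P(n, d^{p/2}, 1/c, 1/δ)` (with `√d` in place of `d^{p/2}` if `p = 0`) and
`k ≥ C₃ (log n + p log(d+1)) / (η c)`. -/
structure Admissible (b B C₂ C₃ : ℝ) (P : MvPolynomial (Fin 4) ℝ) (d n p : ℕ)
    (δ c : ℝ) (m : ℕ) (κ η : ℝ) (k : ℕ) : Prop where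
  init_pos : 0 < κ
  init_lower : b * (c * δ / ((d : ℝ) ^ 2 * (n : ℝ) ^ (3 / 2 : ℝ))) ≤ κ ^ 2
  init_upper : κ ^ 2 ≤ B * (c * δ / ((d : ℝ) ^ 2 * (n : ℝ) ^ (3 / 2 : ℝ)))
  step_pos : 0 < η
  step_upper : η ≤ C₂ * (c / ((d : ℝ) * (n : ℝ)) ^ 2)
  width : MvPolynomial.eval ![(n : ℝ), √(d : ℝ) ^ max p 1, 1 / c, 1 / δ] P ≤ (m : ℝ)
  iterations : C₃ * ((Real.log n + (p : ℝ) * Real.log ((d : ℝ) + 1)) / (η * c)) ≤ (k : ℝ)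

end

/-! Since π - arccos = π/2 + arcsin, the kernel is `(1+t)/4 + (1+t)/(2π) · arcsin((1+t)/(d+1))` with
`t = ⟪x, x'⟫`. Expanding arcsin and then the powers of `1 + t` gives `K = ∑ d_k t^k` with every `d_k
> 0`, because the bias supplies all exponents. So `K` is the inner product of the feature vectors,
and the target is the linear functional `w̄` with `‖w̄‖² ≤ 1/d_p`. A quadratic form of `H` is a sum
of nonnegative forms, one for each tensor power. For non-parallel points the forms of high degree,
after normalization, approach the identity, so `H` is positive definite. Density is
Stone-Weierstrass.

The generalization bound compares gradient descent with kernel gradient descent in the feature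
space. Neurons whose initial preactivations exceed the distance travelled keep their activation
pattern. For large `m` few neurons are exceptional, and the empirical kernel is close to `K`
(`measure_not_initGood_le`). The training residual then contracts by `1 - ηc/4` at each step, the
total movement is a convergent geometric series, and the network minus its initial value stays close
to `⟪Φ x, v⟫`, where `v` is the iterate in the feature space (`KernelRegime.trajectory`,
`KernelRegime.abs_network_gdIterate_sub_le`).

Let `w` represent the target and let `u` interpolate the initial outputs on the sample. The error of
the predictor is governed by `g = v + u - w`, whose norm hardly increases during training because
kernel gradient descent is a least-squares descent (`KernelRegime.norm_featureIterate_add_sq_le`).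
Hoeffding's inequality in a Hilbert space, applied to `Φ ⊗ Φ`, bounds `E⟪Φ, g⟫²` by its empirical
mean plus `‖g‖² t` for all `g` at once, where `t` is of order `(d+1)√(log(1/δ)/n)`
(`measure_quadratic_deviation_le`). The empirical mean is small after training, so the rate is
`(d+1)/d_p · √(log(1/δ)/n)`, and `div_featureCoeff_le` makes it explicit. -/

/-! ### The power series of arcsin on the closed interval. -/

theorem doubleFactorial_ratio_succ (q : ℕ) :
    ((2 * (q + 1) - 1)‼ : ℝ) / ((2 * (q + 1))‼ : ℝ) =
      ((2 * q - 1)‼ : ℝ) / ((2 * q)‼ : ℝ) * ((2 * (q : ℝ) + 1) / (2 * q + 2)) := by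
  have h1 : (2 * (q + 1) - 1)‼ = (2 * q + 1) * (2 * q - 1)‼ := by
    cases q with
    | zero => simp
    | succ q =>
      rw [show 2 * (q + 1 + 1) - 1 = (2 * q + 1) + 2 by lia, Nat.doubleFactorial_add_two]
      rfl
  have h2 : (2 * (q + 1))‼ = (2 * q + 2) * (2 * q)‼ := Nat.doubleFactorial_add_two (2 * q)
  rw [h1, h2]
  have := Nat.doubleFactorial_pos (2 * q)
  push_cast
  field_simp

/-- These are the binomial coefficients of `(1 - t)^(-1/2)`. Both sides acquire the factor `(q +
1/2)/(q + 1)` when `q` grows by one. At `q = 0` truncated subtraction gives `0‼ = 1`, in agreement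
with `(-1)!! = 1`. -/
theorem multichoose_half (q : ℕ) :
    Ring.multichoose (1 / 2 : ℝ) q = ((2 * q - 1)‼ : ℝ) / ((2 * q)‼ : ℝ) := by
  induction q with
  | zero => simp
  | succ q ih =>
    rw [doubleFactorial_ratio_succ, ← ih]
    have h1 := Ring.factorial_nsmul_multichoose_eq_ascPochhammer (1 / 2 : ℝ) (q + 1)
    have h0 := Ring.factorial_nsmul_multichoose_eq_ascPochhammer (1 / 2 : ℝ) q
    rw [ascPochhammer_succ_right, Polynomial.smeval_mul, ← h0, Polynomial.smeval_add,
      Polynomial.smeval_X, Polynomial.smeval_natCast] at h1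
    simp only [nsmul_eq_mul, Nat.factorial_succ, pow_one, pow_zero] at h1
    have := Nat.factorial_pos q
    push_cast at h1
    field_simp at h1 ⊢
    linarith

theorem hasSum_inv_sqrt_one_sub {t : ℝ} (ht : |t| < 1) :
    HasSum (fun q : ℕ => ((2 * q - 1)‼ : ℝ) / ((2 * q)‼ : ℝ) * t ^ q) (1 / √(1 - t)) := by
  have h := (Real.one_div_one_sub_rpow_hasFPowerSeriesOnBall_zero (1 / 2)).hasSum
    (y := t) (by simpa [enorm_eq_nnnorm] using! ht)
  rw [zero_add, ← Real.sqrt_eq_rpow] at h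
  refine h.congr_fun fun q => ?_
  rw [FormalMultilinearSeries.ofScalars_apply_eq, ← Ring.multichoose_eq, multichoose_half, smul_eq_mul]

/-- Differentiated term by term, the series becomes the binomial series of `1/√(1 - z²)`, the
derivative of arcsin, and both functions vanish at 0. -/
theorem hasSum_arcsin_of_abs_lt {z : ℝ} (hz : |z| < 1) :
    HasSum (fun q : ℕ => ((2 * q - 1)‼ : ℝ) / ((2 * q)‼ : ℝ) / (2 * q + 1) * z ^ (2 * q + 1))
      (Real.arcsin z) := by
  -- On `(-r, r)` the differentiated series is dominated by its value at `r < 1`.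
  obtain ⟨r, hzr, hr1⟩ := exists_between hz
  have hr0 : 0 < r := (abs_nonneg z).trans_lt hzr
  set g : ℕ → ℝ → ℝ := fun q z =>
    ((2 * q - 1)‼ : ℝ) / ((2 * q)‼ : ℝ) / (2 * q + 1) * z ^ (2 * q + 1) with hg
  set g' : ℕ → ℝ → ℝ := fun q z => ((2 * q - 1)‼ : ℝ) / ((2 * q)‼ : ℝ) * (z ^ 2) ^ q with hg'
  have hder : ∀ q y, HasDerivAt (g q) (g' q y) y := by
    intro q y
    have := ((hasDerivAt_id y).pow (2 * q + 1)).const_mul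
      (((2 * q - 1)‼ : ℝ) / ((2 * q)‼ : ℝ) / (2 * q + 1))
    convert! this using 1
    simp only [hg', id, Nat.add_sub_cancel, pow_mul]
    push_cast
    field_simp
  have hu : Summable fun q : ℕ => g' q r :=
    (hasSum_inv_sqrt_one_sub (t := r ^ 2) (by rw [abs_of_nonneg (by positivity)]; nlinarith)).summable
  have hbd : ∀ q, ∀ y ∈ Set.Ioo (-r) r, ‖g' q y‖ ≤ g' q r := by
    intro q y hy
    simp only [hg', norm_mul, norm_pow, Real.norm_eq_abs, sq_abs]
    rw [abs_of_nonneg (by positivity)]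
    have : y ^ 2 ≤ r ^ 2 := sq_le_sq' hy.1.le hy.2.le
    gcongr
  have h0 : (0 : ℝ) ∈ Set.Ioo (-r) r := ⟨by linarith, hr0⟩
  have hs0 : Summable fun q => g q 0 := by simp [hg, summable_zero]
  have hD : ∀ y ∈ Set.Ioo (-r) r, HasDerivAt (fun y => ∑' q, g q y) (∑' q, g' q y) y :=
    fun y hy => hasDerivAt_tsum_of_isPreconnected hu isOpen_Ioo isPreconnected_Ioo
      (fun q y _ => hder q y) hbd h0 hs0 hy
  have hA : ∀ y ∈ Set.Ioo (-r) r, HasDerivAt Real.arcsin (∑' q, g' q y) y := by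
    intro y hy
    have h := Real.hasDerivAt_arcsin (x := y) (by linarith [hy.1]) (by linarith [hy.2])
    have hy2 : |y ^ 2| < 1 := by
      rw [abs_of_nonneg (by positivity)]; nlinarith [hy.1, hy.2]
    rwa [← (hasSum_inv_sqrt_one_sub hy2).tsum_eq] at h
  have hEq : Set.EqOn (fun y => ∑' q, g q y) Real.arcsin (Set.Ioo (-r) r) := by
    refine isOpen_Ioo.eqOn_of_deriv_eq isPreconnected_Ioo
      (fun y hy => (hD y hy).differentiableAt.differentiableWithinAt)
      (fun y hy => (hA y hy).differentiableAt.differentiableWithinAt) ?_ h0 (by simp [hg])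
    intro y hy
    simp only [(hD y hy).deriv, (hA y hy).deriv]
  have hzm := abs_lt.1 hzr
  have hsum : Summable fun q => g q z :=
    summable_of_summable_hasDerivAt_of_isPreconnected hu isOpen_Ioo isPreconnected_Ioo
      (fun q y _ => hder q y) hbd h0 hs0 hzm
  have := hsum.hasSum
  rwa [show ∑' q, g q z = Real.arcsin z from hEq hzm] at this

/-- For `0 < z < 1` the partial sums are at most `arcsin z ≤ π/2`, since all terms are nonnegative.
The bound survives the limit `z → 1`. -/
theorem summable_arcsin_coeff :
    Summable fun q : ℕ => ((2 * q - 1)‼ : ℝ) / ((2 * q)‼ : ℝ) / (2 * q + 1) := by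
  refine summable_of_sum_range_le (c := Real.pi / 2) (fun q => by positivity) fun n => ?_
  have hcont : Continuous fun z : ℝ => ∑ q ∈ Finset.range n,
      ((2 * q - 1)‼ : ℝ) / ((2 * q)‼ : ℝ) / (2 * q + 1) * z ^ (2 * q + 1) := by fun_prop
  have hlim := (hcont.tendsto 1).mono_left (nhdsWithin_le_nhds (s := Set.Iio 1))
  simp only [one_pow, mul_one] at hlim
  refine le_of_tendsto hlim ?_
  filter_upwards [Ioo_mem_nhdsLT (show (0 : ℝ) < 1 by norm_num)] with z hz
  have h := hasSum_arcsin_of_abs_lt (abs_lt.2 ⟨by linarith [hz.1], hz.2⟩)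
  refine (sum_le_hasSum _ (fun q _ => ?_) h).trans (Real.arcsin_le_pi_div_two z)
  have := hz.1
  positivity

/-- The endpoint `z = 1` is the diagonal `x = x'` of the kernel. Summable coefficients make the
series continuous on `[-1, 1]`, and it agrees with arcsin on the dense interior. -/
theorem hasSum_arcsin {z : ℝ} (hz : |z| ≤ 1) :
    HasSum (fun q : ℕ => ((2 * q - 1)‼ : ℝ) / ((2 * q)‼ : ℝ) / (2 * q + 1) * z ^ (2 * q + 1))
      (Real.arcsin z) := by
  have hbd : ∀ (q : ℕ) (x : ℝ), x ∈ Set.Icc (-1 : ℝ) 1 →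
      ‖((2 * q - 1)‼ : ℝ) / ((2 * q)‼ : ℝ) / (2 * q + 1) * x ^ (2 * q + 1)‖ ≤
        ((2 * q - 1)‼ : ℝ) / ((2 * q)‼ : ℝ) / (2 * q + 1) := by
    intro q x hx
    rw [norm_mul, norm_pow, Real.norm_of_nonneg (by positivity)]
    exact mul_le_of_le_one_right (by positivity)
      (pow_le_one₀ (norm_nonneg _) (abs_le.2 hx))
  have hc : ContinuousOn (fun x : ℝ => ∑' q : ℕ,
      ((2 * q - 1)‼ : ℝ) / ((2 * q)‼ : ℝ) / (2 * q + 1) * x ^ (2 * q + 1)) (Set.Icc (-1) 1) :=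
    continuousOn_tsum (fun q => by fun_prop) summable_arcsin_coeff hbd
  have hE : Set.EqOn (fun x : ℝ => ∑' q : ℕ,
      ((2 * q - 1)‼ : ℝ) / ((2 * q)‼ : ℝ) / (2 * q + 1) * x ^ (2 * q + 1)) Real.arcsin
      (Set.Icc (-1) 1) :=
    Set.EqOn.of_subset_closure (s := Set.Ioo (-1 : ℝ) 1)
      (fun x hx => (hasSum_arcsin_of_abs_lt (abs_lt.2 hx)).tsum_eq) hc
      Real.continuous_arcsin.continuousOn Set.Ioo_subset_Icc_self
      (by rw [closure_Ioo (by norm_num)])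
  have hs := (Summable.of_norm_bounded summable_arcsin_coeff
    (fun q => hbd q z (abs_le.1 hz))).hasSum
  have he := hE (abs_le.1 hz)
  simp only at he
  rwa [he] at hs

/-! ### The coefficients `d_k` and the expansion of the kernel. -/

theorem augment_dotProduct {d : ℕ} (x y : EuclideanSpace ℝ (Fin d)) :
    augment x ⬝ᵥ augment y = inner ℝ x y + 1 := by
  simp [dotProduct, augment, Fin.sum_univ_castSucc, PiLp.inner_apply, mul_comm]

theorem sum_tensorPow_mul {d : ℕ} (x y : EuclideanSpace ℝ (Fin d)) (k : ℕ) :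
    ∑ i, tensorPow x k i * tensorPow y k i = inner ℝ x y ^ k := by
  simp only [tensorPow, ← Finset.prod_mul_distrib, PiLp.inner_apply]
  rw [Fintype.sum_pow]
  simp [mul_comm]

theorem kernelCoeff_succ (d q : ℕ) :
    kernelCoeff d (q + 1) = ((d : ℝ) + 1) / (2 * Real.pi) *
      (((2 * q - 1)‼ : ℝ) / ((2 * q)‼ : ℝ) / (2 * q + 1)) := by
  have h1 : 2 * (q + 1) - 3 = 2 * q - 1 := by lia
  have h2 : 2 * (q + 1) - 2 = 2 * q := by lia
  rw [kernelCoeff, h1, h2]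
  have := Nat.doubleFactorial_pos (2 * q)
  have := Real.pi_pos
  have h3 : 2 * (((q + 1 : ℕ) : ℝ)) - 1 = 2 * q + 1 := by push_cast; ring
  rw [h3]
  field_simp

theorem kernelCoeff_succ_pos (d q : ℕ) : 0 < kernelCoeff d (q + 1) := by
  rw [kernelCoeff_succ]
  have := Nat.doubleFactorial_pos (2 * q)
  have := Nat.doubleFactorial_pos (2 * q - 1)
  have := Real.pi_pos
  positivity

theorem kernelCoeff_pos (d : ℕ) {q : ℕ} (hq : 1 ≤ q) : 0 < kernelCoeff d q := by
  obtain ⟨q, rfl⟩ := Nat.exists_eq_add_of_le' hq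
  exact kernelCoeff_succ_pos d q

/-- The summands of the series that defines `featureCoeff`. -/
noncomputable def featureTerm (d k q : ℕ) : ℝ :=
  if 1 ≤ q ∧ k ≤ 2 * q then
    kernelCoeff d q / ((d : ℝ) + 1) ^ (2 * q) * ((2 * q).choose k : ℝ) else 0

theorem featureTerm_nonneg (d k q : ℕ) : 0 ≤ featureTerm d k q := by
  unfold featureTerm
  split_ifs with h
  · have := kernelCoeff_pos d h.1
    positivity
  · rfl

/-- The bias coordinate replaces `t` by `1 + t`. The binomial theorem then spreads one even power
over all exponents up to `2(q+1)`, odd ones included. -/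
theorem hasSum_featureTerm_mul_pow (d q : ℕ) (t : ℝ) :
    HasSum (fun k => featureTerm d k (q + 1) * t ^ k)
      (kernelCoeff d (q + 1) * ((1 + t) / ((d : ℝ) + 1)) ^ (2 * (q + 1))) := by
  have h : ∀ k ∉ Finset.range (2 * (q + 1) + 1), featureTerm d k (q + 1) * t ^ k = 0 := by
    intro k hk
    rw [featureTerm, if_neg (by simp at hk ⊢; lia), zero_mul]
  convert hasSum_sum_of_ne_finset_zero (L := SummationFilter.unconditional ℕ) h using 1
  rw [div_pow, add_comm 1 t, add_pow, Finset.sum_div, Finset.mul_sum]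
  refine Finset.sum_congr rfl fun k hk => ?_
  rw [featureTerm, if_pos (by simp at hk ⊢; lia)]
  ring

theorem summable_kernelCoeff_succ (d : ℕ) : Summable fun q => kernelCoeff d (q + 1) := by
  simp only [kernelCoeff_succ]
  exact summable_arcsin_coeff.mul_left _

/-- Absolute convergence of the double series, needed to exchange the sums. With `|t|` in place of
`t`, row `q` sums to `c_{2(q+1)}` times a power of `(1+|t|)/(d+1) ≤ 1`, and the `c_{2q}` are
multiples of the arcsin coefficients. -/
theorem summable_featureTerm_mul_pow {d : ℕ} {t : ℝ} (ht : |t| ≤ d) :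
    Summable fun z : ℕ × ℕ => featureTerm d z.2 (z.1 + 1) * t ^ z.2 := by
  refine Summable.of_norm ?_
  simp only [norm_mul, norm_pow, Real.norm_eq_abs, abs_of_nonneg (featureTerm_nonneg _ _ _)]
  refine (summable_prod_of_nonneg fun z => ?_).2
    ⟨fun q => (hasSum_featureTerm_mul_pow d q |t|).summable, ?_⟩
  · have := featureTerm_nonneg d z.2 (z.1 + 1)
    positivity
  · simp only [(hasSum_featureTerm_mul_pow d _ |t|).tsum_eq]
    refine Summable.of_nonneg_of_le (fun q => ?_) (fun q => ?_) (summable_kernelCoeff_succ d)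
    · have := kernelCoeff_succ_pos d q
      positivity
    · refine mul_le_of_le_one_right (kernelCoeff_succ_pos d q).le (pow_le_one₀ (by positivity) ?_)
      rw [div_le_one (by positivity)]
      linarith

theorem summable_featureTerm {d : ℕ} (hd : 1 ≤ d) (k : ℕ) : Summable (featureTerm d k) := by
  have hd' : (1 : ℝ) ≤ d := by exact_mod_cast hd
  have h := summable_featureTerm_mul_pow (d := d) (t := 1) (by simpa using hd')
  have := h.prod_symm.prod_factor k
  simp only [Prod.swap, one_pow, mul_one] at this
  exact (summable_nat_add_iff 1).1 this

theorem featureCoeff_eq (d k : ℕ) :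
    featureCoeff d k = (if k ≤ 1 then 1 / 4 else 0) + ∑' q, featureTerm d k q := rfl

theorem featureTerm_le_featureCoeff {d : ℕ} (hd : 1 ≤ d) (k q : ℕ) :
    featureTerm d k q ≤ featureCoeff d k := by
  rw [featureCoeff_eq]
  have := (summable_featureTerm hd k).le_tsum q fun j _ => featureTerm_nonneg d k j
  split_ifs <;> linarith

theorem quarter_le_featureCoeff (d : ℕ) {k : ℕ} (hk : k ≤ 1) : 1 / 4 ≤ featureCoeff d k := by
  rw [featureCoeff_eq, if_pos hk]
  have : 0 ≤ ∑' q, featureTerm d k q := tsum_nonneg fun j => featureTerm_nonneg d k j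
  linarith

theorem featureCoeff_pos {d : ℕ} (hd : 1 ≤ d) (k : ℕ) : 0 < featureCoeff d k := by
  refine lt_of_lt_of_le ?_ (featureTerm_le_featureCoeff hd k (k + 1))
  rw [featureTerm, if_pos (by lia)]
  have := kernelCoeff_succ_pos d k
  have : 0 < (2 * (k + 1)).choose k := Nat.choose_pos (by lia)
  positivity

/-- The double series is summed in both orders: rows give the arcsin series times `(1+t)/(2π)`,
columns give the `d_k`. The terms `1/4` for `k ≤ 1` account for `(1+t)/4`. -/
theorem hasSum_featureCoeff_mul_pow {d : ℕ} (hd : 1 ≤ d) {t : ℝ} (ht : |t| ≤ d) :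
    HasSum (fun k => featureCoeff d k * t ^ k)
      ((1 + t) / 4 + (1 + t) / (2 * Real.pi) * Real.arcsin ((1 + t) / (d + 1))) := by
  have hsum := summable_featureTerm_mul_pow ht
  have hz : |(1 + t) / ((d : ℝ) + 1)| ≤ 1 := by
    rw [abs_div, abs_of_pos (by positivity : (0 : ℝ) < d + 1), div_le_one (by positivity)]
    calc |1 + t| ≤ |1| + |t| := abs_add_le _ _
      _ ≤ d + 1 := by rw [abs_one]; linarith
  have h1 : HasSum (fun q : ℕ => kernelCoeff d (q + 1) *
      ((1 + t) / ((d : ℝ) + 1)) ^ (2 * (q + 1)))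
      ((1 + t) / (2 * Real.pi) * Real.arcsin ((1 + t) / (d + 1))) := by
    refine ((hasSum_arcsin hz).mul_left ((1 + t) / (2 * Real.pi))).congr_fun fun q => ?_
    rw [kernelCoeff_succ, show 2 * (q + 1) = (2 * q + 1) + 1 by ring, pow_succ]
    have := Real.pi_pos
    have : ((d : ℝ) + 1) ≠ 0 := by positivity
    field_simp
  have h2 := h1.unique (hsum.hasSum.prod_fiberwise fun q => hasSum_featureTerm_mul_pow d q t)
  have h3 : HasSum (fun k => (∑' q, featureTerm d k q) * t ^ k)
      ((1 + t) / (2 * Real.pi) * Real.arcsin ((1 + t) / (d + 1))) := by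
    rw [h2]
    have := hsum.hasSum
    rw [← (Equiv.prodComm ℕ ℕ).hasSum_iff] at this
    refine this.prod_fiberwise fun k => ?_
    have hk := summable_featureTerm hd k
    -- The series for `d_k` starts at index 1, so shifting the index loses nothing.
    have h0 : featureTerm d k 0 = 0 := by simp [featureTerm]
    have := (hasSum_nat_add_iff' 1).2 hk.hasSum
    simp only [Finset.sum_range_one, h0, sub_zero] at this
    exact this.mul_right _
  have h4 : HasSum (fun k => (if k ≤ 1 then (1 : ℝ) / 4 else 0) * t ^ k) ((1 + t) / 4) := by
    have : ∀ k ∉ Finset.range 2, (if k ≤ 1 then (1 : ℝ) / 4 else 0) * t ^ k = 0 := by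
      intro k hk
      rw [if_neg (by simp at hk; lia), zero_mul]
    convert hasSum_sum_of_ne_finset_zero (L := SummationFilter.unconditional ℕ) this using 1
    simp [Finset.sum_range_succ]
    ring
  refine (h4.add h3).congr_fun fun k => ?_
  rw [featureCoeff_eq]
  ring

theorem ntkKernel_eq {d : ℕ} (x y : EuclideanSpace ℝ (Fin d)) :
    ntkKernel x y = (1 + inner ℝ x y) / 4 + (1 + inner ℝ x y) / (2 * Real.pi) *
      Real.arcsin ((1 + inner ℝ x y) / (d + 1)) := by
  rw [ntkKernel, augment_dotProduct, Real.arccos, add_comm (inner ℝ x y) 1]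
  have := Real.pi_pos
  field_simp
  ring

theorem hasSum_ntkKernel {d : ℕ} (hd : 1 ≤ d) {x y : EuclideanSpace ℝ (Fin d)}
    (h : |inner ℝ x y| ≤ (d : ℝ)) :
    HasSum (fun k => featureCoeff d k * inner ℝ x y ^ k) (ntkKernel x y) := by
  rw [ntkKernel_eq]
  exact hasSum_featureCoeff_mul_pow hd h

theorem ntkKernel_self {d : ℕ} {x : EuclideanSpace ℝ (Fin d)} (hx : ‖x‖ = √(d : ℝ)) :
    ntkKernel x x = ((d : ℝ) + 1) / 2 := by
  have hi : inner ℝ x x = (d : ℝ) := by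
    rw [real_inner_self_eq_norm_sq, hx, Real.sq_sqrt (by positivity)]
  have hd : ((d : ℝ) + 1) ≠ 0 := by positivity
  rw [ntkKernel_eq, hi, add_comm 1 (d : ℝ), div_self hd, Real.arcsin_one]
  have := Real.pi_pos
  field_simp
  ring

theorem ntkKernel_comm {d : ℕ} (x y : EuclideanSpace ℝ (Fin d)) :
    ntkKernel x y = ntkKernel y x := by
  rw [ntkKernel_eq, ntkKernel_eq, real_inner_comm]

/-- A Wallis-type bound, responsible for the exponent 3/2 of `p + 1` in the rate. The squared
inequality is inductive because `(2q+1)²(4q+5)` exceeds `(4q+1)(2q+2)²` by exactly 1. -/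
theorem inv_sqrt_le_doubleFactorial_ratio (q : ℕ) :
    1 / √(4 * (q : ℝ) + 1) ≤ ((2 * q - 1)‼ : ℝ) / ((2 * q)‼ : ℝ) := by
  have key : 1 / (4 * (q : ℝ) + 1) ≤ (((2 * q - 1)‼ : ℝ) / ((2 * q)‼ : ℝ)) ^ 2 := by
    induction q with
    | zero => simp
    | succ q ih =>
      rw [doubleFactorial_ratio_succ, mul_pow]
      refine le_trans ?_ (mul_le_mul_of_nonneg_right ih (by positivity))
      rw [div_pow, div_mul_div_comm, one_mul, div_le_div_iff₀ (by positivity) (by positivity)]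
      push_cast
      nlinarith [(Nat.cast_nonneg q : (0 : ℝ) ≤ q)]
  refine le_of_sq_le_sq ?_ (by positivity)
  rwa [div_pow, one_pow, Real.sq_sqrt (by positivity)]

/-- A single term of the series for `d_p` suffices, the one of least degree, with its binomial
coefficient bounded below by 1. The exponent is `p` for even `p` and `p + 1` for odd `p`, hence the
extra factor `d + 1` in the odd case. -/
theorem div_featureCoeff_le {d p : ℕ} (hd : 1 ≤ d) (hp : 1 ≤ p) :
    ((d : ℝ) + 1) / featureCoeff d p ≤
      10 * ((d : ℝ) + 1) ^ (2 * ((p + 1) / 2)) * ((p : ℝ) + 1) ^ (3 / 2 : ℝ) := by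
  -- The number `2(q+1)` is the least even number that is at least `p`.
  obtain ⟨q, hq⟩ : ∃ q, (p + 1) / 2 = q + 1 := ⟨(p + 1) / 2 - 1, by lia⟩
  have hqp : 2 * (q + 1) ≤ p + 1 := by lia
  have hpq : p ≤ 2 * (q + 1) := by lia
  have hqp' : 2 * ((q : ℝ) + 1) ≤ p + 1 := by exact_mod_cast hqp
  rw [hq]
  have hD : (0 : ℝ) < (d : ℝ) + 1 := by positivity
  have hpi := Real.pi_pos
  have hpi4 := Real.pi_lt_d2
  have h1 := featureTerm_le_featureCoeff hd p (q + 1)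
  rw [featureTerm, if_pos (by lia), kernelCoeff_succ] at h1
  have hch : (1 : ℝ) ≤ ((2 * (q + 1)).choose p : ℝ) := by exact_mod_cast Nat.choose_pos hpq
  have hr := inv_sqrt_le_doubleFactorial_ratio q
  have hs : √(4 * (q : ℝ) + 1) ≤ √2 * √((p : ℝ) + 1) := by
    rw [← Real.sqrt_mul (by norm_num)]
    exact Real.sqrt_le_sqrt (by linarith)
  have hs0 : 0 < √(4 * (q : ℝ) + 1) := Real.sqrt_pos.2 (by positivity)
  have hp32 : ((p : ℝ) + 1) ^ (3 / 2 : ℝ) = (p + 1) * √((p : ℝ) + 1) := by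
    rw [show (3 / 2 : ℝ) = 1 + 1 / 2 by norm_num, Real.rpow_add (by positivity), Real.rpow_one,
      Real.sqrt_eq_rpow]
  have h2 : (d + 1) / (2 * Real.pi) * (1 / √(4 * (q : ℝ) + 1) / (2 * q + 1)) /
      ((d : ℝ) + 1) ^ (2 * (q + 1)) * 1 ≤ featureCoeff d p :=
    le_trans (by gcongr) h1
  rw [mul_one] at h2
  rw [div_le_iff₀ (featureCoeff_pos hd p)]
  calc (d : ℝ) + 1 = (2 * Real.pi * √(4 * (q : ℝ) + 1) * (2 * q + 1) *
        ((d : ℝ) + 1) ^ (2 * (q + 1))) *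
        ((d + 1) / (2 * Real.pi) * (1 / √(4 * (q : ℝ) + 1) / (2 * q + 1)) /
          ((d : ℝ) + 1) ^ (2 * (q + 1))) := by field_simp
    _ ≤ (10 * ((d : ℝ) + 1) ^ (2 * (q + 1)) * ((p : ℝ) + 1) ^ (3 / 2 : ℝ)) *
        featureCoeff d p := by
      refine mul_le_mul ?_ h2 (by positivity) (by positivity)
      rw [hp32]
      have e1 : 2 * (q : ℝ) + 1 ≤ p + 1 := by linarith
      have e2 : √2 ≤ 1.5 := Real.sqrt_le_iff.2 ⟨by norm_num, by norm_num⟩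
      calc 2 * Real.pi * √(4 * (q : ℝ) + 1) * (2 * q + 1) * ((d : ℝ) + 1) ^ (2 * (q + 1))
          ≤ 2 * 3.15 * (1.5 * √((p : ℝ) + 1)) * (p + 1) * ((d : ℝ) + 1) ^ (2 * (q + 1)) := by
            gcongr
            exact hs.trans (by gcongr)
        _ ≤ 10 * ((d : ℝ) + 1) ^ (2 * (q + 1)) * ((p + 1) * √((p : ℝ) + 1)) := by
            have : 0 ≤ ((d : ℝ) + 1) ^ (2 * (q + 1)) * ((p + 1) * √((p : ℝ) + 1)) := by positivity
            nlinarith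

/-! ### Linearity of the target and positive definiteness of the Gram matrix. -/

theorem hasSum_featureVec_mul_targetVec {d : ℕ} (hd : 1 ≤ d) (p : ℕ)
    (β x : EuclideanSpace ℝ (Fin d)) :
    HasSum (fun k : ℕ => ∑ i, featureVec x k i * targetVec β p k i) (target β p x) := by
  convert hasSum_single p fun k hk => ?_ using 1
  · have h := Real.sqrt_pos.2 (featureCoeff_pos hd p)
    rw [target, ← sum_tensorPow_mul]
    refine Finset.sum_congr rfl fun i _ => ?_
    rw [featureVec, targetVec, if_pos rfl]
    field_simp
  · simp [targetVec, hk]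

theorem abs_inner_le_of_norm {d : ℕ} {x y : EuclideanSpace ℝ (Fin d)} (hx : ‖x‖ = √(d : ℝ))
    (hy : ‖y‖ = √(d : ℝ)) : |inner ℝ x y| ≤ (d : ℝ) := by
  have := abs_real_inner_le_norm x y
  rwa [hx, hy, Real.mul_self_sqrt (by positivity)] at this

theorem abs_inner_lt_of_linearIndependent {d : ℕ} {x y : EuclideanSpace ℝ (Fin d)}
    (hx : ‖x‖ = √(d : ℝ)) (hy : ‖y‖ = √(d : ℝ)) (hd : 1 ≤ d)
    (h : LinearIndependent ℝ ![x, y]) : |inner ℝ x y| < (d : ℝ) := by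
  refine lt_of_le_of_ne (abs_inner_le_of_norm hx hy) fun he => ?_
  have hd' : (0 : ℝ) < d := by exact_mod_cast hd
  have h1 : |inner ℝ x y / (‖x‖ * ‖y‖)| = 1 := by
    rw [hx, hy, Real.mul_self_sqrt hd'.le, abs_div, he, abs_of_pos hd', div_self hd'.ne']
  obtain ⟨-, r, hr, hxy⟩ := (abs_real_inner_div_norm_mul_norm_eq_one_iff x y).1 h1
  have := (LinearIndependent.pair_iff.1 h) r (-1) (by rw [hxy]; simp)
  simp at this

/-- The sum is the squared norm of `∑ α_i S_i^{⊗k}`. -/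
theorem sum_mul_inner_pow_nonneg {d n : ℕ} (S : Fin n → EuclideanSpace ℝ (Fin d)) (α : Fin n → ℝ)
    (k : ℕ) : 0 ≤ ∑ i, ∑ j, α i * α j * inner ℝ (S i) (S j) ^ k := by
  have : ∑ i, ∑ j, α i * α j * inner ℝ (S i) (S j) ^ k =
      ∑ l, (∑ i, α i * tensorPow (S i) k l) ^ 2 := by
    simp_rw [← sum_tensorPow_mul, sq, Finset.sum_mul_sum, Finset.mul_sum]
    rw [Finset.sum_comm' (t' := Finset.univ) (s' := fun _ => Finset.univ) (by simp)]
    rw [Finset.sum_comm]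
    simp_rw [fun i : Fin n => Finset.sum_comm (s := (Finset.univ : Finset (Fin n)))
      (t := (Finset.univ : Finset (Fin k → Fin d)))
      (f := fun j l => α i * α j * (tensorPow (S i) k l * tensorPow (S j) k l))]
    rw [Finset.sum_comm]
    refine Finset.sum_congr rfl fun l _ => Finset.sum_congr rfl fun i _ =>
      Finset.sum_congr rfl fun j _ => by ring
  rw [this]
  positivity

theorem hasSum_ntkGram_quadratic {d n : ℕ} (hd : 1 ≤ d) {S : Fin n → EuclideanSpace ℝ (Fin d)}
    (hS : ∀ i, ‖S i‖ = √(d : ℝ)) (α : Fin n → ℝ) :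
    HasSum (fun k => featureCoeff d k * ∑ i, ∑ j, α i * α j * inner ℝ (S i) (S j) ^ k)
      (∑ i, ∑ j, α i * α j * ntkKernel (S i) (S j)) := by
  have := hasSum_sum (s := Finset.univ) fun i (_ : i ∈ Finset.univ) =>
    hasSum_sum (s := Finset.univ) fun j (_ : j ∈ Finset.univ) =>
      (hasSum_ntkKernel hd (abs_inner_le_of_norm (hS i) (hS j))).mul_left (α i * α j)
  refine this.congr_fun fun k => ?_
  simp_rw [Finset.mul_sum]
  refine Finset.sum_congr rfl fun i _ => Finset.sum_congr rfl fun j _ => by ring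

theorem ntkGram_isHermitian {d n : ℕ} (S : Fin n → EuclideanSpace ℝ (Fin d)) :
    (ntkGram S).IsHermitian := by
  exact Matrix.IsHermitian.ext fun i j => ntkKernel_comm _ _

theorem dotProduct_ntkGram_mulVec {d n : ℕ} (S : Fin n → EuclideanSpace ℝ (Fin d))
    (α : Fin n → ℝ) :
    α ⬝ᵥ (ntkGram S).mulVec α = ∑ i, ∑ j, α i * α j * ntkKernel (S i) (S j) := by
  simp only [dotProduct, Matrix.mulVec, Finset.mul_sum]
  refine Finset.sum_congr rfl fun i _ => Finset.sum_congr rfl fun j _ => ?_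
  rw [show ntkGram S i j = ntkKernel (S i) (S j) from rfl]
  ring

/-- All degrees contribute nonnegatively and every `d_k` is positive, so one degree with a positive
form suffices. Since `|⟪S_i, S_j⟫| < d` for `i ≠ j`, the powers of `⟪S_i, S_j⟫ / d` tend to the
identity matrix, and a large degree will do. -/
theorem ntkGram_posDef {d n : ℕ} (hd : 1 ≤ d) {S : Fin n → EuclideanSpace ℝ (Fin d)}
    (hS : ∀ i, ‖S i‖ = √(d : ℝ)) (hind : ∀ i j, i ≠ j → LinearIndependent ℝ ![S i, S j]) :
    (ntkGram S).PosDef := by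
  refine Matrix.PosDef.of_dotProduct_mulVec_pos (ntkGram_isHermitian S) fun α hα => ?_
  rw [star_trivial, dotProduct_ntkGram_mulVec]
  have hd' : (0 : ℝ) < d := by exact_mod_cast hd
  have hlim : Filter.Tendsto
      (fun k : ℕ => ∑ i, ∑ j, α i * α j * (inner ℝ (S i) (S j) / (d : ℝ)) ^ k) Filter.atTop
      (nhds (∑ i, ∑ j, α i * α j * if i = j then 1 else 0)) := by
    refine tendsto_finsetSum _ fun i _ => tendsto_finsetSum _ fun j _ =>
      Filter.Tendsto.const_mul _ ?_
    split_ifs with hij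
    · rw [hij, real_inner_self_eq_norm_sq, hS, Real.sq_sqrt hd'.le, div_self hd'.ne']
      exact tendsto_const_nhds.congr fun k => (one_pow k).symm
    · refine tendsto_pow_atTop_nhds_zero_of_abs_lt_one ?_
      rw [abs_div, abs_of_pos hd', div_lt_one hd']
      exact abs_inner_lt_of_linearIndependent (hS i) (hS j) hd (hind i j hij)
  have hpos : 0 < ∑ i, ∑ j, α i * α j * if i = j then 1 else 0 := by
    simp only [mul_ite, mul_one, mul_zero, Finset.sum_ite_eq, Finset.mem_univ, if_true]
    obtain ⟨i, hi⟩ := Function.ne_iff.1 hα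
    exact Finset.sum_pos' (fun j _ => mul_self_nonneg _) ⟨i, Finset.mem_univ i,
      mul_self_pos.2 hi⟩
  obtain ⟨k, hk⟩ := (hlim.eventually (lt_mem_nhds hpos)).exists
  have hk' : 0 < ∑ i, ∑ j, α i * α j * inner ℝ (S i) (S j) ^ k := by
    have : ∑ i, ∑ j, α i * α j * inner ℝ (S i) (S j) ^ k =
        (d : ℝ) ^ k * ∑ i, ∑ j, α i * α j * (inner ℝ (S i) (S j) / (d : ℝ)) ^ k := by
      simp_rw [Finset.mul_sum, div_pow]
      refine Finset.sum_congr rfl fun i _ => Finset.sum_congr rfl fun j _ => by field_simp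
    rw [this]
    positivity
  refine lt_of_lt_of_le (mul_pos (featureCoeff_pos hd k) hk')
    (le_hasSum (hasSum_ntkGram_quadratic hd hS α) k fun l _ =>
      mul_nonneg (featureCoeff_pos hd l).le (sum_mul_inner_pow_nonneg S α l))

/-! ### Density of polynomials on the sphere. -/

/-- Stone-Weierstrass on the compact sphere for the algebra generated by the coordinate functions,
which separate points. -/
theorem exists_mvPolynomial_near_on_sphere {d : ℕ} (g : EuclideanSpace ℝ (Fin d) → ℝ) {r : ℝ}
    (hg : ContinuousOn g (Metric.sphere 0 r)) {ε : ℝ} (hε : 0 < ε) :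
    ∃ q : MvPolynomial (Fin d) ℝ, ∀ x ∈ Metric.sphere (0 : EuclideanSpace ℝ (Fin d)) r,
      |MvPolynomial.eval (fun i => x i) q - g x| < ε := by
  let coord : Fin d → C(Metric.sphere (0 : EuclideanSpace ℝ (Fin d)) r, ℝ) :=
    fun i => ⟨fun x => x.1 i, by fun_prop⟩
  have hA : (MvPolynomial.aeval (R := ℝ) coord).range.SeparatesPoints := by
    intro x y hxy
    obtain ⟨i, hi⟩ : ∃ i, x.1 i ≠ y.1 i := by
      by_contra! h
      exact hxy (Subtype.ext (PiLp.ext h))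
    exact ⟨coord i, ⟨coord i, ⟨MvPolynomial.X i, by simp⟩, rfl⟩, hi⟩
  obtain ⟨⟨f, q, hq⟩, hf⟩ := ContinuousMap.exists_mem_subalgebra_near_continuousMap_of_separatesPoints
    _ hA ⟨_, hg.domRestrict⟩ ε hε
  refine ⟨q, fun x hx => ?_⟩
  have h1 := (ContinuousMap.norm_lt_iff _ hε).1 hf ⟨x, hx⟩
  have h2 : ∀ q : MvPolynomial (Fin d) ℝ,
      MvPolynomial.aeval coord q ⟨x, hx⟩ = MvPolynomial.eval (fun i => x i) q := by
    intro q
    induction q using MvPolynomial.induction_on with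
    | C a => simp
    | add p q hp hq => simp [hp, hq]
    | mul_X p i hp => simp [hp, coord]
  rw [← h2]
  have h3 : MvPolynomial.aeval coord q = f := hq
  rw [h3]
  simpa using h1

/-! ### The feature map into a Hilbert space. -/

/-- The function `G` with `ntkKernel x y = G ⟪x, y⟫`. -/
noncomputable def ntkProfile (d : ℕ) (t : ℝ) : ℝ :=
  (1 + t) / 4 + (1 + t) / (2 * Real.pi) * Real.arcsin ((1 + t) / (d + 1))

theorem continuous_ntkProfile (d : ℕ) : Continuous (ntkProfile d) := by
  unfold ntkProfile
  have := Real.continuous_arcsin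
  fun_prop

/-- The Hilbert sum of the blocks of the feature vector. -/
abbrev FeatureSpace (d : ℕ) : Type :=
  lp (fun k : ℕ => EuclideanSpace ℝ (Fin k → Fin d)) 2

/-- The radial retraction onto the ball of radius `√d`. -/
noncomputable def clamp {d : ℕ} (x : EuclideanSpace ℝ (Fin d)) : EuclideanSpace ℝ (Fin d) :=
  (√(d : ℝ) / max √(d : ℝ) ‖x‖) • x

theorem continuous_clamp {d : ℕ} (hd : 1 ≤ d) :
    Continuous (clamp : EuclideanSpace ℝ (Fin d) → _) := by
  have hd' : 0 < √(d : ℝ) := Real.sqrt_pos.2 (by exact_mod_cast hd)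
  have h : Continuous fun x : EuclideanSpace ℝ (Fin d) => √(d : ℝ) / max √(d : ℝ) ‖x‖ :=
    Continuous.div (by fun_prop) (by fun_prop) fun x => (lt_max_of_lt_left hd').ne'
  exact h.smul continuous_id

theorem norm_clamp_le {d : ℕ} (x : EuclideanSpace ℝ (Fin d)) : ‖clamp x‖ ≤ √(d : ℝ) := by
  rw [clamp, norm_smul, Real.norm_of_nonneg (by positivity), div_mul_eq_mul_div]
  refine div_le_of_le_mul₀ (by positivity) (by positivity) ?_
  gcongr
  exact le_max_right _ _

theorem clamp_eq_self {d : ℕ} (hd : 1 ≤ d) {x : EuclideanSpace ℝ (Fin d)}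
    (hx : ‖x‖ = √(d : ℝ)) : clamp x = x := by
  have hd' : 0 < √(d : ℝ) := Real.sqrt_pos.2 (by exact_mod_cast hd)
  rw [clamp, hx, max_self, div_self hd'.ne', one_smul]

theorem abs_inner_clamp_le {d : ℕ} (x y : EuclideanSpace ℝ (Fin d)) :
    |inner ℝ (clamp x) (clamp y)| ≤ (d : ℝ) := by
  calc |inner ℝ (clamp x) (clamp y)| ≤ ‖clamp x‖ * ‖clamp y‖ := abs_real_inner_le_norm _ _
    _ ≤ √(d : ℝ) * √(d : ℝ) := by gcongr <;> exact norm_clamp_le _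
    _ = d := Real.mul_self_sqrt (by positivity)

/-- The `k`-th block of the feature vector as an element of a Euclidean space. -/
noncomputable def featureBlock {d : ℕ} (x : EuclideanSpace ℝ (Fin d)) (k : ℕ) :
    EuclideanSpace ℝ (Fin k → Fin d) :=
  WithLp.toLp 2 (featureVec x k)

theorem inner_featureBlock {d : ℕ} (hd : 1 ≤ d) (x y : EuclideanSpace ℝ (Fin d)) (k : ℕ) :
    inner ℝ (featureBlock x k) (featureBlock y k) = featureCoeff d k * inner ℝ x y ^ k := by
  rw [← sum_tensorPow_mul, Finset.mul_sum, PiLp.inner_apply]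
  refine Finset.sum_congr rfl fun i _ => ?_
  have := Real.mul_self_sqrt (featureCoeff_pos hd k).le
  simp only [featureBlock, featureVec, RCLike.inner_apply, conj_trivial]
  rw [← this]
  ring_nf
  rw [Real.sqrt_sq (Real.sqrt_nonneg _)]

theorem memlp_featureBlock {d : ℕ} (hd : 1 ≤ d) (x : EuclideanSpace ℝ (Fin d)) :
    Memℓp (fun k => featureBlock (clamp x) k) 2 := by
  refine memℓp_gen ?_
  have := (hasSum_featureCoeff_mul_pow hd (abs_inner_clamp_le x x)).summable
  refine this.congr fun k => ?_
  rw [← inner_featureBlock hd, real_inner_self_eq_norm_sq]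
  norm_num

/-- The expansion is available only for `|t| ≤ d`. Composing with `clamp` makes `Φ` defined, bounded
and continuous on the whole space, without changing it on the sphere that carries the data. -/
theorem exists_featureMap {d : ℕ} (hd : 1 ≤ d) :
    ∃ Φ : EuclideanSpace ℝ (Fin d) → FeatureSpace d, Continuous Φ ∧
      (∀ x, ‖Φ x‖ ^ 2 ≤ ((d : ℝ) + 1) / 2) ∧
      (∀ x y, ‖x‖ = √(d : ℝ) → ‖y‖ = √(d : ℝ) → inner ℝ (Φ x) (Φ y) = ntkKernel x y) ∧
      ∀ (p : ℕ) (β : EuclideanSpace ℝ (Fin d)), ‖β‖ ≤ 1 →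
        ∃ w : FeatureSpace d, ‖w‖ ^ 2 ≤ 1 / featureCoeff d p ∧
          ∀ x, ‖x‖ = √(d : ℝ) → inner ℝ (Φ x) w = target β p x := by
  have hd' : (1 : ℝ) ≤ d := by exact_mod_cast hd
  let Φ : EuclideanSpace ℝ (Fin d) → FeatureSpace d := fun x => ⟨_, memlp_featureBlock hd x⟩
  have hinner : ∀ x y, inner ℝ (Φ x) (Φ y) = ntkProfile d (inner ℝ (clamp x) (clamp y)) := by
    intro x y
    refine (lp.hasSum_inner (Φ x) (Φ y)).unique ?_
    refine (hasSum_featureCoeff_mul_pow hd (abs_inner_clamp_le x y)).congr_fun fun k => ?_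
    exact inner_featureBlock hd _ _ _
  have hnorm : ∀ x, ‖Φ x‖ ^ 2 ≤ ((d : ℝ) + 1) / 2 := by
    intro x
    have h1 : ntkProfile d d = ((d : ℝ) + 1) / 2 := by
      have := Real.pi_pos
      rw [ntkProfile, add_comm 1 (d : ℝ), div_self (by positivity), Real.arcsin_one]
      field_simp
      ring
    rw [← real_inner_self_eq_norm_sq, hinner, ← h1]
    refine hasSum_le (fun k => ?_) (hasSum_featureCoeff_mul_pow hd (abs_inner_clamp_le x x))
      (hasSum_featureCoeff_mul_pow hd (t := d) (by simp))
    have h2 := abs_le.1 (abs_inner_clamp_le x x)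
    have h3 : 0 ≤ inner ℝ (clamp x) (clamp x) := real_inner_self_nonneg
    have := featureCoeff_pos hd k
    gcongr
    exact h2.2
  refine ⟨Φ, ?_, hnorm, ?_, ?_⟩
  · refine continuous_iff_continuousAt.2 fun x => ?_
    refine tendsto_iff_norm_sub_tendsto_zero.2 ?_
    have hc := continuous_clamp hd
    have hG := continuous_ntkProfile d
    -- Distances between features depend only on kernel values, so `Φ` inherits its continuity from
    -- `ntkProfile`.
    have h1 : ∀ y, ‖Φ y - Φ x‖ = √(ntkProfile d (inner ℝ (clamp y) (clamp y)) -
        2 * ntkProfile d (inner ℝ (clamp y) (clamp x)) +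
          ntkProfile d (inner ℝ (clamp x) (clamp x))) := by
      intro y
      rw [← hinner, ← hinner, ← hinner, real_inner_self_eq_norm_sq, real_inner_self_eq_norm_sq,
        ← norm_sub_sq_real, Real.sqrt_sq (norm_nonneg _)]
    have h2 : Continuous fun y => ‖Φ y - Φ x‖ := by
      simp_rw [h1]
      fun_prop
    simpa using h2.tendsto x
  · intro x y hx hy
    rw [hinner, clamp_eq_self hd hx, clamp_eq_self hd hy, ntkKernel_eq]
    rfl
  · intro p β hβ
    have hp := featureCoeff_pos hd p
    have hsq := Real.mul_self_sqrt hp.le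
    have hs := Real.sqrt_pos.2 hp
    -- Block `p` is `(1/d_p) · √d_p β^{⊗p} = β^{⊗p}/√d_p`, which is `w̄`.
    refine ⟨lp.single 2 p ((1 / featureCoeff d p) • featureBlock β p), ?_, ?_⟩
    · rw [lp.norm_single (by norm_num), norm_smul, mul_pow, ← real_inner_self_eq_norm_sq (featureBlock β p),
        inner_featureBlock hd, real_inner_self_eq_norm_sq, Real.norm_of_nonneg (by positivity)]
      have : (‖β‖ ^ 2) ^ p ≤ 1 := pow_le_one₀ (by positivity) (pow_le_one₀ (by positivity) hβ)
      calc (1 / featureCoeff d p) ^ 2 * (featureCoeff d p * (‖β‖ ^ 2) ^ p)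
          = 1 / featureCoeff d p * (‖β‖ ^ 2) ^ p := by field_simp
        _ ≤ 1 / featureCoeff d p := mul_le_of_le_one_right (by positivity) this
    · intro x hx
      rw [lp.inner_single_right, inner_smul_right]
      change _ * inner ℝ (featureBlock (clamp x) p) _ = _
      rw [inner_featureBlock hd, clamp_eq_self hd hx, target]
      field_simp

/-! ### Hoeffding's inequality in Hilbert space and the uniform deviation bound. -/

/-- The series `∑ x^n/(2n)!` has nonnegative coefficients. -/
theorem convexOn_cosh_sqrt : ConvexOn ℝ (Set.Ici 0) fun x => Real.cosh √x := by
  have hs : ∀ x : ℝ, 0 ≤ x → HasSum (fun n : ℕ => x ^ n / ((2 * n) ! : ℝ)) (Real.cosh √x) := by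
    intro x hx
    refine (Real.hasSum_cosh √x).congr_fun fun n => ?_
    rw [pow_mul, Real.sq_sqrt hx]
  refine ⟨convex_Ici 0, fun x hx y hy a b ha hb hab => ?_⟩
  have hx' : 0 ≤ x := hx
  have hy' : 0 ≤ y := hy
  refine hasSum_le (fun n => ?_) (hs _ (by simp only [smul_eq_mul]; positivity))
    (((hs x hx').mul_left a).add ((hs y hy').mul_left b))
  have := (convexOn_pow n).2 hx hy ha hb hab
  simp only [smul_eq_mul] at this ⊢
  rw [← mul_div_assoc, ← mul_div_assoc, ← add_div]
  gcongr

/-- With `A = ‖s‖² + L²` and `b = 2‖s‖L`, `‖s + z‖²` is at most `A + 2⟪s, z⟫`, a point of `[A - b, A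
+ b]`. The convex function `cosh √x` lies below its chord there. At the midpoint the chord is the
mean of `cosh(‖s‖ ± L)`, that is `cosh ‖s‖ cosh L`, and its slope gives a term linear in `z`, which
vanishes when a centred `z` is integrated. -/
theorem exists_cosh_norm_add_le {H : Type*} [NormedAddCommGroup H] [InnerProductSpace ℝ H]
    (s : H) {L : ℝ} (hL : 0 ≤ L) :
    ∃ m : ℝ, ∀ z : H, ‖z‖ ≤ L →
      Real.cosh ‖s + z‖ ≤ Real.cosh ‖s‖ * Real.cosh L + m * inner ℝ s z := by
  set A := ‖s‖ ^ 2 + L ^ 2 with hA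
  set b := 2 * ‖s‖ * L with hb
  have hb0 : 0 ≤ b := by positivity
  have hAb1 : A - b = |‖s‖ - L| ^ 2 := by rw [sq_abs, hA, hb]; ring
  have hAb2 : A + b = (‖s‖ + L) ^ 2 := by rw [hA, hb]; ring
  set m := (Real.cosh √(A + b) - Real.cosh √(A - b)) / (2 * b) with hm
  refine ⟨2 * m, fun z hz => ?_⟩
  have hB : |2 * inner ℝ s z| ≤ b := by
    rw [abs_mul, abs_two, hb, mul_assoc]
    have := (abs_real_inner_le_norm s z).trans (mul_le_mul_of_nonneg_left hz (norm_nonneg s))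
    linarith
  have hB' := abs_le.1 hB
  have h1 : Real.cosh ‖s + z‖ ≤ Real.cosh √(A + 2 * inner ℝ s z) := by
    rw [Real.cosh_le_cosh, abs_of_nonneg (norm_nonneg _), abs_of_nonneg (Real.sqrt_nonneg _)]
    refine Real.le_sqrt_of_sq_le ?_
    rw [norm_add_sq_real, hA]
    have : ‖z‖ ^ 2 ≤ L ^ 2 := by gcongr
    linarith
  have h2 : Real.cosh ‖s‖ * Real.cosh L = (Real.cosh √(A + b) + Real.cosh √(A - b)) / 2 := by
    rw [hAb1, hAb2, Real.sqrt_sq (by positivity), Real.sqrt_sq (by positivity), Real.cosh_abs,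
      Real.cosh_add, Real.cosh_sub]
    ring
  refine h1.trans ?_
  rw [h2]
  rcases hb0.eq_or_lt with h0 | h0
  · have h3 : inner ℝ s z = 0 := by
      rw [← h0] at hB
      have := abs_nonpos_iff.1 hB
      linarith
    rw [h3, ← h0]
    simp
  · have hAb : 0 ≤ A - b := by rw [hAb1]; positivity
    obtain ⟨-, hconv⟩ := convexOn_cosh_sqrt
    have h3 := hconv (x := A - b) (y := A + b) hAb (by simp; linarith)
      (a := (b - 2 * inner ℝ s z) / (2 * b)) (b := (b + 2 * inner ℝ s z) / (2 * b))
      (div_nonneg (by linarith) (by linarith)) (div_nonneg (by linarith) (by linarith))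
      (by field_simp; ring)
    simp only [smul_eq_mul] at h3
    have h4 : (b - 2 * inner ℝ s z) / (2 * b) * (A - b) + (b + 2 * inner ℝ s z) / (2 * b) * (A + b) =
        A + 2 * inner ℝ s z := by
      field_simp
      ring
    rw [h4] at h3
    refine h3.trans (le_of_eq ?_)
    rw [hm]
    field_simp
    ring

theorem lintegral_cosh_norm_add_le {Ω H : Type*} [MeasurableSpace Ω] [NormedAddCommGroup H]
    [InnerProductSpace ℝ H] [CompleteSpace H] {μ : Measure Ω} [IsProbabilityMeasure μ] {Z : Ω → H}
    (hZ : StronglyMeasurable Z) {L : ℝ} (hL : 0 ≤ L) (hZL : ∀ ω, ‖Z ω‖ ≤ L)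
    (h0 : ∫ ω, Z ω ∂μ = 0) (s : H) :
    ∫⁻ ω, ENNReal.ofReal (Real.cosh ‖s + Z ω‖) ∂μ ≤
      ENNReal.ofReal (Real.cosh ‖s‖ * Real.cosh L) := by
  obtain ⟨m, hm⟩ := exists_cosh_norm_add_le s hL
  have hint : Integrable Z μ := Integrable.of_bound hZ.aestronglyMeasurable L (.of_forall hZL)
  have hint' : Integrable (fun ω => Real.cosh ‖s‖ * Real.cosh L + m * inner ℝ s (Z ω)) μ :=
    (integrable_const _).add ((hint.const_inner s).const_mul m)
  calc ∫⁻ ω, ENNReal.ofReal (Real.cosh ‖s + Z ω‖) ∂μ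
      ≤ ∫⁻ ω, ENNReal.ofReal (Real.cosh ‖s‖ * Real.cosh L + m * inner ℝ s (Z ω)) ∂μ :=
        lintegral_mono fun ω => ENNReal.ofReal_le_ofReal (hm _ (hZL ω))
    _ = ENNReal.ofReal (∫ ω, (Real.cosh ‖s‖ * Real.cosh L + m * inner ℝ s (Z ω)) ∂μ) :=
        (ofReal_integral_eq_lintegral_ofReal hint'
          (.of_forall fun ω => (Real.cosh_pos _).le.trans (hm _ (hZL ω)))).symm
    _ = ENNReal.ofReal (Real.cosh ‖s‖ * Real.cosh L) := by
        rw [integral_add (integrable_const _) ((hint.const_inner s).const_mul m),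
          integral_const, integral_const_mul, integral_inner hint, h0]
        simp

/-- The arbitrary starting point `s` lets the induction peel off one independent summand at a time,
each at the cost of a factor `cosh L`. -/
theorem lintegral_cosh_norm_add_sum_le {Ω H : Type*} [MeasurableSpace Ω] [NormedAddCommGroup H]
    [InnerProductSpace ℝ H] [CompleteSpace H] {μ : Measure Ω} [IsProbabilityMeasure μ] {Z : Ω → H}
    (hZ : StronglyMeasurable Z) {L : ℝ} (hL : 0 ≤ L) (hZL : ∀ ω, ‖Z ω‖ ≤ L)
    (h0 : ∫ ω, Z ω ∂μ = 0) (n : ℕ) (s : H) :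
    ∫⁻ S, ENNReal.ofReal (Real.cosh ‖s + ∑ i, Z (S i)‖) ∂(Measure.pi fun _ : Fin n => μ) ≤
      ENNReal.ofReal (Real.cosh ‖s‖ * Real.cosh L ^ n) := by
  induction n generalizing s with
  | zero => simp
  | succ n ih =>
    have hmp := measurePreserving_piFinSuccAbove (fun _ : Fin (n + 1) => μ) 0
    have hsm : StronglyMeasurable fun z : Ω × (Fin n → Ω) => s + Z z.1 + ∑ i, Z (z.2 i) := by
      refine (stronglyMeasurable_const.add (hZ.comp_measurable measurable_fst)).add ?_
      refine Finset.stronglyMeasurable_fun_sum _ fun i _ => ?_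
      exact hZ.comp_measurable ((measurable_pi_apply i).comp measurable_snd)
    have hm : Measurable fun z : Ω × (Fin n → Ω) =>
        ENNReal.ofReal (Real.cosh ‖s + Z z.1 + ∑ i, Z (z.2 i)‖) :=
      ENNReal.measurable_ofReal.comp (Real.measurable_cosh.comp hsm.norm.measurable)
    calc ∫⁻ S, ENNReal.ofReal (Real.cosh ‖s + ∑ i, Z (S i)‖) ∂(Measure.pi fun _ : Fin (n + 1) => μ)
        = ∫⁻ S, (fun z : Ω × (Fin n → Ω) =>
            ENNReal.ofReal (Real.cosh ‖s + Z z.1 + ∑ i, Z (z.2 i)‖))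
            (MeasurableEquiv.piFinSuccAbove (fun _ => Ω) 0 S)
            ∂(Measure.pi fun _ : Fin (n + 1) => μ) := by
          refine lintegral_congr fun S => ?_
          simp [Fin.sum_univ_succ, add_assoc, Fin.tail]
      _ = ∫⁻ z, ENNReal.ofReal (Real.cosh ‖s + Z z.1 + ∑ i, Z (z.2 i)‖)
            ∂(μ.prod (Measure.pi fun _ : Fin n => μ)) := hmp.lintegral_comp hm
      _ = ∫⁻ x, ∫⁻ S, ENNReal.ofReal (Real.cosh ‖s + Z x + ∑ i, Z (S i)‖)
            ∂(Measure.pi fun _ : Fin n => μ) ∂μ := lintegral_prod _ hm.aemeasurable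
      _ ≤ ∫⁻ x, ENNReal.ofReal (Real.cosh ‖s + Z x‖) * ENNReal.ofReal (Real.cosh L ^ n) ∂μ := by
          refine lintegral_mono fun x => (ih (s + Z x)).trans_eq ?_
          rw [ENNReal.ofReal_mul (Real.cosh_pos _).le]
      _ = (∫⁻ x, ENNReal.ofReal (Real.cosh ‖s + Z x‖) ∂μ) * ENNReal.ofReal (Real.cosh L ^ n) := by
          rw [lintegral_mul_const']
          exact ENNReal.ofReal_ne_top
      _ ≤ ENNReal.ofReal (Real.cosh ‖s‖ * Real.cosh L) * ENNReal.ofReal (Real.cosh L ^ n) := by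
          gcongr
          exact lintegral_cosh_norm_add_le hZ hL hZL h0 s
      _ = ENNReal.ofReal (Real.cosh ‖s‖ * Real.cosh L ^ (n + 1)) := by
          have := Real.cosh_pos ‖s‖
          have := Real.cosh_pos L
          rw [← ENNReal.ofReal_mul (by positivity)]
          congr 1
          ring

/-- Hoeffding's inequality for independent bounded random vectors in a Hilbert space. -/
theorem measure_norm_sum_ge_le {Ω H : Type*} [MeasurableSpace Ω] [NormedAddCommGroup H]
    [InnerProductSpace ℝ H] [CompleteSpace H] {μ : Measure Ω} [IsProbabilityMeasure μ] {Z : Ω → H}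
    (hZ : StronglyMeasurable Z) {L : ℝ} (hL : 0 < L) (hZL : ∀ ω, ‖Z ω‖ ≤ L)
    (h0 : ∫ ω, Z ω ∂μ = 0) {n : ℕ} (hn : 1 ≤ n) {t : ℝ} (ht : 0 ≤ t) :
    Measure.pi (fun _ : Fin n => μ) {S | t ≤ ‖∑ i, Z (S i)‖} ≤
      ENNReal.ofReal (2 * Real.exp (-(t ^ 2 / (2 * n * L ^ 2)))) := by
  have hn' : (0 : ℝ) < n := by exact_mod_cast hn
  -- This `c` minimizes the exponent `n c² L²/2 - c t` in the Chernoff argument.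
  set c : ℝ := t / (n * L ^ 2) with hc
  have hc0 : 0 ≤ c := by positivity
  have h1 := lintegral_cosh_norm_add_sum_le (μ := μ) (Z := fun ω => c • Z ω) (hZ.const_smul c)
    (L := c * L) (by positivity) (fun ω => by
      rw [norm_smul, Real.norm_of_nonneg hc0]; exact mul_le_mul_of_nonneg_left (hZL ω) hc0)
    (by rw [integral_smul, h0, smul_zero]) n 0
  have hsm : Measurable fun S : Fin n → Ω =>
      ENNReal.ofReal (Real.cosh ‖0 + ∑ i, c • Z (S i)‖) := by
    refine ENNReal.measurable_ofReal.comp (Real.measurable_cosh.comp (StronglyMeasurable.measurable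
      (StronglyMeasurable.norm (stronglyMeasurable_const.add ?_))))
    refine Finset.stronglyMeasurable_fun_sum _ fun i _ => ?_
    exact (hZ.const_smul c).comp_measurable (measurable_pi_apply i)
  have h2 := (mul_meas_ge_le_lintegral hsm (ENNReal.ofReal (Real.cosh (c * t)))).trans h1
  have hsub : {S : Fin n → Ω | t ≤ ‖∑ i, Z (S i)‖} ⊆ {S | ENNReal.ofReal (Real.cosh (c * t)) ≤
      ENNReal.ofReal (Real.cosh ‖0 + ∑ i, c • Z (S i)‖)} := by
    intro S hS
    refine ENNReal.ofReal_le_ofReal ?_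
    rw [zero_add, ← Finset.smul_sum, norm_smul, Real.norm_of_nonneg hc0, Real.cosh_le_cosh,
      abs_of_nonneg (by positivity), abs_of_nonneg (by positivity)]
    exact mul_le_mul_of_nonneg_left hS hc0
  refine (measure_mono hsub).trans ?_
  have hch := Real.cosh_pos (c * t)
  have h3 : Real.cosh ‖(0 : H)‖ * Real.cosh (c * L) ^ n ≤
      Real.cosh (c * t) * (2 * Real.exp (-(t ^ 2 / (2 * n * L ^ 2)))) := by
    rw [norm_zero, Real.cosh_zero, one_mul]
    calc Real.cosh (c * L) ^ n ≤ Real.exp ((c * L) ^ 2 / 2) ^ n := by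
          gcongr
          exact Real.cosh_le_exp_half_sq _
      _ = Real.exp (c * t) / 2 * (2 * Real.exp (-(t ^ 2 / (2 * n * L ^ 2)))) := by
          have he : n * ((c * L) ^ 2 / 2) = c * t + -(t ^ 2 / (2 * n * L ^ 2)) := by
            rw [hc]
            field_simp
            ring
          rw [← Real.exp_nat_mul, he, Real.exp_add]
          ring
      _ ≤ _ := by
          gcongr
          rw [Real.cosh_eq]
          have := Real.exp_pos (-(c * t))
          linarith
  refine (ENNReal.mul_le_mul_iff_right (a := ENNReal.ofReal (Real.cosh (c * t)))
    (by simpa using hch) ENNReal.ofReal_ne_top).1 (h2.trans ?_)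
  rw [← ENNReal.ofReal_mul hch.le]
  exact ENNReal.ofReal_le_ofReal h3

open scoped TensorProduct in
/-- Uniform deviation of the quadratic form of the empirical covariance operator. -/
theorem measure_quadratic_deviation_le {Ω H : Type*} [TopologicalSpace Ω]
    [SecondCountableTopology Ω] [MeasurableSpace Ω]
    [OpensMeasurableSpace Ω] [NormedAddCommGroup H] [InnerProductSpace ℝ H]
    {μ : Measure Ω} [IsProbabilityMeasure μ] {Φ : Ω → H} (hΦ : Continuous Φ) {R : ℝ} (hR : 0 < R)
    (hΦR : ∀ ω, ‖Φ ω‖ ^ 2 ≤ R) {n : ℕ} (hn : 1 ≤ n) {t : ℝ} (ht : 0 ≤ t) :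
    Measure.pi (fun _ : Fin n => μ) {S | ¬ ∀ g : H, ∫ ω, inner ℝ (Φ ω) g ^ 2 ∂μ ≤
        (1 / n : ℝ) * ∑ i, inner ℝ (Φ (S i)) g ^ 2 + ‖g‖ ^ 2 * t} ≤
      ENNReal.ofReal (2 * Real.exp (-(n * t ^ 2 / (8 * R ^ 2)))) := by
  have hn' : (0 : ℝ) < n := by exact_mod_cast hn
  -- `⟪Φ, g⟫² = ⟪Φ ⊗ Φ, g ⊗ g⟫` is linear in `Φ ⊗ Φ`. One norm bound for the deviation of the mean
  -- of `Φ ⊗ Φ` therefore serves all `g` simultaneously. The completion makes room for the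
  -- expectation.
  let Ψ : Ω → UniformSpace.Completion (H ⊗[ℝ] H) := fun ω => ((Φ ω ⊗ₜ[ℝ] Φ ω : H ⊗[ℝ] H) : _)
  have hΨc : Continuous Ψ := (UniformSpace.Completion.continuous_coe _).comp
    (TensorProduct.continuous_tmul.comp (hΦ.prodMk hΦ))
  have hΨm : StronglyMeasurable Ψ := hΨc.stronglyMeasurable
  have hΨR : ∀ ω, ‖Ψ ω‖ ≤ R := by
    intro ω
    rw [UniformSpace.Completion.norm_coe, TensorProduct.norm_tmul, ← sq]
    exact hΦR ω
  have hint : Integrable Ψ μ := Integrable.of_bound hΨm.aestronglyMeasurable R (.of_forall hΨR)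
  set M := ∫ ω, Ψ ω ∂μ with hM
  have hMR : ‖M‖ ≤ R := by
    simpa using norm_integral_le_of_norm_le_const (μ := μ) (.of_forall hΨR)
  have key := measure_norm_sum_ge_le (μ := μ) (Z := fun ω => Ψ ω - M)
    (hΨm.sub stronglyMeasurable_const) (L := 2 * R) (by positivity)
    (fun ω => (norm_sub_le _ _).trans (by linarith [hΨR ω]))
    (by rw [integral_sub hint (integrable_const _)]; simp [hM]) hn (t := n * t) (by positivity)
  have hexp : (n * t) ^ 2 / (2 * n * (2 * R) ^ 2) = n * t ^ 2 / (8 * R ^ 2) := by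
    field_simp
    ring
  rw [hexp] at key
  refine (measure_mono fun S hS => ?_).trans key
  simp only [Set.mem_ofPred_eq] at hS ⊢
  by_contra! hlt
  refine hS fun g => ?_
  let G : UniformSpace.Completion (H ⊗[ℝ] H) := ((g ⊗ₜ[ℝ] g : H ⊗[ℝ] H) : _)
  have hG : ‖G‖ = ‖g‖ ^ 2 := by
    rw [UniformSpace.Completion.norm_coe, TensorProduct.norm_tmul, ← sq]
  have hin : ∀ ω, inner ℝ (Ψ ω) G = inner ℝ (Φ ω) g ^ 2 := by
    intro ω
    rw [UniformSpace.Completion.inner_coe, TensorProduct.inner_tmul, ← sq]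
  have h1 : ∫ ω, inner ℝ (Φ ω) g ^ 2 ∂μ = inner ℝ M G := by
    simp_rw [← hin, real_inner_comm]
    exact integral_inner hint G
  have h2 : inner ℝ (∑ i, (Ψ (S i) - M)) G = ∑ i, inner ℝ (Φ (S i)) g ^ 2 - n * inner ℝ M G := by
    rw [sum_inner]
    simp [inner_sub_left, hin]
  have h3 : -(inner ℝ (∑ i, (Ψ (S i) - M)) G) ≤ n * t * ‖g‖ ^ 2 := by
    rw [← hG]
    refine (neg_le_abs _).trans ((abs_real_inner_le_norm _ _).trans ?_)
    gcongr
  rw [h1]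
  rw [h2] at h3
  have h4 : n * inner ℝ M G ≤ n * ((1 / n : ℝ) * ∑ i, inner ℝ (Φ (S i)) g ^ 2 + ‖g‖ ^ 2 * t) := by
    field_simp
    linarith
  exact le_of_mul_le_mul_left h4 hn'

/-! ### Gaussian computations: orthant probabilities and small balls. -/

theorem integral_cexp_dotProduct_pi_gaussianReal {ι : Type*} [Fintype ι] (v : NNReal) (c : ι → ℝ) :
    ∫ w, Complex.exp (((w ⬝ᵥ c : ℝ) : ℂ) * Complex.I)
      ∂(Measure.pi fun _ : ι => gaussianReal 0 v) =
      Complex.exp (((-(v * (c ⬝ᵥ c) / 2) : ℝ) : ℂ)) := by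
  have h1 : ∀ w : ι → ℝ, Complex.exp (((w ⬝ᵥ c : ℝ) : ℂ) * Complex.I) =
      ∏ i, Complex.exp ((c i : ℂ) * (w i : ℂ) * Complex.I) := by
    intro w
    rw [← Complex.exp_sum, ← Finset.sum_mul, dotProduct]
    push_cast
    simp_rw [mul_comm]
  simp_rw [h1]
  rw [integral_fintype_prod_eq_prod (𝕜 := ℂ)
    (f := fun (i : ι) (x : ℝ) => Complex.exp ((c i : ℂ) * (x : ℂ) * Complex.I))]
  simp_rw [← charFun_apply_real, charFun_gaussianReal]
  rw [← Complex.exp_sum]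
  congr 1
  simp only [dotProduct, Complex.ofReal_zero, mul_zero, zero_mul, zero_sub]
  push_cast
  rw [Finset.sum_neg_distrib, Finset.mul_sum, Finset.sum_div]
  congr 1
  refine Finset.sum_congr rfl fun i _ => by ring

theorem map_dotProduct_pi_gaussianReal {ι : Type*} [Fintype ι] (v : NNReal) (a : ι → ℝ) :
    (Measure.pi fun _ : ι => gaussianReal 0 v).map (fun w => w ⬝ᵥ a) =
      gaussianReal 0 (Real.toNNReal (a ⬝ᵥ a) * v) := by
  have hm : Measurable fun w : ι → ℝ => w ⬝ᵥ a := by unfold dotProduct; fun_prop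
  have := Measure.isProbabilityMeasure_map (μ := Measure.pi fun _ : ι => gaussianReal 0 v)
    hm.aemeasurable
  refine Measure.ext_of_charFun ?_
  ext t
  rw [charFun_gaussianReal, charFun_apply_real, integral_map hm.aemeasurable (by fun_prop)]
  have h := integral_cexp_dotProduct_pi_gaussianReal v (t • a)
  simp only [dotProduct_smul, smul_dotProduct, smul_eq_mul] at h
  push_cast at h
  rw [h]
  have : 0 ≤ a ⬝ᵥ a := Finset.sum_nonneg fun i _ => mul_self_nonneg _
  push_cast [Real.coe_toNNReal _ this]
  congr 1
  ring

/-- Comparison of characteristic functions: both pairs are centred Gaussian with the same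
covariance. The right side is a linear image of two independent coordinates, ready for polar
coordinates. -/
theorem map_dotProduct_pair_pi_gaussianReal {ι : Type*} [Fintype ι] (v : NNReal) {a b : ι → ℝ}
    {r z : ℝ} (ha : a ⬝ᵥ a = r ^ 2) (hb : b ⬝ᵥ b = r ^ 2) (hab : a ⬝ᵥ b = r ^ 2 * z)
    (hz : |z| ≤ 1) :
    (Measure.pi fun _ : ι => gaussianReal 0 v).map (fun w => (w ⬝ᵥ a, w ⬝ᵥ b)) =
      ((gaussianReal 0 v).prod (gaussianReal 0 v)).map
        (fun p => (r * p.1, r * (z * p.1 + √(1 - z ^ 2) * p.2))) := by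
  have hm : Measurable fun w : ι → ℝ => (w ⬝ᵥ a, w ⬝ᵥ b) := by unfold dotProduct; fun_prop
  have hm' : Measurable fun p : ℝ × ℝ => (r * p.1, r * (z * p.1 + √(1 - z ^ 2) * p.2)) := by
    fun_prop
  have := Measure.isProbabilityMeasure_map (μ := Measure.pi fun _ : ι => gaussianReal 0 v)
    hm.aemeasurable
  have := Measure.isProbabilityMeasure_map (μ := (gaussianReal 0 v).prod (gaussianReal 0 v))
    hm'.aemeasurable
  refine Measure.ext_of_charFunDual ?_
  ext L
  rw [charFunDual_apply, charFunDual_apply, integral_map hm.aemeasurable (by fun_prop),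
    integral_map hm'.aemeasurable (by fun_prop)]
  have hL : ∀ x y : ℝ, L (x, y) = x * L (1, 0) + y * L (0, 1) := by
    intro x y
    rw [← smul_eq_mul, ← smul_eq_mul, ← L.map_smul, ← L.map_smul, ← L.map_add]
    simp
  set s := L (1, 0)
  set t := L (0, 1)
  have h1 : ∀ w : ι → ℝ, L (w ⬝ᵥ a, w ⬝ᵥ b) = w ⬝ᵥ (s • a + t • b) := by
    intro w
    rw [hL, dotProduct_add, dotProduct_smul, dotProduct_smul, smul_eq_mul, smul_eq_mul]
    ring
  have h2 : ∀ p : ℝ × ℝ, Complex.exp ((L (r * p.1, r * (z * p.1 + √(1 - z ^ 2) * p.2)) : ℂ) *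
      Complex.I) = Complex.exp (((r * (s + t * z) : ℝ) : ℂ) * (p.1 : ℂ) * Complex.I) *
        Complex.exp (((r * t * √(1 - z ^ 2) : ℝ) : ℂ) * (p.2 : ℂ) * Complex.I) := by
    intro p
    rw [hL, ← Complex.exp_add]
    congr 1
    push_cast
    ring
  simp_rw [h1, h2]
  rw [integral_cexp_dotProduct_pi_gaussianReal,
    integral_prod_mul (fun x : ℝ => Complex.exp (((r * (s + t * z) : ℝ) : ℂ) * (x : ℂ) * Complex.I))
      (fun y : ℝ => Complex.exp (((r * t * √(1 - z ^ 2) : ℝ) : ℂ) * (y : ℂ) * Complex.I)),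
    ← charFun_apply_real, ← charFun_apply_real, charFun_gaussianReal, charFun_gaussianReal,
    ← Complex.exp_add]
  congr 1
  have hz2 : 0 ≤ 1 - z ^ 2 := by
    rw [sub_nonneg, ← sq_abs]
    exact pow_le_one₀ (abs_nonneg _) hz
  have h3 : (s • a + t • b) ⬝ᵥ (s • a + t • b) =
      (r * (s + t * z)) ^ 2 + (r * t) ^ 2 * √(1 - z ^ 2) ^ 2 := by
    rw [Real.sq_sqrt hz2]
    simp only [dotProduct_add, add_dotProduct, dotProduct_smul, smul_dotProduct, smul_eq_mul, ha,
      hb, hab, dotProduct_comm b a]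
    ring
  rw [h3]
  push_cast
  ring

theorem gaussianReal_prod_apply_of_polar {v : NNReal} (hv : v ≠ 0) {A : Set (ℝ × ℝ)}
    (hA : MeasurableSet A) {Θ : Set ℝ} (hΘ : MeasurableSet Θ)
    (h : ∀ r θ : ℝ, 0 < r → θ ∈ Set.Ioo (-Real.pi) Real.pi →
      ((r * Real.cos θ, r * Real.sin θ) ∈ A ↔ θ ∈ Θ)) :
    ((gaussianReal 0 v).prod (gaussianReal 0 v)) A * ENNReal.ofReal (2 * Real.pi) =
      volume (Θ ∩ Set.Ioo (-Real.pi) Real.pi) := by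
  set c : ℝ → ENNReal := fun r => ENNReal.ofReal r *
    (ENNReal.ofReal ((√(2 * Real.pi * v))⁻¹ ^ 2 * Real.exp (-r ^ 2 / (2 * v)))) with hc
  have hcm : Measurable c := by fun_prop
  have key : ∀ (A : Set (ℝ × ℝ)) (Θ : Set ℝ), MeasurableSet A → MeasurableSet Θ →
      (∀ r θ : ℝ, 0 < r → θ ∈ Set.Ioo (-Real.pi) Real.pi →
        ((r * Real.cos θ, r * Real.sin θ) ∈ A ↔ θ ∈ Θ)) →
      ((gaussianReal 0 v).prod (gaussianReal 0 v)) A =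
        (∫⁻ r in Set.Ioi 0, c r) * volume (Θ ∩ Set.Ioo (-Real.pi) Real.pi) := by
    intro A Θ hA hΘ h
    rw [gaussianReal_of_var_ne_zero _ hv, prod_withDensity (measurable_gaussianPDF 0 v)
      (measurable_gaussianPDF 0 v), withDensity_apply _ hA, ← lintegral_indicator hA,
      ← Measure.volume_eq_prod, ← lintegral_comp_polarCoord_symm, polarCoord_target]
    have h1 : ∀ p ∈ Set.Ioi (0 : ℝ) ×ˢ Set.Ioo (-Real.pi) Real.pi,
        ENNReal.ofReal p.1 • A.indicator (fun z => gaussianPDF 0 v z.1 * gaussianPDF 0 v z.2)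
          (polarCoord.symm p) = c p.1 * Θ.indicator 1 p.2 := by
      rintro ⟨r, θ⟩ ⟨hr, hθ⟩
      have hpol : polarCoord.symm (r, θ) = (r * Real.cos θ, r * Real.sin θ) := rfl
      rw [hpol]
      by_cases hmem : θ ∈ Θ
      · rw [Set.indicator_of_mem ((h r θ hr hθ).2 hmem), Set.indicator_of_mem hmem, Pi.one_apply,
          mul_one, smul_eq_mul, hc]
        simp only [gaussianPDF]
        rw [← ENNReal.ofReal_mul (gaussianPDFReal_nonneg _ _ _)]
        congr 2
        simp only [gaussianPDFReal, sub_zero]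
        rw [mul_mul_mul_comm, ← sq, ← Real.exp_add]
        congr 2
        have := Real.cos_sq_add_sin_sq θ
        field_simp
        linear_combination (-r ^ 2) * this
      · rw [Set.indicator_of_notMem (fun hh => hmem ((h r θ hr hθ).1 hh)),
          Set.indicator_of_notMem hmem, smul_zero, mul_zero]
    rw [setLIntegral_congr_fun (measurableSet_Ioi.prod measurableSet_Ioo) h1,
      Measure.volume_eq_prod, ← Measure.prod_restrict, lintegral_prod_mul hcm.aemeasurable
        ((measurable_one.indicator hΘ).aemeasurable), lintegral_indicator_one hΘ,
      Measure.restrict_apply hΘ]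
  -- The whole plane identifies the radial integral as `1/(2π)`, so it need not be computed.
  have huniv := key Set.univ Set.univ MeasurableSet.univ MeasurableSet.univ (by simp)
  rw [measure_univ, Set.univ_inter, Real.volume_Ioo, sub_neg_eq_add, ← two_mul] at huniv
  rw [key A Θ hA hΘ h, mul_right_comm, ← huniv, one_mul]

/-- In polar coordinates the conditions are `cos θ ≥ 0` and `cos(θ - α) ≥ 0` with `α = arccos z`.
They cut out an arc of length `π - α`. For `z = -1` the set of angles would not be the interval used
here: it also contains `-π/2`. -/
theorem pi_gaussianReal_orthant {ι : Type*} [Fintype ι] {v : NNReal} (hv : v ≠ 0) {a b : ι → ℝ}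
    {r z : ℝ} (hr : 0 < r) (ha : a ⬝ᵥ a = r ^ 2) (hb : b ⬝ᵥ b = r ^ 2)
    (hab : a ⬝ᵥ b = r ^ 2 * z) (hz1 : -1 < z) (hz2 : z ≤ 1) :
    (Measure.pi fun _ : ι => gaussianReal 0 v) {w | 0 ≤ w ⬝ᵥ a ∧ 0 ≤ w ⬝ᵥ b} =
      ENNReal.ofReal ((Real.pi - Real.arccos z) / (2 * Real.pi)) := by
  have hpi := Real.pi_pos
  have hm : Measurable fun w : ι → ℝ => (w ⬝ᵥ a, w ⬝ᵥ b) := by unfold dotProduct; fun_prop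
  have hm' : Measurable fun p : ℝ × ℝ => (r * p.1, r * (z * p.1 + √(1 - z ^ 2) * p.2)) := by
    fun_prop
  have hQ : MeasurableSet (Set.Ici (0 : ℝ) ×ˢ Set.Ici (0 : ℝ)) :=
    measurableSet_Ici.prod measurableSet_Ici
  have h0 : (Measure.pi fun _ : ι => gaussianReal 0 v) {w | 0 ≤ w ⬝ᵥ a ∧ 0 ≤ w ⬝ᵥ b} =
      ((Measure.pi fun _ : ι => gaussianReal 0 v).map (fun w => (w ⬝ᵥ a, w ⬝ᵥ b)))
        (Set.Ici (0 : ℝ) ×ˢ Set.Ici (0 : ℝ)) := by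
    rw [Measure.map_apply hm hQ]
    rfl
  rw [h0, map_dotProduct_pair_pi_gaussianReal v ha hb hab (abs_le.2 ⟨hz1.le, hz2⟩),
    Measure.map_apply hm' hQ]
  set α := Real.arccos z with hα
  have hcos : Real.cos α = z := Real.cos_arccos hz1.le hz2
  have hsin : Real.sin α = √(1 - z ^ 2) := Real.sin_arccos z
  have hα0 : 0 ≤ α := Real.arccos_nonneg z
  have hαpi : α < Real.pi := by
    refine lt_of_le_of_ne (Real.arccos_le_pi z) fun h => ?_
    rw [hα, Real.arccos_eq_pi] at h
    linarith
  have key := gaussianReal_prod_apply_of_polar hv (hm' hQ)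
    (measurableSet_Icc (a := α - Real.pi / 2) (b := Real.pi / 2)) ?_
  · have hsub : Set.Icc (α - Real.pi / 2) (Real.pi / 2) ⊆ Set.Ioo (-Real.pi) Real.pi :=
      fun x hx => ⟨by linarith [hx.1], by linarith [hx.2]⟩
    rw [Set.inter_eq_left.2 hsub, Real.volume_Icc] at key
    rw [ENNReal.ofReal_div_of_pos (by positivity), ENNReal.eq_div_iff (by simpa using hpi)
        ENNReal.ofReal_ne_top, mul_comm, key]
    congr 1
    ring
  · intro s θ hs hθ
    have h1 : z * (s * Real.cos θ) + √(1 - z ^ 2) * (s * Real.sin θ) = s * Real.cos (θ - α) := by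
      rw [Real.cos_sub, hcos, hsin]
      ring
    simp only [Set.mem_preimage, Set.mem_prod, Set.mem_Ici, h1, Set.mem_Icc]
    rw [mul_nonneg_iff_of_pos_left hr, mul_nonneg_iff_of_pos_left hs,
      mul_nonneg_iff_of_pos_left hr, mul_nonneg_iff_of_pos_left hs]
    constructor
    · rintro ⟨h2, h3⟩
      have h4 : θ ≤ Real.pi / 2 := by
        by_contra! h
        exact absurd h2 (Real.cos_neg_of_pi_div_two_lt_of_lt h (by linarith [hθ.2])).not_ge
      have h5 : -(Real.pi / 2) ≤ θ := by
        by_contra! h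
        have := Real.cos_neg_of_pi_div_two_lt_of_lt (x := -θ) (by linarith) (by linarith [hθ.1])
        rw [Real.cos_neg] at this
        linarith
      refine ⟨?_, h4⟩
      by_contra! h
      have := Real.cos_neg_of_pi_div_two_lt_of_lt (x := -(θ - α)) (by linarith) (by linarith)
      rw [Real.cos_neg] at this
      linarith
    · rintro ⟨h2, h3⟩
      exact ⟨Real.cos_nonneg_of_neg_pi_div_two_le_of_le (by linarith) h3,
        Real.cos_nonneg_of_neg_pi_div_two_le_of_le (by linarith) (by linarith)⟩

/-- The density is at most `1/√(2πV)`, the interval has length `2ε`, and `2 ≤ √(2π)`. -/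
theorem gaussianReal_abs_le_le {V : NNReal} (hV : V ≠ 0) {ε : ℝ} (hε : 0 ≤ ε) :
    gaussianReal 0 V {x | |x| ≤ ε} ≤ ENNReal.ofReal (ε / √V) := by
  have hV' : (0 : ℝ) < V := by positivity
  have hset : {x : ℝ | |x| ≤ ε} = Set.Icc (-ε) ε := by ext x; simp [abs_le]
  have hpi := Real.pi_gt_three
  rw [hset, gaussianReal_apply _ hV]
  calc ∫⁻ x in Set.Icc (-ε) ε, gaussianPDF 0 V x
      ≤ ∫⁻ _ in Set.Icc (-ε) ε, ENNReal.ofReal (√(2 * Real.pi * V))⁻¹ := by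
        refine lintegral_mono fun x => ENNReal.ofReal_le_ofReal ?_
        rw [gaussianPDFReal]
        refine mul_le_of_le_one_right (by positivity) (Real.exp_le_one_iff.2 ?_)
        rw [neg_div, neg_nonpos]
        positivity
    _ = ENNReal.ofReal ((√(2 * Real.pi * V))⁻¹ * (2 * ε)) := by
        rw [setLIntegral_const, Real.volume_Icc, ← ENNReal.ofReal_mul (by positivity)]
        congr 1
        ring
    _ ≤ ENNReal.ofReal (ε / √V) := by
        refine ENNReal.ofReal_le_ofReal ?_
        have h1 : 2 * √(V : ℝ) ≤ √(2 * Real.pi * V) := by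
          refine Real.le_sqrt_of_sq_le ?_
          rw [mul_pow, Real.sq_sqrt hV'.le]
          nlinarith
        have h2 : 0 < √(V : ℝ) := Real.sqrt_pos.2 hV'
        rw [inv_mul_le_iff₀ (by positivity), ← mul_div_assoc, le_div_iff₀ h2]
        nlinarith

/-! ### The random initialization. -/

/-- The activation pattern of a neuron. -/
noncomputable def activation {d : ℕ} (w : Fin (d + 1) → ℝ) (x : EuclideanSpace ℝ (Fin d)) : ℝ :=
  if 0 ≤ w ⬝ᵥ augment x then 1 else 0

/-- The tangent kernel of a network of finite width. -/
noncomputable def empiricalKernel {m d : ℕ} (w : Fin m → Fin (d + 1) → ℝ)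
    (x y : EuclideanSpace ℝ (Fin d)) : ℝ :=
  (m : ℝ)⁻¹ * ∑ k, (augment x ⬝ᵥ augment y) * (activation (w k) x * activation (w k) y)

/-- The fraction of the neurons whose preactivation at `x` has absolute value at most `ε`. -/
noncomputable def nearFraction {m d : ℕ} (w : Fin m → Fin (d + 1) → ℝ) (ε : ℝ)
    (x : EuclideanSpace ℝ (Fin d)) : ℝ :=
  (m : ℝ)⁻¹ * ∑ k, if |w k ⬝ᵥ augment x| ≤ ε then 1 else 0

theorem continuous_augment_apply {d : ℕ} (j : Fin (d + 1)) :
    Continuous fun x : EuclideanSpace ℝ (Fin d) => augment x j := by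
  refine Fin.lastCases ?_ (fun i => ?_) j
  · simp only [augment, Fin.snoc_last]
    fun_prop
  · simp only [augment, Fin.snoc_castSucc]
    fun_prop

theorem measurable_preactivation {d : ℕ} :
    Measurable fun z : EuclideanSpace ℝ (Fin d) × (Fin (d + 1) → ℝ) => z.2 ⬝ᵥ augment z.1 := by
  unfold dotProduct
  refine Finset.measurable_fun_sum _ fun j _ => ?_
  exact ((measurable_pi_apply j).comp measurable_snd).mul
    ((continuous_augment_apply j).measurable.comp measurable_fst)

theorem measurable_activation {d : ℕ} :
    Measurable fun z : EuclideanSpace ℝ (Fin d) × (Fin (d + 1) → ℝ) => activation z.2 z.1 :=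
  Measurable.ite (measurableSet_le measurable_const measurable_preactivation) measurable_const
    measurable_const

theorem activation_nonneg {d : ℕ} (w : Fin (d + 1) → ℝ) (x : EuclideanSpace ℝ (Fin d)) :
    0 ≤ activation w x := by
  unfold activation; split_ifs <;> norm_num

theorem activation_le_one {d : ℕ} (w : Fin (d + 1) → ℝ) (x : EuclideanSpace ℝ (Fin d)) :
    activation w x ≤ 1 := by
  unfold activation; split_ifs <;> norm_num

theorem activation_mul {d : ℕ} (w : Fin (d + 1) → ℝ) (x y : EuclideanSpace ℝ (Fin d)) :
    activation w x * activation w y =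
      {w : Fin (d + 1) → ℝ | 0 ≤ w ⬝ᵥ augment x ∧ 0 ≤ w ⬝ᵥ augment y}.indicator 1 w := by
  by_cases h1 : 0 ≤ w ⬝ᵥ augment x <;> by_cases h2 : 0 ≤ w ⬝ᵥ augment y <;>
    simp [activation, h1, h2]

theorem augment_dotProduct_self {d : ℕ} {x : EuclideanSpace ℝ (Fin d)} (hx : ‖x‖ = √(d : ℝ)) :
    augment x ⬝ᵥ augment x = (d : ℝ) + 1 := by
  rw [augment_dotProduct, real_inner_self_eq_norm_sq, hx, Real.sq_sqrt (by positivity)]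

theorem abs_augment_dotProduct_le {d : ℕ} {x y : EuclideanSpace ℝ (Fin d)} (hx : ‖x‖ = √(d : ℝ))
    (hy : ‖y‖ = √(d : ℝ)) : |augment x ⬝ᵥ augment y| ≤ (d : ℝ) + 1 := by
  rw [augment_dotProduct]
  refine (abs_add_le _ _).trans ?_
  rw [abs_one]
  linarith [abs_inner_le_of_norm hx hy]

/-- The law of the weights of one neuron. -/
noncomputable abbrev weightMeasure (d : ℕ) (v : NNReal) : Measure (Fin (d + 1) → ℝ) :=
  Measure.pi fun _ : Fin (d + 1) => gaussianReal 0 v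

theorem integral_activation_mul {d : ℕ} (hd : 1 ≤ d) {v : NNReal} (hv : v ≠ 0)
    {x y : EuclideanSpace ℝ (Fin d)} (hx : ‖x‖ = √(d : ℝ)) (hy : ‖y‖ = √(d : ℝ)) :
    ∫ w, (augment x ⬝ᵥ augment y) * (activation w x * activation w y) ∂(weightMeasure d v) =
      ntkKernel x y := by
  have hd' : (1 : ℝ) ≤ d := by exact_mod_cast hd
  have hD : (0 : ℝ) < (d : ℝ) + 1 := by positivity
  have hD2 : √((d : ℝ) + 1) ^ 2 = (d : ℝ) + 1 := Real.sq_sqrt hD.le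
  have habs := abs_le.1 (abs_inner_le_of_norm hx hy)
  have h := pi_gaussianReal_orthant (ι := Fin (d + 1)) hv (a := augment x) (b := augment y)
    (r := √((d : ℝ) + 1)) (z := (augment x ⬝ᵥ augment y) / ((d : ℝ) + 1)) (Real.sqrt_pos.2 hD)
    (by rw [hD2, augment_dotProduct_self hx]) (by rw [hD2, augment_dotProduct_self hy])
    (by rw [hD2]; field_simp)
    -- The bias excludes antipodal augmented inputs: `1 + ⟪x, y⟫ ≥ 1 - d > -(d + 1)`.
    (by rw [lt_div_iff₀ hD, augment_dotProduct]; linarith)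
    (by rw [div_le_one hD, augment_dotProduct]; linarith)
  have hpi := Real.pi_pos
  rw [integral_const_mul, ntkKernel]
  congr 1
  simp_rw [activation_mul]
  rw [integral_indicator_one, Measure.real, h, ENNReal.toReal_ofReal]
  · have := Real.arccos_le_pi ((augment x ⬝ᵥ augment y) / ((d : ℝ) + 1))
    exact div_nonneg (by linarith) (by positivity)
  · have hmeas : ∀ x : EuclideanSpace ℝ (Fin d),
        MeasurableSet {w : Fin (d + 1) → ℝ | 0 ≤ w ⬝ᵥ augment x} := fun x =>
      measurableSet_le measurable_const
        (measurable_preactivation.comp (measurable_prodMk_left (x := x)))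
    exact (hmeas x).inter (hmeas y)

theorem integral_sq_sum_pi {Ω : Type*} [MeasurableSpace Ω] {μ : Measure Ω} [IsProbabilityMeasure μ]
    {m : ℕ} {h : Fin m → Ω → ℝ} (hL : ∀ k, MemLp (h k) 2 μ) (h0 : ∀ k, ∫ ω, h k ω ∂μ = 0) :
    ∫ ω, (∑ k, h k (ω k)) ^ 2 ∂(Measure.pi fun _ : Fin m => μ) = ∑ k, ∫ ω, h k ω ^ 2 ∂μ := by
  have hL' : ∀ k, MemLp (fun ω : Fin m → Ω => h k (ω k)) 2 (Measure.pi fun _ : Fin m => μ) :=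
    fun k => (hL k).comp_measurePreserving (measurePreserving_eval (fun _ : Fin m => μ) k)
  have hsum : ∑ k, (fun ω : Fin m → Ω => h k (ω k)) = fun ω => ∑ k, h k (ω k) := by
    ext ω; simp
  have h1 := variance_sum_pi (μ := fun _ : Fin m => μ) hL
  rw [hsum, variance_of_integral_eq_zero] at h1
  · rw [h1]
    exact Finset.sum_congr rfl fun k _ =>
      variance_of_integral_eq_zero (hL k).1.aemeasurable (h0 k)
  · exact (memLp_finsetSum _ fun k _ => hL' k).1.aemeasurable
  · rw [integral_finsetSum _ fun k _ => (hL' k).integrable (by norm_num)]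
    refine Finset.sum_eq_zero fun k _ => ?_
    have hmp := measurePreserving_eval (fun _ : Fin m => μ) k
    rw [← h0 k]
    conv_rhs => rw [← hmp.map_eq]
    rw [integral_map hmp.measurable.aemeasurable (by rw [hmp.map_eq]; exact (hL k).1)]

instance : IsProbabilityMeasure signMeasure := by
  refine ⟨?_⟩
  simp only [signMeasure, Measure.smul_apply, Measure.add_apply, measure_univ, smul_eq_mul]
  rw [one_add_one_eq_two, ENNReal.inv_mul_cancel two_ne_zero ENNReal.ofNat_ne_top]

theorem integral_signMeasure (g : ℝ → ℝ) : ∫ a, g a ∂signMeasure = (g 1 + g (-1)) / 2 := by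
  rw [signMeasure, integral_smul_measure, integral_add_measure (integrable_dirac (by simp))
    (integrable_dirac (by simp)), integral_dirac, integral_dirac]
  simp
  ring

theorem memLp_id_signMeasure : MemLp (fun a : ℝ => a) 2 signMeasure := by
  refine MemLp.of_bound (C := 1) (by fun_prop) ?_
  refine Measure.ae_smul_measure (ae_add_measure_iff.2 ⟨?_, ?_⟩) _ <;> simp [ae_dirac_eq]

instance (m d : ℕ) (κ : ℝ) : IsProbabilityMeasure (initMeasure m d κ) := by
  unfold initMeasure
  infer_instance

theorem lintegral_sq_gaussianReal (V : NNReal) :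
    ∫⁻ t, ENNReal.ofReal (t ^ 2) ∂(gaussianReal 0 V) = V := by
  have hL : MemLp (fun t : ℝ => t) 2 (gaussianReal 0 V) := memLp_id_gaussianReal 2
  have h := variance_id_gaussianReal (μ := 0) (v := V)
  rw [variance_of_integral_eq_zero (by fun_prop) (by simp)] at h
  rw [← ofReal_integral_eq_lintegral_ofReal hL.integrable_sq (.of_forall fun t => sq_nonneg t)]
  simp only [id] at h
  rw [h, ENNReal.ofReal_coe_nnreal]

theorem measurable_dotProduct_right {ι : Type*} [Fintype ι] (u : ι → ℝ) :
    Measurable fun w : ι → ℝ => w ⬝ᵥ u := by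
  unfold dotProduct; fun_prop

theorem lintegral_preactivation {d : ℕ} (v : NNReal) {x : EuclideanSpace ℝ (Fin d)}
    (hx : ‖x‖ = √(d : ℝ)) {g : ℝ → ENNReal} (hg : Measurable g) :
    ∫⁻ w, g (w ⬝ᵥ augment x) ∂(weightMeasure d v) =
      ∫⁻ t, g t ∂(gaussianReal 0 (((d : NNReal) + 1) * v)) := by
  have h := map_dotProduct_pi_gaussianReal v (augment x)
  have h1 : Real.toNNReal ((d : ℝ) + 1) = (d : NNReal) + 1 := by
    ext
    rw [Real.coe_toNNReal _ (by positivity)]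
    simp
  rw [augment_dotProduct_self hx, h1] at h
  rw [← h, lintegral_map hg (measurable_dotProduct_right _)]

theorem network_eq {m d : ℕ} (a : Fin m → ℝ) (w : Fin m → Fin (d + 1) → ℝ)
    (x : EuclideanSpace ℝ (Fin d)) :
    network a w x = ∑ k, a k * (max 0 (w k ⬝ᵥ augment x) / √(m : ℝ)) := by
  refine Finset.sum_congr rfl fun k _ => by ring

theorem measurable_network {m d : ℕ} :
    Measurable fun z : EuclideanSpace ℝ (Fin d) × ((Fin m → ℝ) × (Fin m → Fin (d + 1) → ℝ)) =>
      network z.2.1 z.2.2 z.1 := by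
  unfold network
  refine Finset.measurable_fun_sum _ fun k _ => ?_
  refine Measurable.mul (by fun_prop) (measurable_const.max ?_)
  exact measurable_preactivation.comp (g := fun z : EuclideanSpace ℝ (Fin d) ×
    (Fin (d + 1) → ℝ) => z.2 ⬝ᵥ augment z.1) (f := fun z : EuclideanSpace ℝ (Fin d) ×
      ((Fin m → ℝ) × (Fin m → Fin (d + 1) → ℝ)) => (z.1, z.2.2 k)) (by fun_prop)

theorem measurable_empiricalKernel {m d : ℕ} (y : EuclideanSpace ℝ (Fin d)) :
    Measurable fun z : EuclideanSpace ℝ (Fin d) × (Fin m → Fin (d + 1) → ℝ) =>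
      empiricalKernel z.2 z.1 y := by
  unfold empiricalKernel
  refine measurable_const.mul (Finset.measurable_fun_sum _ fun k _ => ?_)
  refine Measurable.mul ?_ (Measurable.mul ?_ ?_)
  · simp only [augment_dotProduct]
    fun_prop
  · exact measurable_activation.comp (f := fun z : EuclideanSpace ℝ (Fin d) ×
      (Fin m → Fin (d + 1) → ℝ) => (z.1, z.2 k)) (by fun_prop)
  · exact measurable_activation.comp (f := fun z : EuclideanSpace ℝ (Fin d) ×
      (Fin m → Fin (d + 1) → ℝ) => (y, z.2 k)) (by fun_prop)

theorem measurable_nearFraction {m d : ℕ} (ε : ℝ) :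
    Measurable fun z : EuclideanSpace ℝ (Fin d) × (Fin m → Fin (d + 1) → ℝ) =>
      nearFraction z.2 ε z.1 := by
  unfold nearFraction
  refine measurable_const.mul (Finset.measurable_fun_sum _ fun k _ => ?_)
  refine Measurable.ite (measurableSet_le (Measurable.abs ?_) measurable_const) measurable_const
    measurable_const
  exact measurable_preactivation.comp (f := fun z : EuclideanSpace ℝ (Fin d) ×
    (Fin m → Fin (d + 1) → ℝ) => (z.1, z.2 k)) (by fun_prop)

theorem measurable_nearFraction_weights {m d : ℕ} (ε : ℝ) (x : EuclideanSpace ℝ (Fin d)) :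
    Measurable fun w : Fin m → Fin (d + 1) → ℝ => nearFraction w ε x := by
  have h : Measurable fun w : Fin m → Fin (d + 1) → ℝ => (x, w) := measurable_prodMk_left
  have h2 := measurable_nearFraction (m := m) (d := d) ε
  generalize nearFraction (m := m) (d := d) = F at *
  exact h2.comp h

/-- Independent centred signs remove all cross terms. -/
theorem integral_network_sq_signs {m d : ℕ} (w : Fin m → Fin (d + 1) → ℝ)
    (x : EuclideanSpace ℝ (Fin d)) :
    ∫⁻ a, ENNReal.ofReal (network a w x ^ 2) ∂(Measure.pi fun _ : Fin m => signMeasure) =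
      ENNReal.ofReal (∑ k, (max 0 (w k ⬝ᵥ augment x) / √(m : ℝ)) ^ 2) := by
  set c : Fin m → ℝ := fun k => max 0 (w k ⬝ᵥ augment x) / √(m : ℝ) with hc
  have hL : ∀ k, MemLp (fun a : ℝ => a * c k) 2 signMeasure :=
    fun k => memLp_id_signMeasure.mul_const _
  have h := integral_sq_sum_pi (μ := signMeasure) (h := fun k a => a * c k) hL
    (fun k => by rw [integral_signMeasure]; ring)
  have hL' : MemLp (fun a : Fin m → ℝ => ∑ k, a k * c k) 2
      (Measure.pi fun _ : Fin m => signMeasure) :=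
    memLp_finsetSum _ fun k _ =>
      (hL k).comp_measurePreserving (measurePreserving_eval (fun _ : Fin m => signMeasure) k)
  simp_rw [network_eq]
  rw [← ofReal_integral_eq_lintegral_ofReal hL'.integrable_sq (.of_forall fun t => sq_nonneg _), h]
  congr 1
  refine Finset.sum_congr rfl fun k _ => ?_
  rw [integral_signMeasure]
  ring

theorem lintegral_mean_pi {Ω : Type*} [MeasurableSpace Ω] {μ : Measure Ω} [IsProbabilityMeasure μ]
    {m : ℕ} (hm : 1 ≤ m) {g : Ω → ENNReal} (hg : Measurable g) :
    ∫⁻ w, ∑ k, ENNReal.ofReal (m : ℝ)⁻¹ * g (w k) ∂(Measure.pi fun _ : Fin m => μ) =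
      ∫⁻ ω, g ω ∂μ := by
  have hm' : (0 : ℝ) < m := by exact_mod_cast hm
  rw [lintegral_finsetSum]
  swap
  · exact fun k _ => (hg.comp (measurable_pi_apply k)).const_mul _
  have h : ∀ k : Fin m, ∫⁻ w, ENNReal.ofReal (m : ℝ)⁻¹ * g (w k) ∂(Measure.pi fun _ : Fin m => μ) =
      ENNReal.ofReal (m : ℝ)⁻¹ * ∫⁻ ω, g ω ∂μ := fun k => by
    rw [lintegral_const_mul' _ _ ENNReal.ofReal_ne_top]
    congr 1
    exact (measurePreserving_eval (fun _ : Fin m => μ) k).lintegral_comp hg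
  rw [Finset.sum_congr rfl fun k _ => h k, Finset.sum_const, Finset.card_univ, Fintype.card_fin,
    nsmul_eq_mul, ← mul_assoc, ← ENNReal.ofReal_natCast, ← ENNReal.ofReal_mul hm'.le,
    mul_inv_cancel₀ hm'.ne', ENNReal.ofReal_one, one_mul]

/-- After averaging over the signs, the output has the second moment of one rectified neuron, at
most the variance `κ²(d+1)` of a preactivation. The bound does not depend on `m`. -/
theorem lintegral_network_sq_le {m d : ℕ} (hm : 1 ≤ m) (κ : ℝ) {x : EuclideanSpace ℝ (Fin d)}
    (hx : ‖x‖ = √(d : ℝ)) :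
    ∫⁻ θ, ENNReal.ofReal (network θ.1 θ.2 x ^ 2) ∂(initMeasure m d κ) ≤
      ENNReal.ofReal (κ ^ 2 * ((d : ℝ) + 1)) := by
  have hm' : (0 : ℝ) < m := by exact_mod_cast hm
  set v := Real.toNNReal (κ ^ 2) with hv
  have hvc : (v : ℝ) = κ ^ 2 := Real.coe_toNNReal _ (sq_nonneg κ)
  have hmeas : Measurable fun θ : (Fin m → ℝ) × (Fin m → Fin (d + 1) → ℝ) =>
      ENNReal.ofReal (network θ.1 θ.2 x ^ 2) :=
    ENNReal.measurable_ofReal.comp ((measurable_network.comp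
      (measurable_prodMk_left (x := x))).pow_const 2)
  rw [initMeasure, lintegral_prod_symm _ hmeas.aemeasurable]
  simp_rw [integral_network_sq_signs]
  have hg : Measurable fun t : ℝ => ENNReal.ofReal (t ^ 2) := by fun_prop
  calc ∫⁻ w, ENNReal.ofReal (∑ k, (max 0 (w k ⬝ᵥ augment x) / √(m : ℝ)) ^ 2)
        ∂(Measure.pi fun _ : Fin m => weightMeasure d v)
      ≤ ∫⁻ w, ∑ k, ENNReal.ofReal (m : ℝ)⁻¹ * ENNReal.ofReal ((w k ⬝ᵥ augment x) ^ 2)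
        ∂(Measure.pi fun _ : Fin m => weightMeasure d v) := by
        refine lintegral_mono fun w => ?_
        simp only
        rw [ENNReal.ofReal_sum_of_nonneg fun k _ => sq_nonneg _]
        refine Finset.sum_le_sum fun k _ => ?_
        rw [← ENNReal.ofReal_mul (by positivity)]
        refine ENNReal.ofReal_le_ofReal ?_
        rw [div_pow, Real.sq_sqrt hm'.le, div_eq_inv_mul]
        refine mul_le_mul_of_nonneg_left ?_ (by positivity)
        rw [← sq_abs (w k ⬝ᵥ augment x)]
        gcongr
        exact max_le (abs_nonneg _) (le_abs_self _)
    _ = ENNReal.ofReal (κ ^ 2 * ((d : ℝ) + 1)) := by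
        rw [lintegral_mean_pi (μ := weightMeasure d v) hm
          (g := fun w => ENNReal.ofReal ((w ⬝ᵥ augment x) ^ 2))
          (hg.comp (measurable_dotProduct_right _)), lintegral_preactivation v hx hg,
          lintegral_sq_gaussianReal, ← ENNReal.ofReal_coe_nnreal]
        congr 1
        push_cast
        rw [hvc]
        ring

theorem lintegral_weights {m d : ℕ} (κ : ℝ) {g : (Fin m → Fin (d + 1) → ℝ) → ENNReal}
    (hg : Measurable g) :
    ∫⁻ θ, g θ.2 ∂(initMeasure m d κ) =
      ∫⁻ w, g w ∂(Measure.pi fun _ : Fin m => weightMeasure d (Real.toNNReal (κ ^ 2))) :=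
  (measurePreserving_snd (μ := Measure.pi fun _ : Fin m => signMeasure)
    (ν := Measure.pi fun _ : Fin m => weightMeasure d (Real.toNNReal (κ ^ 2)))).lintegral_comp hg

/-- Anti-concentration of a preactivation, whose standard deviation is `κ√(d+1)`. Measuring the
threshold in units of `√(d+1)` cancels the dimension. -/
theorem lintegral_nearFraction_le {m d : ℕ} (hm : 1 ≤ m) {κ : ℝ} (hκ : 0 < κ) {ρ : ℝ} (hρ : 0 ≤ ρ)
    {x : EuclideanSpace ℝ (Fin d)} (hx : ‖x‖ = √(d : ℝ)) :
    ∫⁻ θ, ENNReal.ofReal (nearFraction θ.2 (ρ * √((d : ℝ) + 1)) x) ∂(initMeasure m d κ) ≤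
      ENNReal.ofReal (ρ / κ) := by
  have hm' : (0 : ℝ) < m := by exact_mod_cast hm
  obtain ⟨v, hv⟩ : ∃ v, v = Real.toNNReal (κ ^ 2) := ⟨_, rfl⟩
  have hvc : (v : ℝ) = κ ^ 2 := by rw [hv]; exact Real.coe_toNNReal _ (sq_nonneg κ)
  have hv0 : v ≠ 0 := by
    rw [hv, Ne, Real.toNNReal_eq_zero]
    have : 0 < κ ^ 2 := by positivity
    linarith
  obtain ⟨ε, hε⟩ : ∃ ε, ε = ρ * √((d : ℝ) + 1) := ⟨_, rfl⟩
  rw [← hε]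
  rw [lintegral_weights κ (g := fun w => ENNReal.ofReal (nearFraction w ε x))
    (measurable_nearFraction_weights ε x).ennreal_ofReal, ← hv]
  have hA : MeasurableSet {t : ℝ | |t| ≤ ε} := measurableSet_le (by fun_prop) measurable_const
  have hg : Measurable ({t : ℝ | |t| ≤ ε}.indicator (1 : ℝ → ENNReal)) := measurable_one.indicator hA
  have hpt : ∀ w : Fin m → Fin (d + 1) → ℝ, ENNReal.ofReal (nearFraction w ε x) =
      ∑ k, ENNReal.ofReal (m : ℝ)⁻¹ * {t : ℝ | |t| ≤ ε}.indicator 1 (w k ⬝ᵥ augment x) := by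
    intro w
    rw [nearFraction, Finset.mul_sum, ENNReal.ofReal_sum_of_nonneg]
    · refine Finset.sum_congr rfl fun k _ => ?_
      rw [ENNReal.ofReal_mul (by positivity)]
      congr 1
      by_cases h : |w k ⬝ᵥ augment x| ≤ ε <;> simp [h]
    · intro k _
      split_ifs <;> positivity
  rw [lintegral_congr hpt, lintegral_mean_pi (μ := weightMeasure d v) hm
    (g := fun w => {t : ℝ | |t| ≤ ε}.indicator 1 (w ⬝ᵥ augment x))
    (hg.comp (measurable_dotProduct_right _)), lintegral_preactivation v hx hg,
    lintegral_indicator_one hA]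
  refine (gaussianReal_abs_le_le (mul_ne_zero (by positivity) hv0)
    (by rw [hε]; positivity)).trans
    (le_of_eq ?_)
  congr 1
  push_cast
  rw [hvc, hε, Real.sqrt_mul (by positivity), Real.sqrt_sq hκ.le]
  have : 0 < √((d : ℝ) + 1) := Real.sqrt_pos.2 (by positivity)
  field_simp

/-- The empirical kernel is a mean of `m` independent variables with expectation `K` and absolute
value at most `d + 1`, so its variance is at most `(d+1)²/m`. -/
theorem lintegral_empiricalKernel_sub_sq_le {m d : ℕ} (hd : 1 ≤ d) (hm : 1 ≤ m) {κ : ℝ}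
    (hκ : 0 < κ) {x y : EuclideanSpace ℝ (Fin d)} (hx : ‖x‖ = √(d : ℝ)) (hy : ‖y‖ = √(d : ℝ)) :
    ∫⁻ θ, ENNReal.ofReal ((empiricalKernel θ.2 x y - ntkKernel x y) ^ 2) ∂(initMeasure m d κ) ≤
      ENNReal.ofReal (((d : ℝ) + 1) ^ 2 / m) := by
  have hm' : (0 : ℝ) < m := by exact_mod_cast hm
  set v := Real.toNNReal (κ ^ 2) with hv
  have hv0 : v ≠ 0 := by
    rw [hv, Ne, Real.toNNReal_eq_zero]
    have : 0 < κ ^ 2 := by positivity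
    linarith
  rw [lintegral_weights κ (g := fun w => ENNReal.ofReal ((empiricalKernel w x y - ntkKernel x y) ^ 2))
    (ENNReal.measurable_ofReal.comp ((((measurable_empiricalKernel y).comp
      (measurable_prodMk_left (x := x))).sub_const _).pow_const 2))]
  set g : (Fin (d + 1) → ℝ) → ℝ := fun w =>
    (augment x ⬝ᵥ augment y) * (activation w x * activation w y) with hg
  have hgm : Measurable g := measurable_const.mul
    ((measurable_activation.comp (measurable_prodMk_left (x := x))).mul
      (measurable_activation.comp (measurable_prodMk_left (x := y))))
  have hgb : ∀ w, |g w| ≤ (d : ℝ) + 1 := by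
    intro w
    rw [hg, abs_mul, abs_of_nonneg (mul_nonneg (activation_nonneg w x) (activation_nonneg w y))]
    calc |augment x ⬝ᵥ augment y| * (activation w x * activation w y)
        ≤ ((d : ℝ) + 1) * (1 * 1) := by
          gcongr
          · exact mul_nonneg (activation_nonneg w x) (activation_nonneg w y)
          · exact abs_augment_dotProduct_le hx hy
          · exact activation_nonneg w y
          · exact activation_le_one w x
          · exact activation_le_one w y
      _ = (d : ℝ) + 1 := by ring
  have hgL : MemLp g 2 (weightMeasure d v) :=
    MemLp.of_bound hgm.aestronglyMeasurable _ (.of_forall hgb)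
  have hgK : ∫ w, g w ∂(weightMeasure d v) = ntkKernel x y := integral_activation_mul hd hv0 hx hy
  have hvar : ∫ w, (g w - ntkKernel x y) ^ 2 ∂(weightMeasure d v) ≤ ((d : ℝ) + 1) ^ 2 := by
    have h1 := variance_le_expectation_sq (μ := weightMeasure d v) hgm.aestronglyMeasurable
    rw [variance_eq_integral hgm.aemeasurable, hgK] at h1
    refine h1.trans ?_
    have h2 : ∫ w, (g ^ 2) w ∂(weightMeasure d v) ≤
        ∫ _, ((d : ℝ) + 1) ^ 2 ∂(weightMeasure d v) := by
      refine integral_mono hgL.integrable_sq (integrable_const _) fun w => ?_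
      simp only [Pi.pow_apply]
      rw [← sq_abs]
      have := hgb w
      gcongr
    simpa using h2
  have hL : MemLp (fun w => (m : ℝ)⁻¹ * (g w - ntkKernel x y)) 2 (weightMeasure d v) :=
    (hgL.sub (memLp_const _)).const_mul _
  have hsum : ∀ w : Fin m → Fin (d + 1) → ℝ, empiricalKernel w x y - ntkKernel x y =
      ∑ k, (m : ℝ)⁻¹ * (g (w k) - ntkKernel x y) := by
    intro w
    have h1 : empiricalKernel w x y = (m : ℝ)⁻¹ * ∑ k, g (w k) := rfl
    rw [h1]
    clear_value g
    rw [← Finset.mul_sum, Finset.sum_sub_distrib, Finset.sum_const, Finset.card_univ,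
      Fintype.card_fin, nsmul_eq_mul]
    field_simp
  have hL' : MemLp (fun w : Fin m → Fin (d + 1) → ℝ =>
      ∑ k, (m : ℝ)⁻¹ * (g (w k) - ntkKernel x y)) 2
      (Measure.pi fun _ : Fin m => weightMeasure d v) :=
    memLp_finsetSum _ fun k _ =>
      hL.comp_measurePreserving (measurePreserving_eval (fun _ : Fin m => weightMeasure d v) k)
  simp_rw [hsum]
  rw [← ofReal_integral_eq_lintegral_ofReal hL'.integrable_sq (.of_forall fun t => sq_nonneg _),
    integral_sq_sum_pi (μ := weightMeasure d v) (h := fun _ w => (m : ℝ)⁻¹ * (g w - ntkKernel x y))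
      (fun _ => hL) (fun _ => by
        rw [integral_const_mul, integral_sub (hgL.integrable (by norm_num)) (integrable_const _), hgK]
        simp)]
  refine ENNReal.ofReal_le_ofReal ?_
  simp_rw [mul_pow]
  rw [integral_const_mul, Finset.sum_const, Finset.card_univ, Fintype.card_fin, nsmul_eq_mul]
  calc (m : ℝ) * ((m : ℝ)⁻¹ ^ 2 * ∫ w, (g w - ntkKernel x y) ^ 2 ∂(weightMeasure d v))
      ≤ (m : ℝ) * ((m : ℝ)⁻¹ ^ 2 * ((d : ℝ) + 1) ^ 2) := by gcongr
    _ = ((d : ℝ) + 1) ^ 2 / m := by field_simp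

/-- Markov's inequality for `∫ F dX + ∑ F(S_i)`, whose mean over `θ` is at most `(n+1)M` by Tonelli.
A single event controls population and sample. The exceptional set is bounded through inclusion, so
its measurability is not needed. -/
theorem measure_not_integral_le_and_sum_le {E Θ : Type*} [MeasurableSpace E] [MeasurableSpace Θ]
    {X : Measure E} [IsProbabilityMeasure X] {P : Measure Θ} [IsProbabilityMeasure P]
    {s : E → Prop} (hX : ∀ᵐ x ∂X, s x) {n : ℕ} {S : Fin n → E} (hS : ∀ i, s (S i))
    {F : E → Θ → ℝ} (hF : Measurable (Function.uncurry F)) (h0 : ∀ x θ, 0 ≤ F x θ) {M A : ℝ}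
    (hA : 0 < A)
    (hE : ∀ x, s x → ∫⁻ θ, ENNReal.ofReal (F x θ) ∂P ≤ ENNReal.ofReal M) :
    P {θ | ¬ (∫ x, F x θ ∂X ≤ A ∧ ∑ i, F (S i) θ ≤ A)} ≤ ENNReal.ofReal ((n + 1) * M / A) := by
  have hFx : ∀ x, Measurable (F x) := fun x => hF.comp measurable_prodMk_left
  have hFθ : ∀ θ, Measurable fun x => F x θ := fun θ => hF.comp measurable_prodMk_right
  have hsw : Measurable fun z : Θ × E => ENNReal.ofReal (F z.2 z.1) :=
    ENNReal.measurable_ofReal.comp (hF.comp measurable_swap)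
  set G : Θ → ENNReal := fun θ =>
    ∫⁻ x, ENNReal.ofReal (F x θ) ∂X + ∑ i, ENNReal.ofReal (F (S i) θ) with hG
  have hG1 : Measurable fun θ => ∫⁻ x, ENNReal.ofReal (F x θ) ∂X := hsw.lintegral_prod_right'
  have hG2 : Measurable fun θ => ∑ i, ENNReal.ofReal (F (S i) θ) :=
    Finset.measurable_fun_sum _ fun i _ => (hFx (S i)).ennreal_ofReal
  have hsub : {θ | ¬ (∫ x, F x θ ∂X ≤ A ∧ ∑ i, F (S i) θ ≤ A)} ⊆
      {θ | ENNReal.ofReal A ≤ G θ} := by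
    intro θ hθ
    simp only [Set.mem_ofPred_eq] at hθ ⊢
    by_contra! hlt
    refine hθ ⟨?_, ?_⟩
    · rw [integral_eq_lintegral_of_nonneg_ae (.of_forall fun x => h0 x θ)
        (hFθ θ).aestronglyMeasurable]
      exact ENNReal.toReal_le_of_le_ofReal hA.le (le_self_add.trans hlt.le)
    · rw [← ENNReal.ofReal_le_ofReal_iff hA.le, ENNReal.ofReal_sum_of_nonneg fun i _ => h0 _ _]
      exact le_add_self.trans hlt.le
  have hint : ∫⁻ θ, G θ ∂P ≤ ENNReal.ofReal ((n + 1) * M) := by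
    rw [hG, lintegral_add_left hG1, lintegral_finsetSum _ fun i _ => (hFx (S i)).ennreal_ofReal,
      lintegral_lintegral_swap hsw.aemeasurable]
    calc ∫⁻ x, ∫⁻ θ, ENNReal.ofReal (F x θ) ∂P ∂X + ∑ i, ∫⁻ θ, ENNReal.ofReal (F (S i) θ) ∂P
        ≤ ∫⁻ _, ENNReal.ofReal M ∂X + ∑ _i : Fin n, ENNReal.ofReal M := by
          refine add_le_add (lintegral_mono_ae (hX.mono hE)) (Finset.sum_le_sum fun i _ => hE _ (hS i))
      _ = ENNReal.ofReal ((n + 1) * M) := by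
          rw [lintegral_const, measure_univ, mul_one, Finset.sum_const, Finset.card_univ,
            Fintype.card_fin, nsmul_eq_mul, ENNReal.ofReal_mul (by positivity),
            ENNReal.ofReal_add (by positivity) (by positivity), ENNReal.ofReal_one,
            ENNReal.ofReal_natCast]
          ring
  refine (measure_mono hsub).trans ((meas_ge_le_lintegral_div (hG1.add hG2).aemeasurable
    (by simpa using hA) ENNReal.ofReal_ne_top).trans ?_)
  rw [ENNReal.ofReal_div_of_pos hA]
  exact ENNReal.div_le_div_right hint _

/-- The properties of the initialization `θ = (a, w(0))` that make gradient descent work. -/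
structure InitGood {m d n : ℕ} (X : Measure (EuclideanSpace ℝ (Fin d)))
    (S : Fin n → EuclideanSpace ℝ (Fin d)) (A ε τ ρ : ℝ)
    (θ : (Fin m → ℝ) × (Fin m → Fin (d + 1) → ℝ)) : Prop where
  sign : ∀ k, θ.1 k ^ 2 = 1
  net_integral : ∫ x, network θ.1 θ.2 x ^ 2 ∂X ≤ A
  net_sum : ∑ i, network θ.1 θ.2 (S i) ^ 2 ≤ A
  near_integral : ∫ x, nearFraction θ.2 (ρ * √((d : ℝ) + 1)) x ∂X ≤ ε
  near_sum : ∑ i, nearFraction θ.2 (ρ * √((d : ℝ) + 1)) (S i) ≤ ε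
  kernel_integral : ∫ x, ∑ j, (empiricalKernel θ.2 x (S j) - ntkKernel x (S j)) ^ 2 ∂X ≤ τ
  kernel_sum : ∑ i, ∑ j, (empiricalKernel θ.2 (S i) (S j) - ntkKernel (S i) (S j)) ^ 2 ≤ τ

theorem continuous_ntkKernel_left {d : ℕ} (y : EuclideanSpace ℝ (Fin d)) :
    Continuous fun x => ntkKernel x y := by
  have h := continuous_ntkProfile d
  have : (fun x => ntkKernel x y) = fun x => ntkProfile d (inner ℝ x y) := by
    ext x
    rw [ntkKernel_eq]
    rfl
  rw [this]
  fun_prop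

theorem nearFraction_nonneg {m d : ℕ} (w : Fin m → Fin (d + 1) → ℝ) (ε : ℝ)
    (x : EuclideanSpace ℝ (Fin d)) : 0 ≤ nearFraction w ε x := by
  refine mul_nonneg (by positivity) (Finset.sum_nonneg fun k _ => ?_)
  split_ifs <;> norm_num

theorem nearFraction_le_one {m d : ℕ} (w : Fin m → Fin (d + 1) → ℝ) (ε : ℝ)
    (x : EuclideanSpace ℝ (Fin d)) : nearFraction w ε x ≤ 1 := by
  rw [nearFraction]
  have h : ∑ k, (if |w k ⬝ᵥ augment x| ≤ ε then (1 : ℝ) else 0) ≤ m := by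
    calc ∑ k, (if |w k ⬝ᵥ augment x| ≤ ε then (1 : ℝ) else 0) ≤ ∑ _k : Fin m, (1 : ℝ) :=
          Finset.sum_le_sum fun k _ => by split_ifs <;> norm_num
      _ = m := by simp
  calc (m : ℝ)⁻¹ * ∑ k, (if |w k ⬝ᵥ augment x| ≤ ε then (1 : ℝ) else 0) ≤ (m : ℝ)⁻¹ * m := by gcongr
    _ ≤ 1 := inv_mul_le_one

theorem ae_signMeasure_sq : ∀ᵐ a ∂signMeasure, a ^ 2 = 1 := by
  refine Measure.ae_smul_measure (ae_add_measure_iff.2 ⟨?_, ?_⟩) _ <;> simp [ae_dirac_eq]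

theorem ae_initMeasure_sign (m d : ℕ) (κ : ℝ) : ∀ᵐ θ ∂(initMeasure m d κ), ∀ k, θ.1 k ^ 2 = 1 := by
  refine ae_all_iff.2 fun k => ?_
  have h1 : ∀ᵐ a ∂(Measure.pi fun _ : Fin m => signMeasure), a k ^ 2 = 1 :=
    (measurePreserving_eval (fun _ : Fin m => signMeasure) k).quasiMeasurePreserving.ae
      ae_signMeasure_sq
  exact (measurePreserving_fst (μ := Measure.pi fun _ : Fin m => signMeasure)
    (ν := Measure.pi fun _ : Fin m =>
      weightMeasure d (Real.toNNReal (κ ^ 2)))).quasiMeasurePreserving.ae h1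

theorem measurable_uncurry_nearFraction {m d : ℕ} (ε : ℝ) :
    Measurable (Function.uncurry fun (x : EuclideanSpace ℝ (Fin d))
      (θ : (Fin m → ℝ) × (Fin m → Fin (d + 1) → ℝ)) => nearFraction θ.2 ε x) := by
  have h : Measurable fun z : EuclideanSpace ℝ (Fin d) ×
    ((Fin m → ℝ) × (Fin m → Fin (d + 1) → ℝ)) => (z.1, z.2.2) := by fun_prop
  have h2 := measurable_nearFraction (m := m) (d := d) ε
  generalize nearFraction (m := m) (d := d) = F at *
  exact h2.comp h

theorem measure_not_initGood_le {m d n : ℕ} (hd : 1 ≤ d) (hm : 1 ≤ m)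
    {X : Measure (EuclideanSpace ℝ (Fin d))} [IsProbabilityMeasure X]
    (hX : ∀ᵐ x ∂X, ‖x‖ = √(d : ℝ)) {S : Fin n → EuclideanSpace ℝ (Fin d)}
    (hS : ∀ i, ‖S i‖ = √(d : ℝ)) {κ : ℝ} (hκ : 0 < κ) {A ε τ ρ : ℝ} (hA : 0 < A) (hε : 0 < ε)
    (hτ : 0 < τ) (hρ : 0 ≤ ρ) :
    initMeasure m d κ {θ | ¬ InitGood X S A ε τ ρ θ} ≤
      ENNReal.ofReal ((n + 1) * (κ ^ 2 * ((d : ℝ) + 1)) / A + (n + 1) * (ρ / κ) / ε +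
        (n + 1) * (n * (((d : ℝ) + 1) ^ 2 / m)) / τ) := by
  have hm' : (0 : ℝ) < m := by exact_mod_cast hm
  have h1 := measure_not_integral_le_and_sum_le (P := initMeasure m d κ) hX hS
    (F := fun x θ => network θ.1 θ.2 x ^ 2) (measurable_network.pow_const 2)
    (fun x θ => sq_nonneg _) hA (fun x hx => lintegral_network_sq_le hm κ hx)
  have h2 := measure_not_integral_le_and_sum_le (P := initMeasure m d κ) hX hS
    (F := fun x θ => nearFraction θ.2 (ρ * √((d : ℝ) + 1)) x)
    (measurable_uncurry_nearFraction _) (fun x θ => nearFraction_nonneg _ _ _) hε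
    (fun x hx => lintegral_nearFraction_le hm hκ hρ hx)
  have hkm : ∀ j, Measurable fun z : EuclideanSpace ℝ (Fin d) ×
      ((Fin m → ℝ) × (Fin m → Fin (d + 1) → ℝ)) =>
      (empiricalKernel z.2.2 z.1 (S j) - ntkKernel z.1 (S j)) ^ 2 := fun j =>
    (((measurable_empiricalKernel (S j)).comp (f := fun z : EuclideanSpace ℝ (Fin d) ×
      ((Fin m → ℝ) × (Fin m → Fin (d + 1) → ℝ)) => (z.1, z.2.2)) (by fun_prop)).sub
        ((continuous_ntkKernel_left (S j)).measurable.comp measurable_fst)).pow_const 2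
  have h3 := measure_not_integral_le_and_sum_le (P := initMeasure m d κ) hX hS
    (F := fun x θ => ∑ j, (empiricalKernel θ.2 x (S j) - ntkKernel x (S j)) ^ 2)
    (Finset.measurable_fun_sum _ fun j _ => hkm j)
    (fun x θ => Finset.sum_nonneg fun j _ => sq_nonneg _)
    (M := n * (((d : ℝ) + 1) ^ 2 / m)) hτ (fun x hx => by
      simp_rw [ENNReal.ofReal_sum_of_nonneg fun (j : Fin n) _ =>
        sq_nonneg (empiricalKernel _ x (S j) - ntkKernel x (S j))]
      rw [lintegral_finsetSum]
      swap
      · exact fun j _ => ((hkm j).comp (measurable_prodMk_left (x := x))).ennreal_ofReal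
      refine (Finset.sum_le_sum fun j _ =>
        lintegral_empiricalKernel_sub_sq_le hd hm hκ hx (hS j)).trans (le_of_eq ?_)
      rw [Finset.sum_const, Finset.card_univ, Fintype.card_fin, nsmul_eq_mul,
        ENNReal.ofReal_mul (by positivity), ENNReal.ofReal_natCast])
  have h0 := ae_initMeasure_sign m d κ
  rw [ae_iff] at h0
  have hsub : {θ : (Fin m → ℝ) × (Fin m → Fin (d + 1) → ℝ) | ¬ InitGood X S A ε τ ρ θ} ⊆
      (({θ | ¬ ∀ k, θ.1 k ^ 2 = 1} ∪ {θ | ¬ (∫ x, network θ.1 θ.2 x ^ 2 ∂X ≤ A ∧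
        ∑ i, network θ.1 θ.2 (S i) ^ 2 ≤ A)}) ∪
      {θ | ¬ (∫ x, nearFraction θ.2 (ρ * √((d : ℝ) + 1)) x ∂X ≤ ε ∧
        ∑ i, nearFraction θ.2 (ρ * √((d : ℝ) + 1)) (S i) ≤ ε)}) ∪
      {θ | ¬ (∫ x, ∑ j, (empiricalKernel θ.2 x (S j) - ntkKernel x (S j)) ^ 2 ∂X ≤ τ ∧
        ∑ i, ∑ j, (empiricalKernel θ.2 (S i) (S j) - ntkKernel (S i) (S j)) ^ 2 ≤ τ)} := by
    intro θ hθ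
    by_contra hcon
    simp only [Set.mem_union, Set.mem_ofPred_eq, not_or, not_not] at hcon hθ
    obtain ⟨⟨⟨c0, c1⟩, c2⟩, c3⟩ := hcon
    exact hθ ⟨c0, c1.1, c1.2, c2.1, c2.2, c3.1, c3.2⟩
  refine (measure_mono hsub).trans ((measure_union_le _ _).trans ?_)
  rw [ENNReal.ofReal_add (by positivity) (by positivity),
    ENNReal.ofReal_add (by positivity) (by positivity)]
  refine add_le_add ((measure_union_le _ _).trans (add_le_add ((measure_union_le _ _).trans ?_) h2)) h3
  rw [h0, zero_add]
  exact h1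

/-! ### One gradient step against one kernel gradient step. -/

/-- The vector of the differences between the outputs of the network and the labels. -/
noncomputable def trainResidual {m d n : ℕ} (a : Fin m → ℝ) (S : Fin n → EuclideanSpace ℝ (Fin d))
    (y : Fin n → ℝ) (w : Fin m → Fin (d + 1) → ℝ) : EuclideanSpace ℝ (Fin n) :=
  WithLp.toLp 2 fun i => network a w (S i) - y i

theorem trainResidual_apply {m d n : ℕ} (a : Fin m → ℝ) (S : Fin n → EuclideanSpace ℝ (Fin d))
    (y : Fin n → ℝ) (w : Fin m → Fin (d + 1) → ℝ) (i : Fin n) :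
    trainResidual a S y w i = network a w (S i) - y i := rfl

theorem sum_abs_le_sqrt_mul_norm {n : ℕ} (r : EuclideanSpace ℝ (Fin n)) :
    ∑ i, |r i| ≤ √(n : ℝ) * ‖r‖ := by
  rw [EuclideanSpace.norm_eq, ← Real.sqrt_mul (by positivity)]
  refine Real.le_sqrt_of_sq_le ?_
  simpa using sq_sum_le_card_mul_sum_sq (s := Finset.univ) (f := fun i => |r i|)

theorem abs_sum_mul_le {n : ℕ} (b : Fin n → ℝ) (r : EuclideanSpace ℝ (Fin n)) :
    |∑ j, b j * r j| ≤ √(∑ j, b j ^ 2) * ‖r‖ := by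
  have h := abs_real_inner_le_norm (WithLp.toLp 2 b : EuclideanSpace ℝ (Fin n)) r
  rw [EuclideanSpace.norm_eq (WithLp.toLp 2 b)] at h
  simpa [PiLp.inner_apply, mul_comm] using h

theorem norm_le_sqrt_mul_of_abs_le {n : ℕ} {r : EuclideanSpace ℝ (Fin n)} {M : ℝ} (hM : 0 ≤ M)
    (h : ∀ i, |r i| ≤ M) : ‖r‖ ≤ √(n : ℝ) * M := by
  rw [EuclideanSpace.norm_eq]
  refine Real.sqrt_le_iff.2 ⟨by positivity, ?_⟩
  rw [mul_pow, Real.sq_sqrt (by positivity)]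
  calc ∑ i, ‖r i‖ ^ 2 ≤ ∑ _i : Fin n, M ^ 2 := by
        refine Finset.sum_le_sum fun i _ => ?_
        have := h i
        rw [Real.norm_eq_abs]
        gcongr
    _ = n * M ^ 2 := by simp

theorem gdStep_dotProduct {m d n : ℕ} (η : ℝ) (a : Fin m → ℝ) (S : Fin n → EuclideanSpace ℝ (Fin d))
    (y : Fin n → ℝ) (w : Fin m → Fin (d + 1) → ℝ) (k : Fin m) (u : Fin (d + 1) → ℝ) :
    gdStep η a S y w k ⬝ᵥ u - w k ⬝ᵥ u = -(η * (a k / √(m : ℝ) * ∑ i, activation (w k) (S i) *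
      trainResidual a S y w i * (augment (S i) ⬝ᵥ u))) := by
  have hj : ∀ j, gdStep η a S y w k j = w k j - η * ∑ i, a k / √(m : ℝ) * activation (w k) (S i) *
      augment (S i) j * trainResidual a S y w i := fun j => rfl
  simp only [dotProduct, ← Finset.sum_sub_distrib, hj]
  simp_rw [Finset.mul_sum]
  rw [← Finset.sum_neg_distrib]
  have : ∀ j, (w k j - ∑ i, η * (a k / √(m : ℝ) * activation (w k) (S i) *
      augment (S i) j * trainResidual a S y w i)) * u j - w k j * u j =
      ∑ i, -(η * (a k / √(m : ℝ) * (activation (w k) (S i) * trainResidual a S y w i *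
        (augment (S i) j * u j)))) := by
    intro j
    rw [sub_mul, sub_sub_cancel_left, Finset.sum_mul, ← Finset.sum_neg_distrib]
    refine Finset.sum_congr rfl fun i _ => by ring
  simp_rw [this]
  rw [Finset.sum_comm]
  refine Finset.sum_congr rfl fun i _ => ?_
  rw [Finset.sum_neg_distrib]

theorem abs_div_sqrt_of_sq_eq_one {a : ℝ} (ha : a ^ 2 = 1) (m : ℕ) :
    |a / √(m : ℝ)| = (√(m : ℝ))⁻¹ := by
  have : |a| = 1 := by
    rwa [← sq_abs, pow_eq_one_iff_of_nonneg (abs_nonneg a) two_ne_zero] at ha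
  rw [abs_div, this, abs_of_nonneg (Real.sqrt_nonneg _), one_div]

theorem abs_gdStep_dotProduct_sub_le {m d n : ℕ} {η : ℝ} (hη : 0 ≤ η) {a : Fin m → ℝ}
    (ha : ∀ k, a k ^ 2 = 1) {S : Fin n → EuclideanSpace ℝ (Fin d)} (hS : ∀ i, ‖S i‖ = √(d : ℝ))
    (y : Fin n → ℝ) (w : Fin m → Fin (d + 1) → ℝ) (k : Fin m) {x : EuclideanSpace ℝ (Fin d)}
    (hx : ‖x‖ = √(d : ℝ)) :
    |gdStep η a S y w k ⬝ᵥ augment x - w k ⬝ᵥ augment x| ≤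
      η * ((√(m : ℝ))⁻¹ * (((d : ℝ) + 1) * ∑ i, |trainResidual a S y w i|)) := by
  rw [gdStep_dotProduct, abs_neg, abs_mul, abs_of_nonneg hη, abs_mul, abs_div_sqrt_of_sq_eq_one (ha k)]
  gcongr
  rw [Finset.mul_sum]
  refine (Finset.abs_sum_le_sum_abs _ _).trans (Finset.sum_le_sum fun i _ => ?_)
  rw [abs_mul, abs_mul, abs_of_nonneg (activation_nonneg _ _), mul_comm]
  have h1 := abs_augment_dotProduct_le (hS i) hx
  have h2 := activation_le_one (w k) (S i)
  have h3 := activation_nonneg (w k) (S i)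
  gcongr
  exact mul_le_of_le_one_left (abs_nonneg _) h2

/-- If `|p₀| > μ`, both points lie on the same side of 0 as `p₀`, where the ReLU is linear.
Otherwise the ReLU increment and the linear one both lie between 0 and `p' - p`. -/
theorem abs_relu_sub_le {μ p₀ p p' : ℝ} (h : |p - p₀| ≤ μ) (h' : |p' - p₀| ≤ μ) :
    |max 0 p' - max 0 p - (if 0 ≤ p₀ then 1 else 0) * (p' - p)| ≤
      (if |p₀| ≤ μ then 1 else 0) * |p' - p| := by
  rw [abs_le] at h h'
  by_cases hp : |p₀| ≤ μ
  · rw [if_pos hp, one_mul]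
    rcases le_total 0 p with h1 | h1 <;> rcases le_total 0 p' with h2 | h2 <;>
      rcases le_total p p' with h3 | h3 <;> split_ifs <;>
      simp only [max_eq_right, max_eq_left, h1, h2, abs_of_nonneg (sub_nonneg.2 h3),
        abs_of_nonpos (sub_nonpos.2 h3)] <;> rw [abs_le] <;> constructor <;> linarith
  · rw [if_neg hp, zero_mul]
    push Not at hp
    split_ifs with h0
    · rw [abs_of_nonneg h0] at hp
      rw [max_eq_right (by linarith), max_eq_right (by linarith)]
      simp
    · rw [abs_of_neg (by linarith)] at hp
      rw [max_eq_left (by linarith), max_eq_left (by linarith)]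
      simp

theorem abs_activation_sub_le {d : ℕ} {μ : ℝ} {w₀ w : Fin (d + 1) → ℝ}
    {x : EuclideanSpace ℝ (Fin d)} (h : |w ⬝ᵥ augment x - w₀ ⬝ᵥ augment x| ≤ μ) :
    |activation w x - activation w₀ x| ≤ if |w₀ ⬝ᵥ augment x| ≤ μ then 1 else 0 := by
  rw [abs_le] at h
  split_ifs with hp
  · rw [abs_le]
    constructor <;>
      linarith [activation_nonneg w x, activation_nonneg w₀ x, activation_le_one w x,
        activation_le_one w₀ x]
  · push Not at hp
    unfold activation
    by_cases h0 : 0 ≤ w₀ ⬝ᵥ augment x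
    · rw [abs_of_nonneg h0] at hp
      rw [if_pos h0, if_pos (by linarith)]
      simp
    · rw [abs_of_neg (by linarith)] at hp
      rw [if_neg h0, if_neg (by linarith)]
      simp

/-- One step of gradient descent moves the network almost like kernel gradient descent, as long
as the preactivations stay within `μ` of their initial values. -/
theorem abs_network_gdStep_sub_le {m d n : ℕ} {η μ : ℝ} (hη : 0 ≤ η) {a : Fin m → ℝ}
    (ha : ∀ k, a k ^ 2 = 1) {S : Fin n → EuclideanSpace ℝ (Fin d)} (hS : ∀ i, ‖S i‖ = √(d : ℝ))
    (y : Fin n → ℝ) {w₀ w : Fin m → Fin (d + 1) → ℝ}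
    (h : ∀ k x, ‖x‖ = √(d : ℝ) → |w k ⬝ᵥ augment x - w₀ k ⬝ᵥ augment x| ≤ μ)
    (h' : ∀ k x, ‖x‖ = √(d : ℝ) → |gdStep η a S y w k ⬝ᵥ augment x - w₀ k ⬝ᵥ augment x| ≤ μ)
    {x : EuclideanSpace ℝ (Fin d)} (hx : ‖x‖ = √(d : ℝ)) :
    |network a (gdStep η a S y w) x - network a w x +
        η * ∑ j, empiricalKernel w₀ x (S j) * trainResidual a S y w j| ≤
      η * (((d : ℝ) + 1) * (nearFraction w₀ μ x * ∑ j, |trainResidual a S y w j| +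
        ∑ j, nearFraction w₀ μ (S j) * |trainResidual a S y w j|)) := by
  set r := trainResidual a S y w with hr
  set p : Fin m → ℝ := fun k => w k ⬝ᵥ augment x with hp
  set p' : Fin m → ℝ := fun k => gdStep η a S y w k ⬝ᵥ augment x with hp'
  have hsq : ∀ k, a k / √(m : ℝ) * (a k / √(m : ℝ)) = (m : ℝ)⁻¹ := by
    intro k
    rw [div_mul_div_comm, Real.mul_self_sqrt (by positivity), ← sq, ha k, one_div]
  have e1 : ∀ k, a k / √(m : ℝ) * (activation (w₀ k) x * (p' k - p k)) =
      -(η * ∑ j, (m : ℝ)⁻¹ * (activation (w₀ k) x * activation (w k) (S j) *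
        (augment x ⬝ᵥ augment (S j)) * r j)) := by
    intro k
    have hk : p' k - p k = _ := gdStep_dotProduct η a S y w k (augment x)
    rw [hk, ← hsq k, Finset.mul_sum, Finset.mul_sum, Finset.mul_sum, ← Finset.sum_neg_distrib,
      ← Finset.sum_neg_distrib, Finset.mul_sum, Finset.mul_sum]
    refine Finset.sum_congr rfl fun j _ => ?_
    rw [dotProduct_comm (augment (S j))]
    ring
  have e2 : ∀ j, empiricalKernel w₀ x (S j) * r j = ∑ k, (m : ℝ)⁻¹ * (activation (w₀ k) x *
      activation (w₀ k) (S j) * (augment x ⬝ᵥ augment (S j)) * r j) := by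
    intro j
    rw [empiricalKernel, Finset.mul_sum, Finset.sum_mul]
    refine Finset.sum_congr rfl fun k _ => by ring
  -- Two errors are separated: linearizing the ReLU at `x` with the initial pattern, and evaluating
  -- the gradient at sample points with the current pattern instead of the initial one. Both come
  -- only from neurons near their threshold.
  have e3 : network a (gdStep η a S y w) x - network a w x + η * ∑ j, empiricalKernel w₀ x (S j) * r j =
      ∑ k, a k / √(m : ℝ) * (max 0 (p' k) - max 0 (p k) - activation (w₀ k) x * (p' k - p k)) -
      η * ∑ j, ∑ k, (m : ℝ)⁻¹ * (activation (w₀ k) x * (activation (w k) (S j) -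
        activation (w₀ k) (S j)) * (augment x ⬝ᵥ augment (S j)) * r j) := by
    simp_rw [mul_sub (_ / _), Finset.sum_sub_distrib, e1, e2]
    rw [Finset.sum_neg_distrib, ← Finset.mul_sum,
      Finset.sum_comm (f := fun k j => (m : ℝ)⁻¹ * (activation (w₀ k) x * activation (w k) (S j) *
        (augment x ⬝ᵥ augment (S j)) * r j)), network, network]
    have : ∀ j k, (m : ℝ)⁻¹ * (activation (w₀ k) x * (activation (w k) (S j) -
        activation (w₀ k) (S j)) * (augment x ⬝ᵥ augment (S j)) * r j) =
        (m : ℝ)⁻¹ * (activation (w₀ k) x * activation (w k) (S j) *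
          (augment x ⬝ᵥ augment (S j)) * r j) - (m : ℝ)⁻¹ * (activation (w₀ k) x *
          activation (w₀ k) (S j) * (augment x ⬝ᵥ augment (S j)) * r j) := fun j k => by ring
    simp_rw [this, Finset.sum_sub_distrib]
    ring
  rw [e3]
  have b1 : |∑ k, a k / √(m : ℝ) * (max 0 (p' k) - max 0 (p k) -
      activation (w₀ k) x * (p' k - p k))| ≤
      η * (((d : ℝ) + 1) * (nearFraction w₀ μ x * ∑ j, |r j|)) := by
    have hk : ∀ k, |a k / √(m : ℝ) * (max 0 (p' k) - max 0 (p k) -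
        activation (w₀ k) x * (p' k - p k))| ≤ (if |w₀ k ⬝ᵥ augment x| ≤ μ then 1 else 0) *
          ((m : ℝ)⁻¹ * (η * (((d : ℝ) + 1) * ∑ j, |r j|))) := by
      intro k
      rw [abs_mul, abs_div_sqrt_of_sq_eq_one (ha k)]
      have h1 := abs_relu_sub_le (h k x hx) (h' k x hx)
      have h2 := abs_gdStep_dotProduct_sub_le hη ha hS y w k hx
      have h3 : (0 : ℝ) ≤ if |w₀ k ⬝ᵥ augment x| ≤ μ then 1 else 0 := by split_ifs <;> norm_num
      have h4 : (√(m : ℝ))⁻¹ * (√(m : ℝ))⁻¹ = (m : ℝ)⁻¹ := by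
        rw [← mul_inv, Real.mul_self_sqrt (by positivity)]
      calc (√(m : ℝ))⁻¹ * |max 0 (p' k) - max 0 (p k) - activation (w₀ k) x * (p' k - p k)|
          ≤ (√(m : ℝ))⁻¹ * ((if |w₀ k ⬝ᵥ augment x| ≤ μ then 1 else 0) *
            (η * ((√(m : ℝ))⁻¹ * (((d : ℝ) + 1) * ∑ i, |r i|)))) := by
            gcongr
            exact h1.trans (mul_le_mul_of_nonneg_left h2 h3)
        _ = _ := by rw [← h4]; ring
    refine (Finset.abs_sum_le_sum_abs _ _).trans ((Finset.sum_le_sum fun k _ => hk k).trans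
      (le_of_eq ?_))
    rw [← Finset.sum_mul, nearFraction]
    ring
  have b2 : |η * ∑ j, ∑ k, (m : ℝ)⁻¹ * (activation (w₀ k) x * (activation (w k) (S j) -
        activation (w₀ k) (S j)) * (augment x ⬝ᵥ augment (S j)) * r j)| ≤
      η * (((d : ℝ) + 1) * ∑ j, nearFraction w₀ μ (S j) * |r j|) := by
    rw [abs_mul, abs_of_nonneg hη]
    gcongr
    rw [Finset.mul_sum]
    refine (Finset.abs_sum_le_sum_abs _ _).trans (Finset.sum_le_sum fun j _ => ?_)
    refine (Finset.abs_sum_le_sum_abs _ _).trans ?_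
    rw [nearFraction, Finset.mul_sum, Finset.sum_mul, Finset.mul_sum]
    refine Finset.sum_le_sum fun k _ => ?_
    have h1 := abs_activation_sub_le (h k (S j) (hS j))
    have h2 := activation_nonneg (w₀ k) x
    have h3 := activation_le_one (w₀ k) x
    have h4 := abs_augment_dotProduct_le hx (hS j)
    rw [abs_mul, abs_mul, abs_mul, abs_mul, abs_of_nonneg h2, abs_of_nonneg (by positivity : (0 : ℝ) ≤ (m : ℝ)⁻¹)]
    calc (m : ℝ)⁻¹ * (activation (w₀ k) x * |activation (w k) (S j) - activation (w₀ k) (S j)| *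
          |augment x ⬝ᵥ augment (S j)| * |r j|)
        ≤ (m : ℝ)⁻¹ * (1 * (if |w₀ k ⬝ᵥ augment (S j)| ≤ μ then 1 else 0) *
          ((d : ℝ) + 1) * |r j|) := by gcongr
      _ = _ := by ring
  refine (abs_sub _ _).trans ((add_le_add b1 b2).trans (le_of_eq ?_))
  ring

/-! ### Linear algebra of finitely many features. -/

section Features

variable {H : Type*} [NormedAddCommGroup H] [InnerProductSpace ℝ H] {n : ℕ}

/-- The combination `∑ i, α i • f i`. -/
def synthesis (f : Fin n → H) (α : EuclideanSpace ℝ (Fin n)) : H := ∑ i, α i • f i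

/-- The vector of the inner products with the `f i`. -/
def analysis (f : Fin n → H) (g : H) : EuclideanSpace ℝ (Fin n) :=
  WithLp.toLp 2 fun i => inner ℝ (f i) g

theorem analysis_apply (f : Fin n → H) (g : H) (i : Fin n) : analysis f g i = inner ℝ (f i) g := rfl

/-- The two maps are adjoint, so `analysis ∘ synthesis` is the Gram matrix. -/
theorem inner_synthesis (f : Fin n → H) (α : EuclideanSpace ℝ (Fin n)) (g : H) :
    inner ℝ (synthesis f α) g = inner ℝ α (analysis f g) := by
  rw [synthesis, sum_inner, PiLp.inner_apply]
  refine Finset.sum_congr rfl fun i _ => ?_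
  rw [real_inner_smul_left, analysis_apply, RCLike.inner_apply, conj_trivial, mul_comm]

theorem norm_synthesis_sq (f : Fin n → H) (α : EuclideanSpace ℝ (Fin n)) :
    ‖synthesis f α‖ ^ 2 = inner ℝ α (analysis f (synthesis f α)) := by
  rw [← inner_synthesis, real_inner_self_eq_norm_sq]

theorem norm_analysis_sq_le {f : Fin n → H} {L : ℝ} (hf : ∀ i, ‖f i‖ ^ 2 ≤ L) (g : H) :
    ‖analysis f g‖ ^ 2 ≤ n * L * ‖g‖ ^ 2 := by
  rw [EuclideanSpace.norm_sq_eq]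
  calc ∑ i, ‖analysis f g i‖ ^ 2 ≤ ∑ _i : Fin n, L * ‖g‖ ^ 2 := by
        refine Finset.sum_le_sum fun i _ => ?_
        rw [analysis_apply, Real.norm_eq_abs]
        calc |inner ℝ (f i) g| ^ 2 ≤ (‖f i‖ * ‖g‖) ^ 2 := by
              gcongr
              exact abs_real_inner_le_norm _ _
          _ = ‖f i‖ ^ 2 * ‖g‖ ^ 2 := mul_pow _ _ _
          _ ≤ L * ‖g‖ ^ 2 := by
              gcongr
              exact hf i
    _ = n * L * ‖g‖ ^ 2 := by simp [mul_assoc]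

theorem norm_synthesis_sq_le {f : Fin n → H} {L : ℝ} (hf : ∀ i, ‖f i‖ ^ 2 ≤ L)
    (α : EuclideanSpace ℝ (Fin n)) : ‖synthesis f α‖ ^ 2 ≤ n * L * ‖α‖ ^ 2 := by
  by_cases h0 : synthesis f α = 0
  · rcases isEmpty_or_nonempty (Fin n) with hn | ⟨⟨i⟩⟩
    · have : n = 0 := by
        by_contra h
        exact hn.false ⟨0, Nat.pos_of_ne_zero h⟩
      subst this
      simp [h0]
    · have : 0 ≤ L := (sq_nonneg _).trans (hf i)
      rw [h0, norm_zero, zero_pow two_ne_zero]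
      positivity
  · have h1 : 0 < ‖synthesis f α‖ := norm_pos_iff.2 h0
    have h2 : ‖synthesis f α‖ ^ 2 ≤ ‖α‖ * ‖analysis f (synthesis f α)‖ := by
      rw [norm_synthesis_sq]
      exact real_inner_le_norm _ _
    have h3 := norm_analysis_sq_le hf (synthesis f α)
    have h4 : (‖synthesis f α‖ ^ 2) ^ 2 ≤ ‖α‖ ^ 2 * (n * L * ‖synthesis f α‖ ^ 2) := by
      calc (‖synthesis f α‖ ^ 2) ^ 2 ≤ (‖α‖ * ‖analysis f (synthesis f α)‖) ^ 2 := by gcongr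
        _ = ‖α‖ ^ 2 * ‖analysis f (synthesis f α)‖ ^ 2 := mul_pow _ _ _
        _ ≤ _ := by gcongr
    have h5 : 0 < ‖synthesis f α‖ ^ 2 := by positivity
    nlinarith

/-- The square of the left side is `‖r‖² - 2η‖synthesis r‖²` plus a quadratic term that the
step-size condition bounds by `η‖synthesis r‖²`. Coercivity leaves `1 - ηc ≤ (1 - ηc/2)²`. -/
theorem norm_sub_smul_analysis_synthesis_le {f : Fin n → H} {L c η : ℝ}
    (hf : ∀ i, ‖f i‖ ^ 2 ≤ L) (hc : ∀ α, c * ‖α‖ ^ 2 ≤ ‖synthesis f α‖ ^ 2) (hη : 0 ≤ η)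
    (hηL : η * (n * L) ≤ 1) (hηc : η * c ≤ 1) (r : EuclideanSpace ℝ (Fin n)) :
    ‖r - η • analysis f (synthesis f r)‖ ≤ (1 - η * c / 2) * ‖r‖ := by
  refine le_of_sq_le_sq ?_ (mul_nonneg (by linarith) (norm_nonneg _))
  have h1 := norm_analysis_sq_le hf (synthesis f r)
  rw [norm_sub_sq_real, real_inner_smul_right, ← norm_synthesis_sq, norm_smul,
    Real.norm_of_nonneg hη, mul_pow]
  have h2 : η ^ 2 * ‖analysis f (synthesis f r)‖ ^ 2 ≤ η * ‖synthesis f r‖ ^ 2 := by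
    calc η ^ 2 * ‖analysis f (synthesis f r)‖ ^ 2
        ≤ η ^ 2 * (n * L * ‖synthesis f r‖ ^ 2) := by gcongr
      _ = η * (η * (n * L)) * ‖synthesis f r‖ ^ 2 := by ring
      _ ≤ η * 1 * ‖synthesis f r‖ ^ 2 := by gcongr
      _ = η * ‖synthesis f r‖ ^ 2 := by ring
  have h3 := mul_le_mul_of_nonneg_left (hc r) hη
  nlinarith [sq_nonneg (η * c * ‖r‖)]

/-- Kernel interpolation: `h = synthesis α`, where `α` solves the Gram system. Coercivity makes this
system invertible and controls the norm of `h`. -/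
theorem exists_analysis_eq {f : Fin n → H} {c : ℝ} (hc0 : 0 < c)
    (hc : ∀ α, c * ‖α‖ ^ 2 ≤ ‖synthesis f α‖ ^ 2) (u : EuclideanSpace ℝ (Fin n)) :
    ∃ h : H, analysis f h = u ∧ c * ‖h‖ ^ 2 ≤ ‖u‖ ^ 2 := by
  let T : EuclideanSpace ℝ (Fin n) →ₗ[ℝ] EuclideanSpace ℝ (Fin n) :=
    { toFun := fun α => analysis f (synthesis f α)
      map_add' := fun α β => by
        ext i
        simp [analysis, synthesis, add_smul, Finset.sum_add_distrib, inner_add_right]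
      map_smul' := fun t α => by
        ext i
        simp [analysis, synthesis, mul_smul, ← Finset.smul_sum, inner_smul_right] }
  have hT : ∀ α, T α = analysis f (synthesis f α) := fun α => rfl
  have hinj : Function.Injective T := by
    rw [injective_iff_map_eq_zero]
    intro α hα
    have h1 := hc α
    rw [norm_synthesis_sq, ← hT, hα, inner_zero_right] at h1
    by_contra h
    have : 0 < ‖α‖ := norm_pos_iff.2 h
    have : 0 < c * ‖α‖ ^ 2 := by positivity
    linarith
  obtain ⟨α, hα⟩ := LinearMap.injective_iff_surjective.1 hinj u
  refine ⟨synthesis f α, hα, ?_⟩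
  have h1 : ‖synthesis f α‖ ^ 2 ≤ ‖α‖ * ‖u‖ := by
    rw [norm_synthesis_sq, ← hT, hα]
    exact real_inner_le_norm _ _
  have h2 := hc α
  rcases (norm_nonneg α).eq_or_lt with h0 | h0
  · rw [← h0, zero_mul] at h1
    have : c * ‖synthesis f α‖ ^ 2 ≤ c * 0 := by gcongr
    nlinarith [sq_nonneg ‖u‖]
  · have h3 : c * ‖α‖ ≤ ‖u‖ := by
      have h4 : ‖α‖ * (c * ‖α‖) ≤ ‖α‖ * ‖u‖ := by nlinarith
      exact le_of_mul_le_mul_left h4 h0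
    calc c * ‖synthesis f α‖ ^ 2 ≤ c * (‖α‖ * ‖u‖) := by gcongr
      _ = (c * ‖α‖) * ‖u‖ := by ring
      _ ≤ ‖u‖ * ‖u‖ := by gcongr
      _ = ‖u‖ ^ 2 := by ring

end Features

/-! ### Gradient descent in the kernel regime. -/

/-- The error, at the point `x`, of the kernel approximation of gradient descent. -/
noncomputable def kernelError {m d n : ℕ} (w₀ : Fin m → Fin (d + 1) → ℝ)
    (S : Fin n → EuclideanSpace ℝ (Fin d)) (μ ε : ℝ) (x : EuclideanSpace ℝ (Fin d)) : ℝ :=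
  √(∑ j, (empiricalKernel w₀ x (S j) - ntkKernel x (S j)) ^ 2) +
    ((d : ℝ) + 1) * (√(n : ℝ) * (nearFraction w₀ μ x + ε))

theorem kernelError_nonneg {m d n : ℕ} (w₀ : Fin m → Fin (d + 1) → ℝ)
    (S : Fin n → EuclideanSpace ℝ (Fin d)) (μ : ℝ) {ε : ℝ} (hε : 0 ≤ ε)
    (x : EuclideanSpace ℝ (Fin d)) : 0 ≤ kernelError w₀ S μ ε x := by
  have := nearFraction_nonneg w₀ μ x
  unfold kernelError
  positivity

theorem abs_network_gdStep_sub_kernel_le {m d n : ℕ} {η μ ε : ℝ} (hη : 0 ≤ η) {a : Fin m → ℝ}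
    (ha : ∀ k, a k ^ 2 = 1) {S : Fin n → EuclideanSpace ℝ (Fin d)} (hS : ∀ i, ‖S i‖ = √(d : ℝ))
    (y : Fin n → ℝ) {w₀ w : Fin m → Fin (d + 1) → ℝ}
    (hε : ∑ i, nearFraction w₀ μ (S i) ≤ ε)
    (h : ∀ k x, ‖x‖ = √(d : ℝ) → |w k ⬝ᵥ augment x - w₀ k ⬝ᵥ augment x| ≤ μ)
    (h' : ∀ k x, ‖x‖ = √(d : ℝ) → |gdStep η a S y w k ⬝ᵥ augment x - w₀ k ⬝ᵥ augment x| ≤ μ)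
    {x : EuclideanSpace ℝ (Fin d)} (hx : ‖x‖ = √(d : ℝ)) :
    |network a (gdStep η a S y w) x - network a w x +
        η * ∑ j, ntkKernel x (S j) * trainResidual a S y w j| ≤
      η * (kernelError w₀ S μ ε x * ‖trainResidual a S y w‖) := by
  have h1 := abs_network_gdStep_sub_le hη ha hS y h h' hx
  set r := trainResidual a S y w with hr
  have h2 := abs_sum_mul_le (fun j => empiricalKernel w₀ x (S j) - ntkKernel x (S j)) r
  have h3 := sum_abs_le_sqrt_mul_norm r
  have h4 : ∑ j, nearFraction w₀ μ (S j) * |r j| ≤ ε * ∑ j, |r j| := by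
    rw [Finset.mul_sum]
    refine Finset.sum_le_sum fun j _ => ?_
    gcongr
    exact (Finset.single_le_sum (f := fun i => nearFraction w₀ μ (S i))
      (fun i _ => nearFraction_nonneg _ _ _) (Finset.mem_univ j)).trans hε
  have hε0 : 0 ≤ ε := (Finset.sum_nonneg fun i _ => nearFraction_nonneg _ _ _).trans hε
  have hN := nearFraction_nonneg w₀ μ x
  have e : network a (gdStep η a S y w) x - network a w x + η * ∑ j, ntkKernel x (S j) * r j =
      (network a (gdStep η a S y w) x - network a w x +
        η * ∑ j, empiricalKernel w₀ x (S j) * r j) -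
      η * ∑ j, (empiricalKernel w₀ x (S j) - ntkKernel x (S j)) * r j := by
    simp_rw [sub_mul, Finset.sum_sub_distrib]
    ring
  rw [e]
  refine (abs_sub _ _).trans ?_
  rw [abs_mul η, abs_of_nonneg hη]
  calc _ ≤ η * (((d : ℝ) + 1) * (nearFraction w₀ μ x * (√(n : ℝ) * ‖r‖) + ε * (√(n : ℝ) * ‖r‖))) +
        η * (√(∑ j, (empiricalKernel w₀ x (S j) - ntkKernel x (S j)) ^ 2) * ‖r‖) := by
        refine add_le_add (h1.trans ?_) (mul_le_mul_of_nonneg_left h2 hη)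
        have h5 := h4.trans (mul_le_mul_of_nonneg_left h3 hε0)
        gcongr
    _ = _ := by
        rw [kernelError]
        ring

/-- The hypotheses under which gradient descent is analysed: the features `f i` represent the
kernel on the sample, and the initialization is close to the kernel regime. -/
structure KernelRegime {m d n : ℕ} {H : Type*} [NormedAddCommGroup H] [InnerProductSpace ℝ H]
    (f : Fin n → H) (S : Fin n → EuclideanSpace ℝ (Fin d)) (a : Fin m → ℝ) (y : Fin n → ℝ)
    (w₀ : Fin m → Fin (d + 1) → ℝ) (η c μ ε R e : ℝ) : Prop where
  hη : 0 ≤ η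
  hc : 0 < c
  sign : ∀ k, a k ^ 2 = 1
  sphere : ∀ i, ‖S i‖ = √(d : ℝ)
  norm_feature : ∀ i, ‖f i‖ ^ 2 ≤ ((d : ℝ) + 1) / 2
  kernel : ∀ i j, inner ℝ (f i) (f j) = ntkKernel (S i) (S j)
  coercive : ∀ α, c * ‖α‖ ^ 2 ≤ ‖synthesis f α‖ ^ 2
  step : η * (n * (((d : ℝ) + 1) / 2)) ≤ 1
  step' : η * c ≤ 1
  near : ∑ i, nearFraction w₀ μ (S i) ≤ ε
  init : ‖trainResidual a S y w₀‖ ≤ R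
  radius : 4 / c * ((√(m : ℝ))⁻¹ * (((d : ℝ) + 1) * (√(n : ℝ) * R))) ≤ μ
  error : ∀ i, kernelError w₀ S μ ε (S i) ≤ e
  error_le : √(n : ℝ) * e ≤ c / 4

namespace KernelRegime

variable {m d n : ℕ} {H : Type*} [NormedAddCommGroup H] [InnerProductSpace ℝ H]
  {f : Fin n → H} {S : Fin n → EuclideanSpace ℝ (Fin d)} {a : Fin m → ℝ} {y : Fin n → ℝ}
  {w₀ : Fin m → Fin (d + 1) → ℝ} {η c μ ε R e : ℝ}

theorem rate_nonneg (h : KernelRegime f S a y w₀ η c μ ε R e) : 0 ≤ 1 - η * c / 4 := by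
  have := h.step'
  linarith

theorem R_nonneg (h : KernelRegime f S a y w₀ η c μ ε R e) : 0 ≤ R :=
  (norm_nonneg _).trans h.init

theorem ε_nonneg (h : KernelRegime f S a y w₀ η c μ ε R e) : 0 ≤ ε :=
  (Finset.sum_nonneg fun _ _ => nearFraction_nonneg _ _ _).trans h.near

theorem gdIterate_succ (η : ℝ) (a : Fin m → ℝ) (S : Fin n → EuclideanSpace ℝ (Fin d))
    (y : Fin n → ℝ) (w₀ : Fin m → Fin (d + 1) → ℝ) (s : ℕ) :
    gdIterate η a S y w₀ (s + 1) = gdStep η a S y (gdIterate η a S y w₀ s) :=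
  Function.iterate_succ_apply' _ _ _

/-- The training residual decays geometrically and the neurons hardly move. -/
theorem trajectory (h : KernelRegime f S a y w₀ η c μ ε R e) (s : ℕ) :
    (∀ k x, ‖x‖ = √(d : ℝ) → |gdIterate η a S y w₀ s k ⬝ᵥ augment x - w₀ k ⬝ᵥ augment x| ≤
      4 / c * ((√(m : ℝ))⁻¹ * (((d : ℝ) + 1) * (√(n : ℝ) * R))) * (1 - (1 - η * c / 4) ^ s)) ∧
    ‖trainResidual a S y (gdIterate η a S y w₀ s)‖ ≤ (1 - η * c / 4) ^ s * R := by
  have hc := h.hc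
  have hη := h.hη
  have hR := h.R_nonneg
  have hq := h.rate_nonneg
  -- `M` is the sum of all displacements when the residual decays like `(1 - ηc/4)^s R`. The partial
  -- sums are written `M(1 - (1 - ηc/4)^s)`, a form that is also valid for `η = 0`.
  set M := 4 / c * ((√(m : ℝ))⁻¹ * (((d : ℝ) + 1) * (√(n : ℝ) * R))) with hM
  have hM0 : 0 ≤ M := by positivity
  have hMμ : ∀ s, M * (1 - (1 - η * c / 4) ^ s) ≤ μ := fun s =>
    (mul_le_of_le_one_right hM0 (by have := pow_nonneg hq s; linarith)).trans h.radius
  induction s with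
  | zero => exact ⟨fun k x _ => by simp [gdIterate], by simpa [gdIterate] using h.init⟩
  | succ s ih =>
    obtain ⟨ih1, ih2⟩ := ih
    set w := gdIterate η a S y w₀ s with hw
    set r := trainResidual a S y w with hr
    rw [gdIterate_succ, ← hw]
    have hmove : ∀ k x, ‖x‖ = √(d : ℝ) → |gdStep η a S y w k ⬝ᵥ augment x - w₀ k ⬝ᵥ augment x| ≤
        M * (1 - (1 - η * c / 4) ^ (s + 1)) := by
      intro k x hx
      have h1 := abs_gdStep_dotProduct_sub_le hη h.sign h.sphere y w k hx
      have h2 := (sum_abs_le_sqrt_mul_norm r).trans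
        (mul_le_mul_of_nonneg_left ih2 (Real.sqrt_nonneg (n : ℝ)))
      calc |gdStep η a S y w k ⬝ᵥ augment x - w₀ k ⬝ᵥ augment x|
          ≤ |gdStep η a S y w k ⬝ᵥ augment x - w k ⬝ᵥ augment x| +
            |w k ⬝ᵥ augment x - w₀ k ⬝ᵥ augment x| := abs_sub_le _ _ _
        _ ≤ η * ((√(m : ℝ))⁻¹ * (((d : ℝ) + 1) * (√(n : ℝ) * ((1 - η * c / 4) ^ s * R)))) +
            M * (1 - (1 - η * c / 4) ^ s) := by
            refine add_le_add (h1.trans ?_) (ih1 k x hx)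
            gcongr
        _ = M * (1 - (1 - η * c / 4) ^ (s + 1)) := by
            rw [hM, pow_succ]
            field_simp
            ring
    refine ⟨hmove, ?_⟩
    have hstep : ∀ i, |network a (gdStep η a S y w) (S i) - network a w (S i) +
        η * ∑ j, ntkKernel (S i) (S j) * r j| ≤ η * (kernelError w₀ S μ ε (S i) * ‖r‖) := fun i =>
      abs_network_gdStep_sub_kernel_le hη h.sign h.sphere y h.near
        (fun k x hx => (ih1 k x hx).trans (hMμ s)) (fun k x hx => (hmove k x hx).trans (hMμ (s + 1)))
        (h.sphere i)
    have hsplit : trainResidual a S y (gdStep η a S y w) = (r - η • analysis f (synthesis f r)) +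
        WithLp.toLp 2 (fun i => network a (gdStep η a S y w) (S i) - network a w (S i) +
          η * ∑ j, ntkKernel (S i) (S j) * r j) := by
      ext i
      simp only [PiLp.add_apply, PiLp.sub_apply, PiLp.smul_apply, analysis_apply, synthesis,
        inner_sum, inner_smul_right, h.kernel, hr, trainResidual_apply, smul_eq_mul]
      simp_rw [mul_comm (ntkKernel _ _)]
      ring
    -- The number `e` may be negative when the sample is empty, hence `max e 0`.
    have herr : ‖(WithLp.toLp 2 (fun i => network a (gdStep η a S y w) (S i) - network a w (S i) +
          η * ∑ j, ntkKernel (S i) (S j) * r j) : EuclideanSpace ℝ (Fin n))‖ ≤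
        √(n : ℝ) * (η * (max e 0 * ‖r‖)) := by
      refine norm_le_sqrt_mul_of_abs_le (by positivity) fun i => (hstep i).trans ?_
      gcongr
      exact (h.error i).trans (le_max_left _ _)
    have hem : √(n : ℝ) * max e 0 ≤ c / 4 := by
      rcases max_cases e 0 with ⟨he, -⟩ | ⟨he, -⟩ <;> rw [he]
      · exact h.error_le
      · rw [mul_zero]; positivity
    have hcontr := norm_sub_smul_analysis_synthesis_le h.norm_feature h.coercive hη h.step h.step' r
    -- The exact kernel step gains `ηc/2`, and the approximation error gives back at most half of
    -- it.
    calc ‖trainResidual a S y (gdStep η a S y w)‖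
        ≤ (1 - η * c / 2) * ‖r‖ + √(n : ℝ) * (η * (max e 0 * ‖r‖)) := by
          rw [hsplit]
          exact (norm_add_le _ _).trans (add_le_add hcontr herr)
      _ = (1 - η * c / 2) * ‖r‖ + η * (√(n : ℝ) * max e 0) * ‖r‖ := by ring
      _ ≤ (1 - η * c / 2) * ‖r‖ + η * (c / 4) * ‖r‖ := by gcongr
      _ = (1 - η * c / 4) * ‖r‖ := by ring
      _ ≤ (1 - η * c / 4) * ((1 - η * c / 4) ^ s * R) := by gcongr
      _ = (1 - η * c / 4) ^ (s + 1) * R := by ring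

theorem abs_preactivation_sub_le (h : KernelRegime f S a y w₀ η c μ ε R e) (s : ℕ) (k : Fin m)
    {x : EuclideanSpace ℝ (Fin d)} (hx : ‖x‖ = √(d : ℝ)) :
    |gdIterate η a S y w₀ s k ⬝ᵥ augment x - w₀ k ⬝ᵥ augment x| ≤ μ := by
  refine ((h.trajectory s).1 k x hx).trans (le_trans (mul_le_of_le_one_right ?_ ?_) h.radius)
  · have := h.hc
    have := h.R_nonneg
    positivity
  · have := pow_nonneg h.rate_nonneg s
    linarith

/-- The predictor that gradient descent would reach in the feature space. -/
noncomputable def featureIterate (f : Fin n → H) (S : Fin n → EuclideanSpace ℝ (Fin d))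
    (a : Fin m → ℝ) (y : Fin n → ℝ) (w₀ : Fin m → Fin (d + 1) → ℝ) (η : ℝ) : ℕ → H
  | 0 => 0
  | s + 1 => featureIterate f S a y w₀ η s -
      η • synthesis f (trainResidual a S y (gdIterate η a S y w₀ s))

/-- The errors of the single steps are proportional to the residual, so they sum to a geometric
series and the bound is uniform in the number of steps. -/
theorem abs_network_gdIterate_sub_le (h : KernelRegime f S a y w₀ η c μ ε R e) (s : ℕ)
    {x : EuclideanSpace ℝ (Fin d)} (hx : ‖x‖ = √(d : ℝ)) {g : H}
    (hg : ∀ j, inner ℝ g (f j) = ntkKernel x (S j)) :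
    |network a (gdIterate η a S y w₀ s) x - network a w₀ x -
        inner ℝ g (featureIterate f S a y w₀ η s)| ≤
      4 / c * (kernelError w₀ S μ ε x * R) * (1 - (1 - η * c / 4) ^ s) := by
  have hc := h.hc
  have hη := h.hη
  have hE := kernelError_nonneg w₀ S μ h.ε_nonneg x
  induction s with
  | zero => simp [gdIterate, featureIterate]
  | succ s ih =>
    have hstep := abs_network_gdStep_sub_kernel_le hη h.sign h.sphere y h.near
      (fun k x hx => h.abs_preactivation_sub_le s k hx)
      (fun k x hx => by rw [← gdIterate_succ]; exact h.abs_preactivation_sub_le (s + 1) k hx) hx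
    rw [← gdIterate_succ] at hstep
    set r := trainResidual a S y (gdIterate η a S y w₀ s) with hr
    have hr2 := (h.trajectory s).2
    have e1 : inner ℝ g (featureIterate f S a y w₀ η (s + 1)) =
        inner ℝ g (featureIterate f S a y w₀ η s) - η * ∑ j, ntkKernel x (S j) * r j := by
      rw [featureIterate, inner_sub_right, inner_smul_right, synthesis, inner_sum]
      congr 2
      refine Finset.sum_congr rfl fun j _ => ?_
      rw [inner_smul_right, hg, mul_comm]
    rw [e1]
    calc _ = |(network a (gdIterate η a S y w₀ s) x - network a w₀ x -
          inner ℝ g (featureIterate f S a y w₀ η s)) +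
          (network a (gdIterate η a S y w₀ (s + 1)) x - network a (gdIterate η a S y w₀ s) x +
            η * ∑ j, ntkKernel x (S j) * r j)| := by congr 1; ring
      _ ≤ 4 / c * (kernelError w₀ S μ ε x * R) * (1 - (1 - η * c / 4) ^ s) +
          η * (kernelError w₀ S μ ε x * ((1 - η * c / 4) ^ s * R)) := by
          refine (abs_add_le _ _).trans (add_le_add ih (hstep.trans ?_))
          gcongr
      _ = _ := by
          rw [pow_succ]
          field_simp
          ring

/-- The distance in the feature space to a function that interpolates the labels, after the
output of the network at initialization is corrected for, hardly increases. -/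
theorem norm_featureIterate_add_sq_le (h : KernelRegime f S a y w₀ η c μ ε R e) {g₀ : H}
    (hg₀ : ∀ i, inner ℝ (f i) g₀ = network a w₀ (S i) - y i) (s : ℕ) :
    ‖featureIterate f S a y w₀ η s + g₀‖ ^ 2 ≤ ‖g₀‖ ^ 2 +
        8 / c * (R * (√(n : ℝ) * (4 / c * (max e 0 * R)))) * (1 - (1 - η * c / 4) ^ s) ∧
      ‖trainResidual a S y (gdIterate η a S y w₀ s) -
        analysis f (featureIterate f S a y w₀ η s + g₀)‖ ≤ √(n : ℝ) * (4 / c * (max e 0 * R)) := by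
  have hc := h.hc
  have hη := h.hη
  have hR := h.R_nonneg
  set Ξ := √(n : ℝ) * (4 / c * (max e 0 * R)) with hΞ
  have hΞ0 : 0 ≤ Ξ := by positivity
  have hξ : ∀ s, ‖trainResidual a S y (gdIterate η a S y w₀ s) -
      analysis f (featureIterate f S a y w₀ η s + g₀)‖ ≤ Ξ := by
    intro s
    refine norm_le_sqrt_mul_of_abs_le (by positivity) fun i => ?_
    have h1 := h.abs_network_gdIterate_sub_le s (h.sphere i) (g := f i) (h.kernel i)
    have e1 : (trainResidual a S y (gdIterate η a S y w₀ s) -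
        analysis f (featureIterate f S a y w₀ η s + g₀)) i =
        network a (gdIterate η a S y w₀ s) (S i) - network a w₀ (S i) -
        inner ℝ (f i) (featureIterate f S a y w₀ η s) := by
      rw [PiLp.sub_apply, trainResidual_apply, analysis_apply, inner_add_right, hg₀]
      ring
    rw [e1]
    refine h1.trans ?_
    have hq := pow_nonneg h.rate_nonneg s
    have h0 := kernelError_nonneg w₀ S μ h.ε_nonneg (S i)
    calc 4 / c * (kernelError w₀ S μ ε (S i) * R) * (1 - (1 - η * c / 4) ^ s)
        ≤ 4 / c * (kernelError w₀ S μ ε (S i) * R) :=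
          mul_le_of_le_one_right (by positivity) (by linarith)
      _ ≤ 4 / c * (max e 0 * R) := by
          gcongr
          exact (h.error i).trans (le_max_left _ _)
  refine ⟨?_, hξ s⟩
  induction s with
  | zero => simp [featureIterate]
  | succ s ih =>
    set r := trainResidual a S y (gdIterate η a S y w₀ s) with hr
    set g := featureIterate f S a y w₀ η s + g₀ with hg
    have e1 : featureIterate f S a y w₀ η (s + 1) + g₀ = g - η • synthesis f r := by
      rw [featureIterate, hg]
      abel
    have hr2 : ‖r‖ ≤ _ := (h.trajectory s).2
    -- Up to the discrepancy `Ξ`, the step direction is the least-squares gradient at `g`. The inner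
    -- product is then about `‖r‖²`, and `-2η‖r‖²` absorbs the quadratic term `η‖r‖²`.
    have h1 : inner ℝ g (synthesis f r) = ‖r‖ ^ 2 - inner ℝ r (r - analysis f g) := by
      rw [real_inner_comm, inner_synthesis, inner_sub_right, real_inner_self_eq_norm_sq]
      ring
    have h2 : inner ℝ r (r - analysis f g) ≤ ‖r‖ * Ξ :=
      (real_inner_le_norm _ _).trans (mul_le_mul_of_nonneg_left (hξ s) (norm_nonneg _))
    have h3 : η ^ 2 * ‖synthesis f r‖ ^ 2 ≤ η * ‖r‖ ^ 2 := by
      calc η ^ 2 * ‖synthesis f r‖ ^ 2 ≤ η ^ 2 * (n * (((d : ℝ) + 1) / 2) * ‖r‖ ^ 2) := by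
            gcongr
            exact norm_synthesis_sq_le h.norm_feature r
        _ = η * (η * (n * (((d : ℝ) + 1) / 2))) * ‖r‖ ^ 2 := by ring
        _ ≤ η * 1 * ‖r‖ ^ 2 := by
            gcongr
            exact h.step
        _ = η * ‖r‖ ^ 2 := by ring
    rw [e1, norm_sub_sq_real, inner_smul_right, h1, norm_smul, Real.norm_of_nonneg hη, mul_pow]
    have h4 : η * inner ℝ r (r - analysis f g) ≤ η * ((1 - η * c / 4) ^ s * R * Ξ) := by
      gcongr
      exact h2.trans (by gcongr)
    have h5 : 8 / c * (R * Ξ) * (1 - (1 - η * c / 4) ^ (s + 1)) =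
        8 / c * (R * Ξ) * (1 - (1 - η * c / 4) ^ s) + 2 * (η * ((1 - η * c / 4) ^ s * R * Ξ)) := by
      rw [pow_succ]
      field_simp
      ring
    rw [h5]
    have h6 : 0 ≤ η * ‖r‖ ^ 2 := by positivity
    nlinarith

end KernelRegime

/-! ### From the training error to the generalization error. -/

section Integrability

variable {d : ℕ} {X : Measure (EuclideanSpace ℝ (Fin d))} [IsProbabilityMeasure X]

theorem integrable_of_continuous_of_ae_sphere (hX : ∀ᵐ x ∂X, ‖x‖ = √(d : ℝ))
    {F : EuclideanSpace ℝ (Fin d) → ℝ} (hF : Continuous F) : Integrable F X := by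
  obtain ⟨C, hC⟩ := (isCompact_sphere (0 : EuclideanSpace ℝ (Fin d)) (√(d : ℝ))).exists_bound_of_continuousOn
    hF.continuousOn
  refine Integrable.of_bound hF.aestronglyMeasurable C (hX.mono fun x hx => hC x ?_)
  simpa using hx

theorem continuous_preactivation (w : Fin (d + 1) → ℝ) :
    Continuous fun x : EuclideanSpace ℝ (Fin d) => w ⬝ᵥ augment x := by
  unfold dotProduct
  exact continuous_finsetSum _ fun j _ => continuous_const.mul (continuous_augment_apply j)

theorem continuous_network {m : ℕ} (a : Fin m → ℝ) (w : Fin m → Fin (d + 1) → ℝ) :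
    Continuous fun x : EuclideanSpace ℝ (Fin d) => network a w x := by
  unfold network
  exact continuous_finsetSum _ fun k _ =>
    continuous_const.mul (continuous_const.max (continuous_preactivation _))

theorem abs_empiricalKernel_le {m : ℕ} (w : Fin m → Fin (d + 1) → ℝ)
    (x y : EuclideanSpace ℝ (Fin d)) : |empiricalKernel w x y| ≤ |augment x ⬝ᵥ augment y| := by
  rw [empiricalKernel, ← Finset.mul_sum, mul_left_comm, abs_mul]
  refine mul_le_of_le_one_right (abs_nonneg _) ?_
  have h0 : ∀ k, 0 ≤ activation (w k) x * activation (w k) y := fun k =>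
    mul_nonneg (activation_nonneg _ _) (activation_nonneg _ _)
  rw [abs_of_nonneg (mul_nonneg (by positivity) (Finset.sum_nonneg fun k _ => h0 k))]
  calc (m : ℝ)⁻¹ * ∑ k, activation (w k) x * activation (w k) y
      ≤ (m : ℝ)⁻¹ * ∑ _k : Fin m, (1 : ℝ) := by
        gcongr with k
        exact mul_le_one₀ (activation_le_one _ _) (activation_nonneg _ _) (activation_le_one _ _)
    _ ≤ 1 := by
        rw [Finset.sum_const, Finset.card_univ, Fintype.card_fin, nsmul_eq_mul, mul_one]
        exact inv_mul_le_one

theorem integrable_empiricalKernel_sub_sq (hX : ∀ᵐ x ∂X, ‖x‖ = √(d : ℝ)) {m : ℕ}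
    (w : Fin m → Fin (d + 1) → ℝ) (y : EuclideanSpace ℝ (Fin d)) :
    Integrable (fun x => (empiricalKernel w x y - ntkKernel x y) ^ 2) X := by
  have hc : Continuous fun x : EuclideanSpace ℝ (Fin d) =>
      (|augment x ⬝ᵥ augment y| + |ntkKernel x y|) ^ 2 := by
    have h1 := continuous_ntkKernel_left y
    have h2 : Continuous fun x : EuclideanSpace ℝ (Fin d) => augment x ⬝ᵥ augment y := by
      simp only [augment_dotProduct]
      fun_prop
    fun_prop
  refine (integrable_of_continuous_of_ae_sphere hX hc).mono ?_ (.of_forall fun x => ?_)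
  · exact ((((measurable_empiricalKernel y).comp (measurable_prodMk_right (y := w))).sub
      (continuous_ntkKernel_left y).measurable).pow_const 2).aestronglyMeasurable
  · rw [Real.norm_of_nonneg (sq_nonneg _), Real.norm_of_nonneg (sq_nonneg _), ← sq_abs]
    gcongr
    exact (abs_sub _ _).trans (add_le_add (abs_empiricalKernel_le _ _ _) le_rfl)

theorem integrable_nearFraction {m : ℕ} (w : Fin m → Fin (d + 1) → ℝ) (ε : ℝ) :
    Integrable (fun x => nearFraction w ε x) X := by
  refine Integrable.of_bound (C := 1) ?_ (.of_forall fun x => ?_)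
  · have h : Measurable fun x : EuclideanSpace ℝ (Fin d) => (x, w) := measurable_prodMk_right
    have h2 := measurable_nearFraction (m := m) (d := d) ε
    generalize nearFraction (m := m) (d := d) = F at *
    exact (h2.comp h).aestronglyMeasurable
  · rw [Real.norm_of_nonneg (nearFraction_nonneg _ _ _)]
    exact nearFraction_le_one _ _ _

end Integrability

theorem kernelError_sq_le {m d n : ℕ} (w₀ : Fin m → Fin (d + 1) → ℝ)
    (S : Fin n → EuclideanSpace ℝ (Fin d)) (μ ε : ℝ) (x : EuclideanSpace ℝ (Fin d)) :
    kernelError w₀ S μ ε x ^ 2 ≤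
      3 * (∑ j, (empiricalKernel w₀ x (S j) - ntkKernel x (S j)) ^ 2 +
        ((d : ℝ) + 1) ^ 2 * n * nearFraction w₀ μ x + ((d : ℝ) + 1) ^ 2 * n * ε ^ 2) := by
  have h1 := nearFraction_nonneg w₀ μ x
  have h2 := nearFraction_le_one w₀ μ x
  -- A fraction dominates its square, so a bound on its first moment is enough.
  have h3 : nearFraction w₀ μ x ^ 2 ≤ nearFraction w₀ μ x := by nlinarith
  rw [kernelError]
  have h4 : √(∑ j, (empiricalKernel w₀ x (S j) - ntkKernel x (S j)) ^ 2) ^ 2 =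
      ∑ j, (empiricalKernel w₀ x (S j) - ntkKernel x (S j)) ^ 2 :=
    Real.sq_sqrt (Finset.sum_nonneg fun _ _ => sq_nonneg _)
  have h5 : √(n : ℝ) ^ 2 = n := Real.sq_sqrt (by positivity)
  generalize ∑ j, (empiricalKernel w₀ x (S j) - ntkKernel x (S j)) ^ 2 = Q at *
  generalize √Q = s at *
  generalize nearFraction w₀ μ x = N at *
  subst h4
  calc (s + ((d : ℝ) + 1) * (√(n : ℝ) * (N + ε))) ^ 2
      ≤ 3 * (s ^ 2 + (((d : ℝ) + 1) * √(n : ℝ) * N) ^ 2 + (((d : ℝ) + 1) * √(n : ℝ) * ε) ^ 2) := by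
        nlinarith [sq_nonneg (s - ((d : ℝ) + 1) * √(n : ℝ) * N),
          sq_nonneg (s - ((d : ℝ) + 1) * √(n : ℝ) * ε),
          sq_nonneg (((d : ℝ) + 1) * √(n : ℝ) * N - ((d : ℝ) + 1) * √(n : ℝ) * ε)]
    _ = 3 * (s ^ 2 + ((d : ℝ) + 1) ^ 2 * n * N ^ 2 + ((d : ℝ) + 1) ^ 2 * n * ε ^ 2) := by
        rw [mul_pow, mul_pow, mul_pow, mul_pow, h5]
    _ ≤ 3 * (s ^ 2 + ((d : ℝ) + 1) ^ 2 * n * N + ((d : ℝ) + 1) ^ 2 * n * ε ^ 2) := by gcongr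

theorem integral_kernelError_sq_le {m d n : ℕ} {X : Measure (EuclideanSpace ℝ (Fin d))}
    [IsProbabilityMeasure X] (hX : ∀ᵐ x ∂X, ‖x‖ = √(d : ℝ))
    {S : Fin n → EuclideanSpace ℝ (Fin d)} {A ε τ ρ : ℝ}
    {θ : (Fin m → ℝ) × (Fin m → Fin (d + 1) → ℝ)} (hθ : InitGood X S A ε τ ρ θ) :
    Integrable (fun x => 3 * (∑ j, (empiricalKernel θ.2 x (S j) - ntkKernel x (S j)) ^ 2 +
        ((d : ℝ) + 1) ^ 2 * n * nearFraction θ.2 (ρ * √((d : ℝ) + 1)) x +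
        ((d : ℝ) + 1) ^ 2 * n * ε ^ 2)) X ∧
    ∫ x, 3 * (∑ j, (empiricalKernel θ.2 x (S j) - ntkKernel x (S j)) ^ 2 +
        ((d : ℝ) + 1) ^ 2 * n * nearFraction θ.2 (ρ * √((d : ℝ) + 1)) x +
        ((d : ℝ) + 1) ^ 2 * n * ε ^ 2) ∂X ≤
      3 * (τ + ((d : ℝ) + 1) ^ 2 * n * ε + ((d : ℝ) + 1) ^ 2 * n * ε ^ 2) := by
  have i1 : Integrable (fun x =>
      ∑ j, (empiricalKernel θ.2 x (S j) - ntkKernel x (S j)) ^ 2) X :=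
    integrable_finsetSum _ fun j _ => integrable_empiricalKernel_sub_sq hX _ _
  have i2 : Integrable (fun x => ((d : ℝ) + 1) ^ 2 * n *
      nearFraction θ.2 (ρ * √((d : ℝ) + 1)) x) X := (integrable_nearFraction _ _).const_mul _
  have h1 := hθ.kernel_integral
  have h2 := hθ.near_integral
  have i3 : Integrable (fun x => ∑ j, (empiricalKernel θ.2 x (S j) - ntkKernel x (S j)) ^ 2 +
      ((d : ℝ) + 1) ^ 2 * n * nearFraction θ.2 (ρ * √((d : ℝ) + 1)) x) X := i1.add i2
  refine ⟨(i3.add (integrable_const _)).const_mul 3, ?_⟩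
  rw [integral_const_mul, integral_add i3 (integrable_const _), integral_add i1 i2,
    integral_const_mul, integral_const, probReal_univ, one_smul]
  gcongr

theorem sq_add_four_le (a b c d : ℝ) :
    (a + b + c + d) ^ 2 ≤ 4 * (a ^ 2 + b ^ 2 + c ^ 2 + d ^ 2) := by
  nlinarith [sq_nonneg (a - b), sq_nonneg (a - c), sq_nonneg (a - d), sq_nonneg (b - c),
    sq_nonneg (b - d), sq_nonneg (c - d)]

/-- The generalization error of gradient descent in the kernel regime. -/
theorem genError_gdIterate_le {m d n : ℕ} {H : Type*} [NormedAddCommGroup H]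
    [InnerProductSpace ℝ H] {X : Measure (EuclideanSpace ℝ (Fin d))}
    [IsProbabilityMeasure X] (hX : ∀ᵐ x ∂X, ‖x‖ = √(d : ℝ)) {Φ : EuclideanSpace ℝ (Fin d) → H}
    (hΦ : Continuous Φ) (hΦD : ∀ x, ‖Φ x‖ ^ 2 ≤ ((d : ℝ) + 1) / 2)
    (hΦK : ∀ x y, ‖x‖ = √(d : ℝ) → ‖y‖ = √(d : ℝ) → inner ℝ (Φ x) (Φ y) = ntkKernel x y)
    {Y : EuclideanSpace ℝ (Fin d) → ℝ} {w : H} (hw : ∀ x, ‖x‖ = √(d : ℝ) → inner ℝ (Φ x) w = Y x)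
    {S : Fin n → EuclideanSpace ℝ (Fin d)} {t : ℝ} (ht : 0 ≤ t)
    (hdev : ∀ g : H, ∫ x, inner ℝ (Φ x) g ^ 2 ∂X ≤
      (1 / n : ℝ) * ∑ i, inner ℝ (Φ (S i)) g ^ 2 + ‖g‖ ^ 2 * t)
    {A ε τ ρ η c R e : ℝ} {θ : (Fin m → ℝ) × (Fin m → Fin (d + 1) → ℝ)}
    (hθ : InitGood X S A ε τ ρ θ) (he : 0 ≤ e)
    (h : KernelRegime (fun i => Φ (S i)) S θ.1 (fun i => Y (S i)) θ.2 η c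
      (ρ * √((d : ℝ) + 1)) ε R e) (k : ℕ) :
    genError X Y θ.1 (gdIterate η θ.1 S (fun i => Y (S i)) θ.2 k) ≤
      4 * (A + ((d : ℝ) + 1) / 2 * (A / c) +
        (1 / n * (2 * ((1 - η * c / 4) ^ k * R) ^ 2 + 2 * (√(n : ℝ) * (4 / c * (e * R))) ^ 2) +
          (2 * (A / c) + 2 * ‖w‖ ^ 2 + 8 / c * (R * (√(n : ℝ) * (4 / c * (e * R))))) * t) +
        (4 / c * R) ^ 2 *
          (3 * (τ + ((d : ℝ) + 1) ^ 2 * n * ε + ((d : ℝ) + 1) ^ 2 * n * ε ^ 2))) := by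
  have hc := h.hc
  have hR := h.R_nonneg
  set f : Fin n → H := fun i => Φ (S i) with hf
  set r := trainResidual θ.1 S (fun i => Y (S i)) (gdIterate η θ.1 S (fun i => Y (S i)) θ.2 k)
    with hr
  set Ξ := √(n : ℝ) * (4 / c * (e * R)) with hΞ
  have hΞ0 : 0 ≤ Ξ := by positivity
  -- The initial network is not zero. Its outputs on the sample are interpolated by an element `u`
  -- of small norm, so that `u - w` represents the initial residual exactly.
  obtain ⟨u, hu, hun⟩ := exists_analysis_eq hc h.coercive
    (WithLp.toLp 2 fun i => network θ.1 θ.2 (S i))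
  have hu' : ‖u‖ ^ 2 ≤ A / c := by
    rw [le_div_iff₀' hc]
    refine hun.trans ?_
    rw [EuclideanSpace.norm_sq_eq]
    simpa using hθ.net_sum
  have hg₀ : ∀ i, inner ℝ (f i) (u - w) = network θ.1 θ.2 (S i) - Y (S i) := fun i => by
    have h1 : analysis f u i = network θ.1 θ.2 (S i) := by rw [hu]
    rw [inner_sub_right, hw _ (h.sphere i), ← h1, analysis_apply]
  obtain ⟨hg1, hg2⟩ := h.norm_featureIterate_add_sq_le hg₀ k
  rw [max_eq_left he, ← hΞ] at hg1 hg2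
  set v := KernelRegime.featureIterate f S θ.1 (fun i => Y (S i)) θ.2 η k with hv
  set g := v + (u - w) with hg
  have hq := pow_nonneg h.rate_nonneg k
  have hgn : ‖g‖ ^ 2 ≤ 2 * (A / c) + 2 * ‖w‖ ^ 2 + 8 / c * (R * Ξ) := by
    have h1 : ‖u - w‖ ^ 2 ≤ 2 * ‖u‖ ^ 2 + 2 * ‖w‖ ^ 2 := by
      have := norm_sub_le u w
      nlinarith [sq_nonneg (‖u‖ - ‖w‖), norm_nonneg (u - w)]
    have h2 : 8 / c * (R * Ξ) * (1 - (1 - η * c / 4) ^ k) ≤ 8 / c * (R * Ξ) :=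
      mul_le_of_le_one_right (by positivity) (by linarith)
    linarith
  have hga : ∑ i, inner ℝ (Φ (S i)) g ^ 2 ≤
      2 * ((1 - η * c / 4) ^ k * R) ^ 2 + 2 * Ξ ^ 2 := by
    have h1 : ∑ i, inner ℝ (Φ (S i)) g ^ 2 = ‖analysis f g‖ ^ 2 := by
      simp [EuclideanSpace.norm_sq_eq, analysis_apply, hf]
    have h2 : ‖r‖ ≤ (1 - η * c / 4) ^ k * R := (h.trajectory k).2
    have h3 : ‖analysis f g‖ ≤ (1 - η * c / 4) ^ k * R + Ξ := by
      have := norm_sub_norm_le (analysis f g) r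
      rw [norm_sub_rev] at this
      linarith
    rw [h1]
    calc ‖analysis f g‖ ^ 2 ≤ ((1 - η * c / 4) ^ k * R + Ξ) ^ 2 := by gcongr
      _ ≤ _ := by nlinarith [sq_nonneg ((1 - η * c / 4) ^ k * R - Ξ)]
  -- Four parts of the error: the initial network, its interpolant `u`, the predictor error `⟪Φ x,
  -- g⟫`, and the kernel approximation.
  have hpt : ∀ x, ‖x‖ = √(d : ℝ) →
      (Y x - network θ.1 (gdIterate η θ.1 S (fun i => Y (S i)) θ.2 k) x) ^ 2 ≤
      4 * (network θ.1 θ.2 x ^ 2 + inner ℝ (Φ x) u ^ 2 + inner ℝ (Φ x) g ^ 2 +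
        (4 / c * R) ^ 2 * (3 * (∑ j, (empiricalKernel θ.2 x (S j) - ntkKernel x (S j)) ^ 2 +
        ((d : ℝ) + 1) ^ 2 * n * nearFraction θ.2 (ρ * √((d : ℝ) + 1)) x +
        ((d : ℝ) + 1) ^ 2 * n * ε ^ 2))) := by
    intro x hx
    have h1 := h.abs_network_gdIterate_sub_le k hx (g := Φ x) (fun j => hΦK _ _ hx (h.sphere j))
    have h2 := kernelError_sq_le θ.2 S (ρ * √((d : ℝ) + 1)) ε x
    have h3 := kernelError_nonneg θ.2 S (ρ * √((d : ℝ) + 1)) h.ε_nonneg x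
    have h4 : inner ℝ (Φ x) v = inner ℝ (Φ x) g - inner ℝ (Φ x) u + Y x := by
      rw [hg, inner_add_right, inner_sub_right, hw x hx]
      ring
    rw [← hv, h4] at h1
    have h5 := h1.trans (mul_le_of_le_one_right (by positivity) (by linarith))
    have h6 := sq_le_sq' (neg_le_of_abs_le h5) (le_of_abs_le h5)
    have h7 : (4 / c * (kernelError θ.2 S (ρ * √((d : ℝ) + 1)) ε x * R)) ^ 2 ≤
      (4 / c * R) ^ 2 * (3 * (∑ j, (empiricalKernel θ.2 x (S j) - ntkKernel x (S j)) ^ 2 +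
        ((d : ℝ) + 1) ^ 2 * n * nearFraction θ.2 (ρ * √((d : ℝ) + 1)) x +
        ((d : ℝ) + 1) ^ 2 * n * ε ^ 2)) := by
      rw [← mul_assoc, mul_right_comm, mul_pow (4 / c * R)]
      gcongr
    have h8 := h6.trans h7
    generalize network θ.1 (gdIterate η θ.1 S (fun i => Y (S i)) θ.2 k) x = F at *
    have h9 := sq_add_four_le (network θ.1 θ.2 x) (-inner ℝ (Φ x) u) (inner ℝ (Φ x) g)
      (F - network θ.1 θ.2 x - (inner ℝ (Φ x) g - inner ℝ (Φ x) u + Y x))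
    rw [neg_sq] at h9
    calc (Y x - F) ^ 2 = _ := by rw [← neg_sq]; congr 1; ring
      _ ≤ _ := h9
      _ ≤ _ := by gcongr
  obtain ⟨i4, hi4⟩ := integral_kernelError_sq_le hX hθ
  have i4' := i4.const_mul ((4 / c * R) ^ 2)
  have i1 : Integrable (fun x => network θ.1 θ.2 x ^ 2) X :=
    integrable_of_continuous_of_ae_sphere hX ((continuous_network _ _).pow 2)
  have i2 : Integrable (fun x => inner ℝ (Φ x) u ^ 2) X :=
    integrable_of_continuous_of_ae_sphere hX (by fun_prop)
  have i3 : Integrable (fun x => inner ℝ (Φ x) g ^ 2) X :=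
    integrable_of_continuous_of_ae_sphere hX (by fun_prop)
  have hu2 : ∫ x, inner ℝ (Φ x) u ^ 2 ∂X ≤ ((d : ℝ) + 1) / 2 * (A / c) := by
    calc ∫ x, inner ℝ (Φ x) u ^ 2 ∂X ≤ ∫ _, ((d : ℝ) + 1) / 2 * (A / c) ∂X := by
          refine integral_mono i2 (integrable_const _) fun x => ?_
          calc inner ℝ (Φ x) u ^ 2 ≤ (‖Φ x‖ * ‖u‖) ^ 2 := by
                rw [← sq_abs]
                gcongr
                exact abs_real_inner_le_norm _ _
            _ = ‖Φ x‖ ^ 2 * ‖u‖ ^ 2 := mul_pow _ _ _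
            _ ≤ _ := by
                gcongr
                exact hΦD x
      _ = _ := by simp
  -- `g` depends on the sample, so the deviation bound has to be uniform in `g`.
  have hg3 : ∫ x, inner ℝ (Φ x) g ^ 2 ∂X ≤ 1 / n * (2 * ((1 - η * c / 4) ^ k * R) ^ 2 + 2 * Ξ ^ 2) +
      (2 * (A / c) + 2 * ‖w‖ ^ 2 + 8 / c * (R * Ξ)) * t := by
    refine (hdev g).trans ?_
    gcongr
  have hn1 := hθ.net_integral
  have i12 : Integrable (fun x => network θ.1 θ.2 x ^ 2 + inner ℝ (Φ x) u ^ 2) X := i1.add i2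
  have i123 : Integrable (fun x => network θ.1 θ.2 x ^ 2 + inner ℝ (Φ x) u ^ 2 +
    inner ℝ (Φ x) g ^ 2) X := i12.add i3
  have hmain := integral_mono_of_nonneg (μ := X) (.of_forall fun x => sq_nonneg _)
    ((i123.add i4').const_mul 4) (hX.mono hpt)
  refine hmain.trans ?_
  simp only [Pi.add_apply]
  rw [integral_const_mul, integral_add i123 i4', integral_add i12 i3, integral_add i1 i2,
    integral_const_mul]
  gcongr

/-! ### Choice of the parameters. -/

/-- `T` dominates, up to powers, all the parameters that the width may depend on. -/
structure ScaleBound (n d p : ℕ) (c δ T : ℝ) : Prop where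
  one_le : 1 ≤ T
  n_le : (n : ℝ) + 1 ≤ T
  d_le : (d : ℝ) ≤ T ^ 2
  pow_le : (d : ℝ) ^ p ≤ T ^ 2
  c_le : 1 / c ≤ T
  δ_le : 1 / δ ≤ T

theorem scaleBound {n d p : ℕ} {c δ : ℝ} (hd : 1 ≤ d) (hc : 0 < c) (hδ : 0 < δ) :
    ScaleBound n d p c δ
      ((1 + (n : ℝ)) * (1 + √(d : ℝ) ^ max p 1) * (1 + 1 / c) * (1 + 1 / δ)) := by
  have hd' : (1 : ℝ) ≤ d := by exact_mod_cast hd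
  have hs : 1 ≤ √(d : ℝ) := Real.one_le_sqrt.2 hd'
  have hc' : 0 < 1 / c := by positivity
  have hδ' : 0 < 1 / δ := by positivity
  have hn' : (0 : ℝ) ≤ n := by positivity
  set v := √(d : ℝ) ^ max p 1 with hv
  have hv0 : 0 ≤ v := by positivity
  -- The exponent `max p 1` keeps control of the dimension when `p = 0`.
  have hv1 : √(d : ℝ) ≤ v := by
    calc √(d : ℝ) = √(d : ℝ) ^ 1 := (pow_one _).symm
      _ ≤ v := pow_le_pow_right₀ hs (le_max_right _ _)
  have hvp : √(d : ℝ) ^ p ≤ v := pow_le_pow_right₀ hs (le_max_left _ _)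
  have h1 : 1 ≤ (1 + (n : ℝ)) * (1 + v) := one_le_mul_of_one_le_of_one_le (by linarith) (by linarith)
  have h2 : 1 ≤ (1 + (n : ℝ)) * (1 + v) * (1 + 1 / c) :=
    one_le_mul_of_one_le_of_one_le h1 (by linarith)
  have hT1 : (1 + (n : ℝ)) * (1 + v) * (1 + 1 / c) ≤
      (1 + (n : ℝ)) * (1 + v) * (1 + 1 / c) * (1 + 1 / δ) :=
    le_mul_of_one_le_right (by linarith) (by linarith)
  have hT2 : (1 + (n : ℝ)) * (1 + v) ≤ (1 + (n : ℝ)) * (1 + v) * (1 + 1 / c) :=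
    le_mul_of_one_le_right (by linarith) (by linarith)
  have hvT : v ≤ (1 + (n : ℝ)) * (1 + v) * (1 + 1 / c) * (1 + 1 / δ) := by
    have : 1 + v ≤ (1 + (n : ℝ)) * (1 + v) := le_mul_of_one_le_left (by linarith) (by linarith)
    linarith
  refine ⟨by linarith, ?_, ?_, ?_, ?_, ?_⟩
  · have : 1 + (n : ℝ) ≤ (1 + (n : ℝ)) * (1 + v) := le_mul_of_one_le_right (by linarith) (by linarith)
    linarith
  · calc (d : ℝ) = √(d : ℝ) ^ 2 := (Real.sq_sqrt (by positivity)).symm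
      _ ≤ _ := by
        gcongr
        exact hv1.trans hvT
  · calc (d : ℝ) ^ p = (√(d : ℝ) ^ p) ^ 2 := by
          rw [← pow_mul, mul_comm, pow_mul, Real.sq_sqrt (by positivity)]
      _ ≤ _ := by
        gcongr
        exact hvp.trans hvT
  · have : 1 + 1 / c ≤ (1 + (n : ℝ)) * (1 + v) * (1 + 1 / c) :=
      le_mul_of_one_le_left (by linarith) h1
    linarith
  · have : 1 + 1 / δ ≤ (1 + (n : ℝ)) * (1 + v) * (1 + 1 / c) * (1 + 1 / δ) :=
      le_mul_of_one_le_left (by linarith) h2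
    linarith

theorem rpow_three_halves {x : ℝ} (hx : 0 < x) : x ^ (3 / 2 : ℝ) = x * √x := by
  rw [show (3 / 2 : ℝ) = 1 + 1 / 2 by norm_num, Real.rpow_add hx, Real.rpow_one, Real.sqrt_eq_rpow]

theorem natCast_add_one_le_two_mul {d : ℕ} (hd : 1 ≤ d) : (d : ℝ) + 1 ≤ 2 * d := by
  have : (1 : ℝ) ≤ d := by exact_mod_cast hd
  linarith

namespace ScaleBound

variable {n d p : ℕ} {c δ T : ℝ}

theorem pos (h : ScaleBound n d p c δ T) : 0 < T := by linarith [h.one_le]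

theorem succ_d_le (h : ScaleBound n d p c δ T) (hd : 1 ≤ d) : (d : ℝ) + 1 ≤ 2 * T ^ 2 :=
  (natCast_add_one_le_two_mul hd).trans (by linarith [h.d_le])

theorem n_le' (h : ScaleBound n d p c δ T) : (n : ℝ) ≤ T := by linarith [h.n_le]

theorem sqrt_n_le (h : ScaleBound n d p c δ T) : √(n : ℝ) ≤ T := by
  rw [Real.sqrt_le_left h.pos.le]
  exact h.n_le'.trans (by nlinarith [h.one_le])

theorem sqrt_residual_le (h : ScaleBound n d p c δ T) :
    √(2 * n * (d : ℝ) ^ p + 32) ≤ 6 * T ^ 2 := by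
  have h1 := h.one_le
  have hT := h.pos
  rw [Real.sqrt_le_left (by positivity)]
  calc 2 * n * (d : ℝ) ^ p + 32 ≤ 2 * T * T ^ 2 + 32 := by
        gcongr
        exacts [h.n_le', h.pow_le]
    _ ≤ 2 * T ^ 4 + 32 * T ^ 4 := by
        have h3 : T ^ 3 ≤ T ^ 4 := pow_le_pow_right₀ h1 (by norm_num)
        have h4 : 1 ≤ T ^ 4 := one_le_pow₀ h1
        nlinarith
    _ ≤ (6 * T ^ 2) ^ 2 := by
        have : 0 ≤ T ^ 4 := by positivity
        nlinarith

theorem inv_le (h : ScaleBound n d p c δ T) (hc : 0 < c) : 1 / T ≤ c := by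
  rw [div_le_iff₀ h.pos, ← div_le_iff₀' hc]
  exact h.c_le

theorem inv_le' (h : ScaleBound n d p c δ T) (hδ : 0 < δ) : 1 / T ≤ δ := by
  rw [div_le_iff₀ h.pos, ← div_le_iff₀' hδ]
  exact h.δ_le

end ScaleBound

/-- The accuracy required from the initialization. -/
noncomputable def accuracy (T : ℝ) : ℝ := 1 / (20000 * T ^ 12)

theorem accuracy_pos {T : ℝ} (hT : 0 < T) : 0 < accuracy T := by
  unfold accuracy; positivity

theorem mul_pow_mul_accuracy_le {T K : ℝ} (hT : 1 ≤ T) (hK : 0 ≤ K) {k : ℕ} (hk : k ≤ 12) :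
    K * T ^ k * accuracy T ≤ K / 20000 := by
  have hT' : 0 < T := by linarith
  have : T ^ k ≤ T ^ 12 := pow_le_pow_right₀ hT hk
  rw [accuracy, mul_one_div, div_le_div_iff₀ (by positivity) (by norm_num)]
  nlinarith

/-- The relative distance that a preactivation may move during training. -/
noncomputable def moveRadius (n d p m : ℕ) (c : ℝ) : ℝ :=
  4 / c * ((√(m : ℝ))⁻¹ * (√((d : ℝ) + 1) * (√(n : ℝ) * √(2 * n * (d : ℝ) ^ p + 32))))

/-- The bound on the output of the network at initialization. -/
noncomputable def initBound (n d : ℕ) (δ κ : ℝ) : ℝ := 8 * n * κ ^ 2 * ((d : ℝ) + 1) / δ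

/-- This fixes the scaling of `κ²`. One factor `n` pays for the bound in terms of the sample size,
and the remaining `√n` gives the rate. Two factors `d + 1` are cancelled by `d²`. -/
theorem mul_initBound_div_le {n d : ℕ} (hn : 1 ≤ n) (hd : 1 ≤ d) {c δ κ : ℝ} (hc : 0 < c)
    (hδ : 0 < δ) (hκ : κ ^ 2 ≤ c * δ / ((d : ℝ) ^ 2 * (n : ℝ) ^ (3 / 2 : ℝ))) :
    ((d : ℝ) + 1) * (initBound n d δ κ / c) ≤ 32 / √(n : ℝ) := by
  have hn' : (0 : ℝ) < n := by exact_mod_cast hn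
  have hd' : (0 : ℝ) < d := by exact_mod_cast hd
  have hs : 0 < √(n : ℝ) := Real.sqrt_pos.2 hn'
  rw [rpow_three_halves hn'] at hκ
  calc ((d : ℝ) + 1) * (initBound n d δ κ / c)
      = κ ^ 2 * (8 * n * ((d : ℝ) + 1) ^ 2 / (δ * c)) := by
        rw [initBound]; field_simp
    _ ≤ c * δ / ((d : ℝ) ^ 2 * (n * √(n : ℝ))) * (8 * n * (2 * d) ^ 2 / (δ * c)) := by
        gcongr
        exact natCast_add_one_le_two_mul hd
    _ = 32 / √(n : ℝ) := by
        field_simp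
        norm_num

theorem measure_not_initGood_lt {n d p m : ℕ} (hn : 1 ≤ n) (hd : 1 ≤ d) {c δ κ T b : ℝ}
    (hc : 0 < c) (hδ : 0 < δ) (hκ : 0 < κ) (hT : ScaleBound n d p c δ T) (hb : 0 < b) (hb1 : b ≤ 1)
    (hκb : b * (c * δ / ((d : ℝ) ^ 2 * (n : ℝ) ^ (3 / 2 : ℝ))) ≤ κ ^ 2)
    (hm : 16 * 10 ^ 12 / b * T ^ 48 ≤ m)
    {X : Measure (EuclideanSpace ℝ (Fin d))} [IsProbabilityMeasure X]
    (hX : ∀ᵐ x ∂X, ‖x‖ = √(d : ℝ)) {S : Fin n → EuclideanSpace ℝ (Fin d)}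
    (hS : ∀ i, ‖S i‖ = √(d : ℝ)) :
    initMeasure m d κ {θ | ¬ InitGood X S (initBound n d δ κ) (accuracy T) (accuracy T ^ 2)
      (moveRadius n d p m c) θ} < ENNReal.ofReal δ := by
  have hn' : (1 : ℝ) ≤ n := by exact_mod_cast hn
  have hd' : (0 : ℝ) < d := by exact_mod_cast hd
  have hT0 := hT.pos
  have hT1 := hT.one_le
  have hσ := accuracy_pos hT0
  have hm0 : (0 : ℝ) < m := lt_of_lt_of_le (by positivity) hm
  have hm1 : 1 ≤ m := by exact_mod_cast (Nat.cast_pos.1 hm0)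
  have hsm : 0 < √(m : ℝ) := Real.sqrt_pos.2 hm0
  have hsb : 0 < √b := Real.sqrt_pos.2 hb
  have hA : 0 < initBound n d δ κ := by unfold initBound; positivity
  have hρ : 0 ≤ moveRadius n d p m c := by unfold moveRadius; positivity
  refine (measure_not_initGood_le hd hm1 hX hS hκ hA hσ (by positivity) hρ).trans_lt ?_
  rw [ENNReal.ofReal_lt_ofReal_iff hδ]
  -- Each of the three failure probabilities is at most `δ/4`, which leaves room for the strict
  -- inequality. The 8 in `initBound` uses `n + 1 ≤ 2n`.
  have h1 : ((n : ℝ) + 1) * (κ ^ 2 * ((d : ℝ) + 1)) / initBound n d δ κ ≤ δ / 4 := by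
    have e : ((n : ℝ) + 1) * (κ ^ 2 * ((d : ℝ) + 1)) / initBound n d δ κ =
        ((n : ℝ) + 1) / (2 * n) * (δ / 4) := by
      rw [initBound]; field_simp; norm_num
    rw [e]
    refine mul_le_of_le_one_left (by positivity) ?_
    rw [div_le_one (by positivity)]
    linarith
  have hδT := hT.inv_le' hδ
  have hκ' : √b / T ^ 4 ≤ κ := by
    refine le_of_sq_le_sq (le_trans ?_ hκb) hκ.le
    have hN : (n : ℝ) ^ (3 / 2 : ℝ) ≤ T ^ 2 := by
      rw [rpow_three_halves (by linarith), sq]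
      exact mul_le_mul hT.n_le' hT.sqrt_n_le (by positivity) hT0.le
    calc (√b / T ^ 4) ^ 2 = b * (1 / T * (1 / T) / ((T ^ 2) ^ 2 * T ^ 2)) := by
          rw [div_pow, Real.sq_sqrt hb.le]
          field_simp
      _ ≤ b * (c * δ / ((d : ℝ) ^ 2 * (n : ℝ) ^ (3 / 2 : ℝ))) := by
          gcongr
          exacts [hT.inv_le hc, hT.d_le]
  have hρ' : moveRadius n d p m c ≤ 48 * T ^ 6 / √(m : ℝ) := by
    have hD : √((d : ℝ) + 1) ≤ 2 * T ^ 2 := by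
      rw [Real.sqrt_le_left (by positivity)]
      have := hT.succ_d_le hd
      nlinarith [one_le_pow₀ hT1 (n := 2)]
    calc moveRadius n d p m c = 4 * (1 / c) * ((√(m : ℝ))⁻¹ * (√((d : ℝ) + 1) *
          (√(n : ℝ) * √(2 * n * (d : ℝ) ^ p + 32)))) := by rw [moveRadius]; ring
      _ ≤ 4 * T * ((√(m : ℝ))⁻¹ * (2 * T ^ 2 * (T * (6 * T ^ 2)))) := by
          gcongr
          exacts [hT.c_le, hT.sqrt_n_le, hT.sqrt_residual_le]
      _ = 48 * T ^ 6 / √(m : ℝ) := by ring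
  -- The exponent 48 of the width is twice this 24. The threshold event collects `T^23` from the
  -- sample size, the radius, `1/κ` and the accuracy, and one more `T` supplies `1/T ≤ δ`.
  have hsm' : 4 * 10 ^ 6 * T ^ 24 / √b ≤ √(m : ℝ) := by
    rw [Real.le_sqrt' (by positivity), div_pow, Real.sq_sqrt hb.le]
    refine le_trans (le_of_eq ?_) hm
    ring
  have h2 : ((n : ℝ) + 1) * (moveRadius n d p m c / κ) / accuracy T ≤ δ / 4 := by
    calc ((n : ℝ) + 1) * (moveRadius n d p m c / κ) / accuracy T
        ≤ T * (48 * T ^ 6 / √(m : ℝ) / (√b / T ^ 4)) / accuracy T := by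
          gcongr
          exact hT.n_le
      _ = 960000 * T ^ 23 / (√b * √(m : ℝ)) := by
          rw [accuracy]; field_simp; norm_num
      _ ≤ 960000 * T ^ 23 / (√b * (4 * 10 ^ 6 * T ^ 24 / √b)) := by gcongr
      _ = 24 / 100 * (1 / T) := by field_simp; norm_num
      _ ≤ δ / 4 := by linarith
  have h3 : ((n : ℝ) + 1) * (n * (((d : ℝ) + 1) ^ 2 / m)) / accuracy T ^ 2 ≤ δ / 4 := by
    have hm2 : 16 * 10 ^ 12 * T ^ 31 ≤ (m : ℝ) := by
      calc (16 * 10 ^ 12 : ℝ) * T ^ 31 ≤ 16 * 10 ^ 12 / b * T ^ 48 := by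
            gcongr
            · rw [le_div_iff₀ hb]
              linarith
            · norm_num
        _ ≤ (m : ℝ) := hm
    calc ((n : ℝ) + 1) * (n * (((d : ℝ) + 1) ^ 2 / m)) / accuracy T ^ 2
        ≤ T * (T * ((2 * T ^ 2) ^ 2 / (16 * 10 ^ 12 * T ^ 31))) / accuracy T ^ 2 := by
          gcongr
          exacts [hT.n_le, hT.n_le', hT.succ_d_le hd]
      _ = 1 / 10000 * (1 / T) := by
          rw [accuracy]; field_simp; norm_num
      _ ≤ δ / 4 := by
          have : 0 < 1 / T := by positivity
          linarith
  linarith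

theorem coercive_of_posSemidef {d n : ℕ} {H : Type*} [NormedAddCommGroup H]
    [InnerProductSpace ℝ H] {f : Fin n → H} {S : Fin n → EuclideanSpace ℝ (Fin d)} {c : ℝ}
    (hf : ∀ i j, inner ℝ (f i) (f j) = ntkKernel (S i) (S j))
    (hc : (ntkGram S - c • (1 : Matrix (Fin n) (Fin n) ℝ)).PosSemidef)
    (α : EuclideanSpace ℝ (Fin n)) : c * ‖α‖ ^ 2 ≤ ‖synthesis f α‖ ^ 2 := by
  have h := hc.dotProduct_mulVec_nonneg (fun i => α i)
  have h1 : ‖synthesis f α‖ ^ 2 = (fun i => α i) ⬝ᵥ (ntkGram S).mulVec fun i => α i := by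
    rw [dotProduct_ntkGram_mulVec, ← real_inner_self_eq_norm_sq, synthesis, sum_inner]
    refine Finset.sum_congr rfl fun i _ => ?_
    rw [inner_sum]
    refine Finset.sum_congr rfl fun j _ => ?_
    rw [real_inner_smul_left, real_inner_smul_right, hf]
    ring
  have h2 : ‖α‖ ^ 2 = (fun i => α i) ⬝ᵥ fun i => α i := by
    rw [EuclideanSpace.norm_sq_eq, dotProduct]
    simp [sq]
  rw [Matrix.sub_mulVec, dotProduct_sub, Matrix.smul_mulVec, Matrix.one_mulVec, dotProduct_smul,
    star_trivial, ← h1, ← h2, smul_eq_mul] at h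
  linarith

/-- The diagonal entries of `H` are `(d+1)/2`. -/
theorem le_of_posSemidef {d n : ℕ} (hn : 1 ≤ n) {S : Fin n → EuclideanSpace ℝ (Fin d)}
    (hS : ∀ i, ‖S i‖ = √(d : ℝ)) {c : ℝ}
    (hc : (ntkGram S - c • (1 : Matrix (Fin n) (Fin n) ℝ)).PosSemidef) : c ≤ ((d : ℝ) + 1) / 2 := by
  have h := hc.diag_nonneg (i := ⟨0, hn⟩)
  rw [Matrix.sub_apply, Matrix.smul_apply, Matrix.one_apply_eq, ntkGram, Matrix.of_apply,
    ntkKernel_self (hS _), smul_eq_mul, mul_one] at h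
  linarith

theorem target_sq_le {d : ℕ} {β x : EuclideanSpace ℝ (Fin d)} (hβ : ‖β‖ ≤ 1)
    (hx : ‖x‖ = √(d : ℝ)) (p : ℕ) : target β p x ^ 2 ≤ (d : ℝ) ^ p := by
  have h : |inner ℝ x β| ≤ √(d : ℝ) := by
    refine (abs_real_inner_le_norm _ _).trans ?_
    rw [hx]
    exact mul_le_of_le_one_right (by positivity) hβ
  calc target β p x ^ 2 = (|inner ℝ x β| ^ 2) ^ p := by
        rw [target, sq_abs, ← pow_mul, ← pow_mul, mul_comm]
    _ ≤ (√(d : ℝ) ^ 2) ^ p := by gcongr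
    _ = (d : ℝ) ^ p := by rw [Real.sq_sqrt (by positivity)]

/-- The bound on the kernel error at the sample points. -/
noncomputable def sampleError (n d : ℕ) (T : ℝ) : ℝ :=
  accuracy T + ((d : ℝ) + 1) * (√(n : ℝ) * (accuracy T + accuracy T))

theorem sampleError_le {n d p : ℕ} {c δ T : ℝ} (hd : 1 ≤ d) (hT : ScaleBound n d p c δ T) :
    sampleError n d T ≤ 5 * T ^ 3 * accuracy T := by
  have hT0 := hT.pos
  have hT1 := hT.one_le
  have hσ := accuracy_pos hT0
  calc sampleError n d T
      ≤ accuracy T + 2 * T ^ 2 * (T * (accuracy T + accuracy T)) := by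
        rw [sampleError]
        gcongr
        exacts [hT.succ_d_le hd, hT.sqrt_n_le]
    _ = (1 + 4 * T ^ 3) * accuracy T := by ring
    _ ≤ 5 * T ^ 3 * accuracy T := by
        gcongr
        linarith [one_le_pow₀ hT1 (n := 3)]

/-- The number of iterations makes `(1 - ηc/4)^(2k) ≤ exp(-ηck/2) ≤ 1/(n (d+1)^p)`, while the
squared initial residual is at most `34 n (d+1)^p`. -/
theorem decayed_residual_sq_le {n d p k : ℕ} {η c : ℝ} (hn : 1 ≤ n) (hη : 0 < η) (hc : 0 < c)
    (hq : 0 ≤ 1 - η * c / 4)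
    (hk : 2 * ((Real.log n + p * Real.log ((d : ℝ) + 1)) / (η * c)) ≤ k) :
    ((1 - η * c / 4) ^ k * √(2 * n * (d : ℝ) ^ p + 32)) ^ 2 ≤ 34 := by
  have hn' : (1 : ℝ) ≤ n := by exact_mod_cast hn
  have hηc : 0 < η * c := by positivity
  have h1 : (1 - η * c / 4) ^ k ≤ Real.exp (-(η * c / 4 * k)) := by
    calc (1 - η * c / 4) ^ k ≤ Real.exp (-(η * c / 4)) ^ k := by
          refine pow_le_pow_left₀ hq ?_ k
          linarith [Real.add_one_le_exp (-(η * c / 4))]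
      _ = Real.exp (-(η * c / 4 * k)) := by
          rw [← Real.exp_nat_mul]
          congr 1
          ring
  have h2 : Real.log n + p * Real.log ((d : ℝ) + 1) ≤ 2 * (η * c / 4 * k) := by
    rw [mul_div_assoc', div_le_iff₀ hηc] at hk
    linarith
  have h3 : Real.exp (-(η * c / 4 * k)) ^ 2 * (n * ((d : ℝ) + 1) ^ p) ≤ 1 := by
    have e1 : (n : ℝ) * ((d : ℝ) + 1) ^ p =
        Real.exp (Real.log n + p * Real.log ((d : ℝ) + 1)) := by
      rw [Real.exp_add, Real.exp_log (by linarith), Real.exp_nat_mul,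
        Real.exp_log (by positivity)]
    rw [e1, ← Real.exp_nat_mul, ← Real.exp_add]
    refine Real.exp_le_one_iff.2 ?_
    push_cast
    linarith
  have h4 : √(2 * n * (d : ℝ) ^ p + 32) ^ 2 ≤ 34 * (n * ((d : ℝ) + 1) ^ p) := by
    rw [Real.sq_sqrt (by positivity)]
    have h5 : (d : ℝ) ^ p ≤ ((d : ℝ) + 1) ^ p := by gcongr; linarith
    have h6 : 1 ≤ ((d : ℝ) + 1) ^ p := one_le_pow₀ (by linarith [(Nat.cast_nonneg d : (0 : ℝ) ≤ d)])
    nlinarith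
  calc ((1 - η * c / 4) ^ k * √(2 * n * (d : ℝ) ^ p + 32)) ^ 2
      = ((1 - η * c / 4) ^ k) ^ 2 * √(2 * n * (d : ℝ) ^ p + 32) ^ 2 := mul_pow _ _ _
    _ ≤ Real.exp (-(η * c / 4 * k)) ^ 2 * (34 * (n * ((d : ℝ) + 1) ^ p)) := by
        have := pow_nonneg hq k
        gcongr
    _ ≤ 34 := by linarith

/-- The condition `δ ≤ 1/2` keeps `log(1/δ)` away from zero, so terms of order `1/√n` are absorbed
in the rate. -/
theorem one_div_sqrt_le (n : ℕ) {δ : ℝ} (hδ : 0 < δ) (hδ2 : δ ≤ 1 / 2) :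
    1 / √(n : ℝ) ≤ 2 * √(Real.log (1 / δ) / n) := by
  have h1 : 1 / 4 ≤ Real.log (1 / δ) := by
    have h2 : Real.log 2 ≤ Real.log (1 / δ) := by
      refine Real.log_le_log (by norm_num) ?_
      rw [le_div_iff₀ hδ]
      linarith
    linarith [Real.log_two_gt_d9]
  have h3 : 1 / 2 ≤ √(Real.log (1 / δ)) := Real.le_sqrt_of_sq_le (by linarith)
  rw [Real.sqrt_div' _ (by positivity), mul_div_assoc']
  gcongr
  linarith

section Regime

variable {m d n p : ℕ} {X : Measure (EuclideanSpace ℝ (Fin d))}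
  {S : Fin n → EuclideanSpace ℝ (Fin d)} {c δ κ η T : ℝ}
  {θ : (Fin m → ℝ) × (Fin m → Fin (d + 1) → ℝ)}

theorem initBound_le (hn : 1 ≤ n) (hd : 1 ≤ d) (hc : 0 < c) (hδ : 0 < δ)
    (hκ : κ ^ 2 ≤ c * δ / ((d : ℝ) ^ 2 * (n : ℝ) ^ (3 / 2 : ℝ))) (hcd : c ≤ ((d : ℝ) + 1) / 2) :
    initBound n d δ κ ≤ 16 / √(n : ℝ) := by
  have h0 : 0 ≤ initBound n d δ κ / c := by unfold initBound; positivity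
  have h1 := mul_initBound_div_le hn hd hc hδ hκ
  calc initBound n d δ κ = c * (initBound n d δ κ / c) := by field_simp
    _ ≤ ((d : ℝ) + 1) / 2 * (initBound n d δ κ / c) := by gcongr
    _ = ((d : ℝ) + 1) * (initBound n d δ κ / c) / 2 := by ring
    _ ≤ 32 / √(n : ℝ) / 2 := by gcongr
    _ = 16 / √(n : ℝ) := by ring

theorem kernelRegime_of_initGood {H : Type*} [NormedAddCommGroup H] [InnerProductSpace ℝ H]
    (hn : 1 ≤ n) (hd : 1 ≤ d) (hc : 0 < c) (hδ : 0 < δ)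
    (hκ : κ ^ 2 ≤ c * δ / ((d : ℝ) ^ 2 * (n : ℝ) ^ (3 / 2 : ℝ))) (hη : 0 < η)
    (hηc : η ≤ c / ((d : ℝ) * n) ^ 2) (hT : ScaleBound n d p c δ T)
    (hS : ∀ i, ‖S i‖ = √(d : ℝ))
    (hpsd : (ntkGram S - c • (1 : Matrix (Fin n) (Fin n) ℝ)).PosSemidef)
    {f : Fin n → H} (hf : ∀ i, ‖f i‖ ^ 2 ≤ ((d : ℝ) + 1) / 2)
    (hfK : ∀ i j, inner ℝ (f i) (f j) = ntkKernel (S i) (S j))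
    {β : EuclideanSpace ℝ (Fin d)} (hβ : ‖β‖ ≤ 1)
    (hθ : InitGood X S (initBound n d δ κ) (accuracy T) (accuracy T ^ 2)
      (moveRadius n d p m c) θ) :
    KernelRegime f S θ.1 (fun i => target β p (S i)) θ.2 η c
      (moveRadius n d p m c * √((d : ℝ) + 1)) (accuracy T) (√(2 * n * (d : ℝ) ^ p + 32))
      (sampleError n d T) := by
  have hn' : (1 : ℝ) ≤ n := by exact_mod_cast hn
  have hd' : (1 : ℝ) ≤ d := by exact_mod_cast hd
  have hT0 := hT.pos
  have hT1 := hT.one_le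
  have hσ := accuracy_pos hT0
  have hcD := le_of_posSemidef hn hS hpsd
  have hDd := natCast_add_one_le_two_mul hd
  have hcd : c ≤ d := by linarith
  have hdn : (d : ℝ) ≤ d * n := le_mul_of_one_le_right (by positivity) hn'
  have hdn0 : (0 : ℝ) < d * n := by positivity
  constructor
  · exact hη.le
  · exact hc
  · exact hθ.sign
  · exact hS
  · exact hf
  · exact hfK
  · exact coercive_of_posSemidef hfK hpsd
  · calc η * (n * (((d : ℝ) + 1) / 2)) ≤ c / ((d : ℝ) * n) ^ 2 * (n * d) := by
          gcongr
          linarith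
      _ = c / (d * n) := by field_simp
      _ ≤ 1 := by
          rw [div_le_one hdn0]
          linarith
  · calc η * c ≤ c / ((d : ℝ) * n) ^ 2 * c := by gcongr
      _ = (c / (d * n)) ^ 2 := by ring
      _ ≤ 1 := by
          refine pow_le_one₀ (by positivity) ?_
          rw [div_le_one hdn0]
          linarith
  · exact hθ.near_sum
  -- The squared residual is at most twice the initial outputs plus twice the labels. The outputs
  -- contribute at most `2 · 16` and the labels at most `2 n d^p`.
  · refine Real.le_sqrt_of_sq_le ?_
    have hA := initBound_le hn hd hc hδ hκ hcD
    have hA' : 16 / √(n : ℝ) ≤ 16 := div_le_self (by norm_num) (Real.one_le_sqrt.2 hn')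
    calc ‖trainResidual θ.1 S (fun i => target β p (S i)) θ.2‖ ^ 2
        = ∑ i, (network θ.1 θ.2 (S i) - target β p (S i)) ^ 2 := by
          rw [EuclideanSpace.norm_sq_eq]
          simp [trainResidual_apply]
      _ ≤ ∑ i, (2 * network θ.1 θ.2 (S i) ^ 2 + 2 * (d : ℝ) ^ p) := by
          refine Finset.sum_le_sum fun i _ => ?_
          have := target_sq_le hβ (hS i) p
          nlinarith [sq_nonneg (network θ.1 θ.2 (S i) + target β p (S i))]
      _ = 2 * ∑ i, network θ.1 θ.2 (S i) ^ 2 + 2 * n * (d : ℝ) ^ p := by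
          rw [Finset.sum_add_distrib, ← Finset.mul_sum]
          simp
          ring
      _ ≤ 2 * n * (d : ℝ) ^ p + 32 := by linarith [hθ.net_sum]
  · refine le_of_eq ?_
    have hD : √((d : ℝ) + 1) * √((d : ℝ) + 1) = (d : ℝ) + 1 :=
      Real.mul_self_sqrt (by positivity)
    rw [moveRadius]
    linear_combination (-(4 / c * ((√(m : ℝ))⁻¹ * (√(n : ℝ) * √(2 * n * (d : ℝ) ^ p + 32))))) * hD
  · intro i
    have h1 : √(∑ j, (empiricalKernel θ.2 (S i) (S j) - ntkKernel (S i) (S j)) ^ 2) ≤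
        accuracy T := by
      rw [Real.sqrt_le_left hσ.le]
      exact (Finset.single_le_sum (f := fun i => ∑ j, (empiricalKernel θ.2 (S i) (S j) -
        ntkKernel (S i) (S j)) ^ 2) (fun i _ => Finset.sum_nonneg fun j _ => sq_nonneg _)
        (Finset.mem_univ i)).trans hθ.kernel_sum
    have h2 : nearFraction θ.2 (moveRadius n d p m c * √((d : ℝ) + 1)) (S i) ≤ accuracy T :=
      (Finset.single_le_sum (f := fun i => nearFraction θ.2 (moveRadius n d p m c *
        √((d : ℝ) + 1)) (S i)) (fun i _ => nearFraction_nonneg _ _ _)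
        (Finset.mem_univ i)).trans hθ.near_sum
    rw [kernelError, sampleError]
    gcongr
  · calc √(n : ℝ) * sampleError n d T ≤ T * (5 * T ^ 3 * accuracy T) :=
          mul_le_mul hT.sqrt_n_le (sampleError_le hd hT)
            (by unfold sampleError; positivity) hT0.le
      _ = 5 * T ^ 5 * accuracy T * (1 / T) := by field_simp
      _ ≤ 5 / 20000 * (1 / T) := by
          gcongr
          exact mul_pow_mul_accuracy_le hT1 (by norm_num) (by norm_num)
      _ ≤ 5 / 20000 * c := by
          gcongr
          exact hT.inv_le hc
      _ ≤ c / 4 := by linarith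

set_option maxHeartbeats 1000000 in
/-- Gradient descent from a good initialization attains the rate `√(log (1 / δ) / n)`. -/
theorem genError_le_of_initGood [IsProbabilityMeasure X] {H : Type*} [NormedAddCommGroup H]
    [InnerProductSpace ℝ H]
    (hn : 1 ≤ n) (hd : 1 ≤ d) (hc : 0 < c) (hδ : 0 < δ) (hδ2 : δ ≤ 1 / 2)
    (hκ : κ ^ 2 ≤ c * δ / ((d : ℝ) ^ 2 * (n : ℝ) ^ (3 / 2 : ℝ))) (hη : 0 < η)
    (hηc : η ≤ c / ((d : ℝ) * n) ^ 2) (hT : ScaleBound n d p c δ T)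
    (hX : ∀ᵐ x ∂X, ‖x‖ = √(d : ℝ)) {Φ : EuclideanSpace ℝ (Fin d) → H}
    (hΦ : Continuous Φ) (hΦD : ∀ x, ‖Φ x‖ ^ 2 ≤ ((d : ℝ) + 1) / 2)
    (hΦK : ∀ x y, ‖x‖ = √(d : ℝ) → ‖y‖ = √(d : ℝ) → inner ℝ (Φ x) (Φ y) = ntkKernel x y)
    {β : EuclideanSpace ℝ (Fin d)} (hβ : ‖β‖ ≤ 1) {w : H}
    (hw : ∀ x, ‖x‖ = √(d : ℝ) → inner ℝ (Φ x) w = target β p x) {W : ℝ} (hwW : ‖w‖ ^ 2 ≤ W)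
    (hS : ∀ i, ‖S i‖ = √(d : ℝ))
    (hdev : ∀ g : H, ∫ x, inner ℝ (Φ x) g ^ 2 ∂X ≤
      (1 / n : ℝ) * ∑ i, inner ℝ (Φ (S i)) g ^ 2 +
        ‖g‖ ^ 2 * (4 * ((d : ℝ) + 1) * √(Real.log (1 / δ) / n)))
    (hpsd : (ntkGram S - c • (1 : Matrix (Fin n) (Fin n) ℝ)).PosSemidef)
    (hθ : InitGood X S (initBound n d δ κ) (accuracy T) (accuracy T ^ 2)
      (moveRadius n d p m c) θ) {k : ℕ}
    (hk : 2 * ((Real.log n + p * Real.log ((d : ℝ) + 1)) / (η * c)) ≤ k) :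
    genError X (target β p) θ.1 (gdIterate η θ.1 S (fun i => target β p (S i)) θ.2 k) ≤
      (2000 + 32 * (((d : ℝ) + 1) * W)) * √(Real.log (1 / δ) / n) := by
  have hn' : (1 : ℝ) ≤ n := by exact_mod_cast hn
  have hd' : (1 : ℝ) ≤ d := by exact_mod_cast hd
  have hT0 := hT.pos
  have hT1 := hT.one_le
  have hσ := accuracy_pos hT0
  have hσ1 : accuracy T ≤ 1 := by
    have := mul_pow_mul_accuracy_le hT1 zero_le_one (k := 0) (by norm_num)
    rw [pow_zero, one_mul, one_mul] at this
    linarith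
  have hcD := le_of_posSemidef hn hS hpsd
  have hreg := kernelRegime_of_initGood hn hd hc hδ hκ hη hηc hT hS hpsd (f := fun i => Φ (S i))
    (fun i => hΦD _) (fun i j => hΦK _ _ (hS i) (hS j)) hβ hθ
  have hsE := sampleError_le hd hT
  have hsE0 : 0 ≤ sampleError n d T := by unfold sampleError; positivity
  have hmain := genError_gdIterate_le hX hΦ hΦD hΦK hw (by positivity) hdev hθ hsE0 hreg k
  refine hmain.trans ?_
  set A := initBound n d δ κ with hA
  set σ := accuracy T with hσd
  set R := √(2 * n * (d : ℝ) ^ p + 32) with hR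
  set Q := √(Real.log (1 / δ) / n) with hQ
  set Ξ := √(n : ℝ) * (4 / c * (sampleError n d T * R)) with hΞ
  have hR0 : 0 ≤ R := Real.sqrt_nonneg _
  have hQ0 : 0 ≤ Q := Real.sqrt_nonneg _
  have hRT : R ≤ 6 * T ^ 2 := hT.sqrt_residual_le
  have hcT : 4 / c ≤ 4 * T := by
    have := hT.c_le
    rw [show 4 / c = 4 * (1 / c) by ring]
    linarith
  have hΞT : Ξ ≤ 120 * T ^ 7 * σ := by
    calc Ξ ≤ T * (4 * T * (5 * T ^ 3 * σ * (6 * T ^ 2))) := by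
          rw [hΞ]
          gcongr
          exact hT.sqrt_n_le
      _ = 120 * T ^ 7 * σ := by ring
  have hΞ0 : 0 ≤ Ξ := by positivity
  have hΞ1 : Ξ ^ 2 ≤ 1 := by
    have := hΞT.trans (mul_pow_mul_accuracy_le hT1 (by norm_num) (by norm_num))
    exact pow_le_one₀ hΞ0 (by linarith)
  -- This estimate and `hlast` are the ones that use the full power `T^12` in `accuracy`.
  have hRΞ : ((d : ℝ) + 1) * (8 / c * (R * Ξ)) ≤ 1 := by
    calc ((d : ℝ) + 1) * (8 / c * (R * Ξ)) = 2 * (((d : ℝ) + 1) * (4 / c * (R * Ξ))) := by ring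
      _ ≤ 2 * (2 * T ^ 2 * (4 * T * (6 * T ^ 2 * (120 * T ^ 7 * σ)))) := by
          gcongr
          exact hT.succ_d_le hd
      _ = 11520 * T ^ 12 * σ := by ring
      _ ≤ 11520 / 20000 := mul_pow_mul_accuracy_le hT1 (by norm_num) le_rfl
      _ ≤ 1 := by norm_num
  have hlast : (4 / c * R) ^ 2 * (3 * (σ ^ 2 + ((d : ℝ) + 1) ^ 2 * n * σ +
      ((d : ℝ) + 1) ^ 2 * n * σ ^ 2)) ≤ 1 / n := by
    have h2 : σ ^ 2 ≤ σ := by nlinarith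
    have h5 : 1 ≤ T ^ 5 := one_le_pow₀ hT1
    calc (4 / c * R) ^ 2 * (3 * (σ ^ 2 + ((d : ℝ) + 1) ^ 2 * n * σ +
          ((d : ℝ) + 1) ^ 2 * n * σ ^ 2))
        ≤ (4 * T * (6 * T ^ 2)) ^ 2 * (3 * (T ^ 5 * σ + (2 * T ^ 2) ^ 2 * T * σ +
          (2 * T ^ 2) ^ 2 * T * σ)) := by
          gcongr
          · exact h2.trans (le_mul_of_one_le_left hσ.le h5)
          · exact hT.succ_d_le hd
          · exact hT.n_le'
          · exact hT.succ_d_le hd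
          · exact hT.n_le'
      _ = 15552 * T ^ 12 * σ * (1 / T) := by field_simp; ring
      _ ≤ 15552 / 20000 * (1 / T) := by
          gcongr
          exact mul_pow_mul_accuracy_le hT1 (by norm_num) le_rfl
      _ ≤ 1 * (1 / n) := by
          gcongr
          · norm_num
          · exact hT.n_le'
      _ = 1 / n := one_mul _
  have hdecay : ((1 - η * c / 4) ^ k * R) ^ 2 ≤ 34 :=
    decayed_residual_sq_le hn hη hc hreg.rate_nonneg hk
  have hsn : 1 ≤ √(n : ℝ) := Real.one_le_sqrt.2 hn'
  have hsQ : 1 / √(n : ℝ) ≤ 2 * Q := one_div_sqrt_le n hδ hδ2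
  have hnQ : 1 / (n : ℝ) ≤ 2 * Q := by
    refine le_trans ?_ hsQ
    gcongr
    rw [Real.sqrt_le_left (by positivity)]
    nlinarith
  have hA1 : A ≤ 32 * Q := by
    have := initBound_le hn hd hc hδ hκ hcD
    rw [show 16 / √(n : ℝ) = 16 * (1 / √(n : ℝ)) by ring] at this
    linarith
  have hA2 : ((d : ℝ) + 1) * (A / c) ≤ 64 * Q := by
    have := mul_initBound_div_le hn hd hc hδ hκ
    rw [show 32 / √(n : ℝ) = 32 * (1 / √(n : ℝ)) by ring] at this
    linarith
  have hA3 : ((d : ℝ) + 1) * (A / c) ≤ 32 :=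
    (mul_initBound_div_le hn hd hc hδ hκ).trans (div_le_self (by norm_num) hsn)
  have hfirst : 1 / n * (2 * ((1 - η * c / 4) ^ k * R) ^ 2 + 2 * Ξ ^ 2) ≤ 140 * Q := by
    calc 1 / n * (2 * ((1 - η * c / 4) ^ k * R) ^ 2 + 2 * Ξ ^ 2) ≤ 2 * Q * (2 * 34 + 2 * 1) := by
          gcongr
      _ = 140 * Q := by ring
  have hsecond : (2 * (A / c) + 2 * ‖w‖ ^ 2 + 8 / c * (R * Ξ)) * (4 * ((d : ℝ) + 1) * Q) ≤
      (260 + 8 * (((d : ℝ) + 1) * W)) * Q := by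
    calc (2 * (A / c) + 2 * ‖w‖ ^ 2 + 8 / c * (R * Ξ)) * (4 * ((d : ℝ) + 1) * Q)
        = (8 * (((d : ℝ) + 1) * (A / c)) + 8 * (((d : ℝ) + 1) * ‖w‖ ^ 2) +
          4 * (((d : ℝ) + 1) * (8 / c * (R * Ξ)))) * Q := by ring
      _ ≤ (8 * 32 + 8 * (((d : ℝ) + 1) * W) + 4 * 1) * Q := by gcongr
      _ = _ := by ring
  linarith

end Regime

/-! ### Assembling the probabilities and the rate. -/

/-- The sample is good for the feature map `Φ` with probability more than `1 - δ`. -/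
theorem measure_not_sample_good_lt {d n : ℕ} (hd : 1 ≤ d) (hn : 1 ≤ n) {H : Type*}
    [NormedAddCommGroup H] [InnerProductSpace ℝ H]
    {X : Measure (EuclideanSpace ℝ (Fin d))} [IsProbabilityMeasure X]
    (hX : ∀ᵐ x ∂X, ‖x‖ = √(d : ℝ)) {Φ : EuclideanSpace ℝ (Fin d) → H} (hΦ : Continuous Φ)
    (hΦD : ∀ x, ‖Φ x‖ ^ 2 ≤ ((d : ℝ) + 1) / 2) {δ : ℝ} (hδ : 0 < δ) (hδ2 : δ ≤ 1 / 2) :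
    Measure.pi (fun _ : Fin n => X) {S | ¬ ((∀ i, ‖S i‖ = √(d : ℝ)) ∧
      ∀ g : H, ∫ x, inner ℝ (Φ x) g ^ 2 ∂X ≤ (1 / n : ℝ) * ∑ i, inner ℝ (Φ (S i)) g ^ 2 +
        ‖g‖ ^ 2 * (4 * ((d : ℝ) + 1) * √(Real.log (1 / δ) / n)))} < ENNReal.ofReal δ := by
  have hn' : (0 : ℝ) < n := by exact_mod_cast hn
  have h0 : ∀ᵐ S ∂(Measure.pi fun _ : Fin n => X), ∀ i, ‖S i‖ = √(d : ℝ) :=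
    ae_all_iff.2 fun i =>
      (measurePreserving_eval (fun _ : Fin n => X) i).quasiMeasurePreserving.ae hX
  rw [ae_iff] at h0
  have h1 := measure_quadratic_deviation_le (μ := X) hΦ (R := ((d : ℝ) + 1) / 2) (by positivity)
    hΦD hn (t := 4 * ((d : ℝ) + 1) * √(Real.log (1 / δ) / n)) (by positivity)
  have hlog : 0 ≤ Real.log (1 / δ) := Real.log_nonneg (by rw [le_div_iff₀ hδ]; linarith)
  -- With the constant 4 the tail is `2 exp(-8 log(1/δ)) = 2δ^8`, which is below `δ` because `δ ≤
  -- 1/2`.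
  have e1 : n * (4 * ((d : ℝ) + 1) * √(Real.log (1 / δ) / n)) ^ 2 / (8 * (((d : ℝ) + 1) / 2) ^ 2) =
      8 * Real.log (1 / δ) := by
    rw [mul_pow, Real.sq_sqrt (by positivity)]
    field_simp
    ring
  have e2 : Real.exp (-(8 * Real.log (1 / δ))) = δ ^ 8 := by
    rw [one_div, Real.log_inv, mul_neg, neg_neg, mul_comm, Real.exp_mul, Real.exp_log hδ]
    exact_mod_cast Real.rpow_natCast δ 8
  rw [e1, e2] at h1
  have h2 : 2 * δ ^ 8 < δ := by
    have h3 : δ ^ 7 ≤ (1 / 2) ^ 7 := by gcongr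
    calc 2 * δ ^ 8 = δ * (2 * δ ^ 7) := by ring
      _ < δ * 1 := by
          gcongr
          linarith
      _ = δ := mul_one _
  refine lt_of_le_of_lt ?_ ((ENNReal.ofReal_lt_ofReal_iff hδ).2 h2)
  refine le_trans (measure_mono ?_) ((measure_union_le _ _).trans
    ((add_le_add h0.le h1).trans (zero_add _).le))
  intro S hS
  by_contra hcon
  simp only [Set.mem_union, Set.mem_ofPred_eq, not_or, not_not] at hcon hS
  exact hS hcon

/-- For `p ≤ 1` the term `1/4` in `d_p` gives `(d+1)/d_p ≤ 4(d+1)`. For `p ≥ 2` the estimate of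
`d_p` costs one more factor `d + 1` than the rate contains only when `p` is odd. -/
theorem rate_le_genRate {d p n : ℕ} (hd : 1 ≤ d) (δ : ℝ) :
    (2000 + 32 * (((d : ℝ) + 1) * (1 / featureCoeff d p))) * √(Real.log (1 / δ) / n) ≤
        3000 * ((d : ℝ) + 1) * genRate d p n δ ∧
      (2 ≤ p → Even p →
        (2000 + 32 * (((d : ℝ) + 1) * (1 / featureCoeff d p))) * √(Real.log (1 / δ) / n) ≤
          3000 * genRate d p n δ) := by
  have hd0 : (0 : ℝ) ≤ d := Nat.cast_nonneg d
  set Q := √(Real.log (1 / δ) / n) with hQ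
  have hQ0 : 0 ≤ Q := Real.sqrt_nonneg _
  rw [mul_one_div]
  have hmain : ∀ K : ℝ, 1 ≤ K → ∀ F : ℝ, 1 ≤ F →
      ((d : ℝ) + 1) / featureCoeff d p ≤ 10 * (K * F) →
      (2000 + 32 * (((d : ℝ) + 1) / featureCoeff d p)) * Q ≤ 3000 * K * (F * Q) := by
    intro K hK F hF h
    have h1 : 1 ≤ K * F := one_le_mul_of_one_le_of_one_le hK hF
    calc (2000 + 32 * (((d : ℝ) + 1) / featureCoeff d p)) * Q
        ≤ (2000 * (K * F) + 32 * (10 * (K * F))) * Q := by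
          gcongr
          linarith
      _ = 2320 * (K * F * Q) := by ring
      _ ≤ 3000 * (K * F * Q) := by
          gcongr
          norm_num
      _ = 3000 * K * (F * Q) := by ring
  by_cases hp : p ≤ 1
  · refine ⟨?_, fun h2 => by omega⟩
    rw [genRate, if_pos hp, ← hQ, ← one_mul Q]
    have hq := quarter_le_featureCoeff d hp
    refine (le_of_eq ?_).trans (hmain ((d : ℝ) + 1) (by linarith) 1 le_rfl ?_)
    · rw [one_mul]
    · rw [div_le_iff₀ (by linarith)]
      nlinarith
  · have hF : 1 ≤ ((d : ℝ) + 1) ^ p * ((p : ℝ) + 1) ^ (3 / 2 : ℝ) :=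
      one_le_mul_of_one_le_of_one_le (one_le_pow₀ (by linarith))
        (Real.one_le_rpow (by linarith [(Nat.cast_nonneg p : (0 : ℝ) ≤ p)]) (by norm_num))
    have h := div_featureCoeff_le (d := d) (p := p) hd (by omega)
    rw [genRate, if_neg hp, ← hQ]
    refine ⟨hmain _ (by linarith) _ hF (h.trans ?_), fun _ hev => ?_⟩
    · have h2 : ((d : ℝ) + 1) ^ (2 * ((p + 1) / 2)) ≤ ((d : ℝ) + 1) ^ (p + 1) :=
        pow_le_pow_right₀ (by linarith) (by omega)
      calc 10 * ((d : ℝ) + 1) ^ (2 * ((p + 1) / 2)) * ((p : ℝ) + 1) ^ (3 / 2 : ℝ)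
          ≤ 10 * ((d : ℝ) + 1) ^ (p + 1) * ((p : ℝ) + 1) ^ (3 / 2 : ℝ) := by gcongr
        _ = _ := by rw [pow_succ]; ring
    · have h3 : 2 * ((p + 1) / 2) = p := by
        obtain ⟨q, rfl⟩ := hev
        omega
      rw [h3] at h
      have h4 := hmain 1 le_rfl _ hF (h.trans (le_of_eq (by ring)))
      rwa [mul_one] at h4

/-- Polynomial lower bound on the width. -/
noncomputable def widthPolynomial (b : ℝ) : MvPolynomial (Fin 4) ℝ :=
  MvPolynomial.C (16 * 10 ^ 12 / b) *
    ((1 + MvPolynomial.X 0) * (1 + MvPolynomial.X 1) * (1 + MvPolynomial.X 2) *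
      (1 + MvPolynomial.X 3)) ^ 48

theorem eval_widthPolynomial (b x₀ x₁ x₂ x₃ : ℝ) :
    MvPolynomial.eval ![x₀, x₁, x₂, x₃] (widthPolynomial b) =
      16 * 10 ^ 12 / b * ((1 + x₀) * (1 + x₁) * (1 + x₂) * (1 + x₃)) ^ 48 := by
  simp only [widthPolynomial, map_mul, map_pow, map_add, map_one, MvPolynomial.eval_C,
    MvPolynomial.eval_X]
  rfl

/-- The generalization bound for gradient descent on a wide network. -/
theorem measure_not_genError_le_lt {b : ℝ} (hb : 0 < b) (hb1 : b ≤ 1) {d : ℕ} (hd : 1 ≤ d)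
    (X : Measure (EuclideanSpace ℝ (Fin d))) [IsProbabilityMeasure X]
    (hX : ∀ᵐ x ∂X, ‖x‖ = √(d : ℝ)) (p : ℕ) {β : EuclideanSpace ℝ (Fin d)} (hβ : ‖β‖ ≤ 1)
    {n : ℕ} (hn : 1 ≤ n) {δ : ℝ} (hδ : 0 < δ) (hδ2 : δ ≤ 1 / 2) :
    Measure.pi (fun _ : Fin n => X)
      {S | ¬ ∀ c : ℝ, 0 < c →
        (ntkGram S - c • (1 : Matrix (Fin n) (Fin n) ℝ)).PosSemidef →
        ∀ (m : ℕ) (κ η : ℝ) (k : ℕ), Admissible b 1 1 2 (widthPolynomial b) d n p δ c m κ η k →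
          initMeasure m d κ
            {θ | ¬ (genError X (target β p) θ.1
                        (gdIterate η θ.1 S (fun i => target β p (S i)) θ.2 k)
                      ≤ 3000 * ((d : ℝ) + 1) * genRate d p n δ ∧
                    (2 ≤ p → Even p →
                      genError X (target β p) θ.1
                        (gdIterate η θ.1 S (fun i => target β p (S i)) θ.2 k)
                      ≤ 3000 * genRate d p n δ))}
            < ENNReal.ofReal δ}
      < ENNReal.ofReal δ := by
  obtain ⟨Φ, hΦ, hΦD, hΦK, hw⟩ := exists_featureMap hd
  obtain ⟨w, hwn, hw⟩ := hw p β hβ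
  -- The good event for the sample does not involve `c`, `m`, `κ`, `η` or `k`, so one event serves
  -- all of them. The sets are compared by inclusion.
  refine (measure_mono fun S hS => ?_).trans_lt
    (measure_not_sample_good_lt hd hn hX hΦ hΦD hδ hδ2)
  rw [Set.mem_ofPred_eq] at hS ⊢
  refine mt ?_ hS
  rintro ⟨hsph, hdev⟩ c hc hpsd m κ η k ⟨hκ, hκb, hκB, hη, hηc, hm, hk⟩
  rw [one_mul] at hκB hηc
  have hT := scaleBound (n := n) (p := p) hd hc hδ
  rw [eval_widthPolynomial] at hm
  refine (measure_mono fun θ hθ => ?_).trans_lt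
    (measure_not_initGood_lt hn hd hc hδ hκ hT hb hb1 hκb hm hX hsph)
  rw [Set.mem_ofPred_eq] at hθ ⊢
  refine mt (fun hgood => ?_) hθ
  have h := genError_le_of_initGood hn hd hc hδ hδ2 hκB hη hηc hT hX hΦ hΦD hΦK hβ hw hwn hsph hdev
    hpsd hgood hk
  obtain ⟨h1, h2⟩ := rate_le_genRate (p := p) (n := n) hd δ
  exact ⟨h.trans h1, fun hp he => h.trans (h2 hp he)⟩

theorem mainTheorem5 :
    -- the target is linear in the feature vector, with the stated coefficient vector
    (∀ (d : ℕ), 1 ≤ d → ∀ (p : ℕ) (β : EuclideanSpace ℝ (Fin d)), ‖β‖ ≤ 1 →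
      0 < featureCoeff d p ∧
      ∀ x : EuclideanSpace ℝ (Fin d),
        HasSum (fun k : ℕ => ∑ i, featureVec x k i * targetVec β p k i) (target β p x)) ∧
    -- non-parallel data points have a positive definite Gram matrix, so that `c` below exists
    (∀ (d n : ℕ) (S : Fin n → EuclideanSpace ℝ (Fin d)), 1 ≤ d →
      (∀ i, ‖S i‖ = √(d : ℝ)) → (∀ i j, i ≠ j → LinearIndependent ℝ ![S i, S j]) →
      (ntkGram S).PosDef) ∧
    -- the generalization bound
    (∃ C B C₂ C₃ : ℝ, 0 < C ∧ 0 < B ∧ 0 < C₂ ∧ 0 < C₃ ∧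
      ∀ b : ℝ, 0 < b → b ≤ B → ∃ P : MvPolynomial (Fin 4) ℝ,
      ∀ (d : ℕ), 1 ≤ d →
      ∀ (X : Measure (EuclideanSpace ℝ (Fin d))), IsProbabilityMeasure X →
        (∀ᵐ x ∂X, ‖x‖ = √(d : ℝ)) →
      ∀ (p : ℕ) (β : EuclideanSpace ℝ (Fin d)), ‖β‖ ≤ 1 →
      ∀ (n : ℕ), 1 ≤ n → ∀ (δ : ℝ), 0 < δ → δ ≤ 1 / 2 →
        Measure.pi (fun _ : Fin n => X)
          {S | ¬ ∀ c : ℝ, 0 < c →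
            (ntkGram S - c • (1 : Matrix (Fin n) (Fin n) ℝ)).PosSemidef →
            ∀ (m : ℕ) (κ η : ℝ) (k : ℕ), Admissible b B C₂ C₃ P d n p δ c m κ η k →
              initMeasure m d κ
                {θ | ¬ (genError X (target β p) θ.1
                            (gdIterate η θ.1 S (fun i => target β p (S i)) θ.2 k)
                          ≤ C * ((d : ℝ) + 1) * genRate d p n δ ∧
                        (2 ≤ p → Even p →
                          genError X (target β p) θ.1
                            (gdIterate η θ.1 S (fun i => target β p (S i)) θ.2 k)
                          ≤ C * genRate d p n δ))}
                < ENNReal.ofReal δ}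
          < ENNReal.ofReal δ) ∧
    -- polynomial functions are dense in the continuous functions on the input space
    (∀ (d : ℕ), 1 ≤ d → ∀ g : EuclideanSpace ℝ (Fin d) → ℝ,
      ContinuousOn g (Metric.sphere 0 (√(d : ℝ))) → ∀ ε : ℝ, 0 < ε →
      ∃ q : MvPolynomial (Fin d) ℝ, ∀ x ∈ Metric.sphere (0 : EuclideanSpace ℝ (Fin d)) (√(d : ℝ)),
        |MvPolynomial.eval (fun i => x i) q - g x| < ε) := by
  refine ⟨fun d hd p β _ => ⟨featureCoeff_pos hd p, hasSum_featureVec_mul_targetVec hd p β⟩,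
    fun d n S hd hS hind => ntkGram_posDef hd hS hind,
    ⟨3000, 1, 1, 2, by norm_num, one_pos, one_pos, two_pos, fun b hb hb1 =>
      ⟨widthPolynomial b, fun d hd X _ hX p β hβ n hn δ hδ hδ2 =>
        measure_not_genError_le_lt hb hb1 hd X hX p hβ hn hδ hδ2⟩⟩,
    fun d _ g hg ε hε => exists_mvPolynomial_near_on_sphere g hg hε⟩
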